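/- Let $V=(V_1,\dots,V_M)$ be jointly Gaussian with zero means and unit variances, and let $X$ and $Y$ be subvectors of $V$ (possibly overlapping) with $P$ and $Q$ entries, whose covariance matrices are nonsingular; assume that no two distinct variables of $V$ are perfectly correlated. Let $D\in\mathbb R^{N\times M}$ hold $N$ i.i.d. observations of $V$, and let $\tilde D$ be the accessible data: each column is either the column of $D$ or its discretization, $\tilde D_{n,j}=t$ if $T^j_t<D_{n,j}\le T^j_{t+1}$, $t=1,\dots,C_j$, with unknown thresholds $-\infty=T^j_1<\dots<T^j_{C_j+1}=\infty$ and $C_j\ge 2$. Write $D^X,D^Y,\tilde D^X,\tilde D^Y$ for the columns of $X$ and $Y$. For a data matrix with $m$ columns, the maximum pairwise likelihood estimate of the correlation matrix is a minimizer $R$, over the positive semidefinite matrices with unit diagonal (and off-diagonal entries in $(-1,1)$), of $-\sum_{i<j}\log p_{ij}(R_{ij})$. For two continuous columns with empirical correlation $\hat\rho$ (of mean-zero variables, $\hat\rho=u^Tv/\sqrt{u^Tu\,v^Tv}$), $\log p_{ij}(\rho)=-\frac12\big(\operatorname{tr}\big(\begin{bmatrix}1&\rho\\ \rho&1\end{bmatrix}^{-1}\begin{bmatrix}1&\hat\rho\\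 \hat\rho&1\end{bmatrix}\big)+\log\det\begin{bmatrix}1&\rho\\ \rho&1\end{bmatrix}\big)$. For a continuous and a discretized column, and for two discretized columns, it is the average polyserial, respectively polychoric, log-likelihood of the correlation $\rho$ of a standard bivariate Gaussian pair, in which the thresholds are replaced by $\hat T_{t+1}=\Phi^{-1}\big(\frac1N\#\{n:\tilde D_{n,j}\le t\}\big)$. Let $\tilde R$ be this estimate from $\tilde D$, with blocks $\tilde\Sigma_X,\tilde\Sigma_{X,Y},\tilde\Sigma_Y$. Let $K=\min(P,Q)$, let $\tilde\Sigma_X^{-1/2}\tilde\Sigma_{X,Y}\tilde\Sigma_Y^{-1/2}=USV$ be any singular value decomposition (thin, with $S$ of size $K\times K$), and put $A=(\tilde\Sigma_X^{-1/2})^TU$, $B=(\tilde\Sigma_Y^{-1/2})^TV^T$. Fix $0\le k<K$; a subscript $k{:}$ means that the first $k$ indices are left out. For an $N\times N$ permutation matrix $P_\sigma$, let $\hat\Sigma_{{C_X}_{k:}}$, $\hat\Sigma_{{C_X}_{k:},{C_Y}_{k:}}$, $\hat\Sigma_{{C_Y}_{k:}}$ be the sample (cross-)covariances (products divided by $N-1$)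 of the data $(P_\sigma D^XA)_{:,k:}$ and $(D^YB)_{:,k:}$, and let $\hat r_1\ge\dots\ge\hat r_{K-k}$ be their empirical CCA scores: the diagonal of $G^T\hat\Sigma_{{C_X}_{k:},{C_Y}_{k:}}H$ for a solution $(G,H)$, at which this matrix is diagonal, of the problem of maximizing $\operatorname{tr}(G^T\hat\Sigma_{{C_X}_{k:},{C_Y}_{k:}}H)$ subject to $G^T\hat\Sigma_{{C_X}_{k:}}G=H^T\hat\Sigma_{{C_Y}_{k:}}H=I$. Then: 1. For every permutation, whenever $\hat\Sigma_{{C_X}_{k:}}$ and $\hat\Sigma_{{C_Y}_{k:}}$ are nonsingular, the $\hat r_i$ exist and are exactly the singular values of $W=\hat\Sigma_{{C_X}_{k:}}^{-1/2}\hat\Sigma_{{C_X}_{k:},{C_Y}_{k:}}\hat\Sigma_{{C_Y}_{k:}}^{-1/2}$. Moreover, always $$W=((A^T\hat\Sigma_XA)_{k:,k:})^{-1/2}\Big(A^T\tfrac{{D^X}^TP_\sigma^TD^Y}{N-1}B\Big)_{k:,k:}((B^T\hat\Sigma_YB)_{k:,k:})^{-1/2},$$ where $\hat\Sigma_X={D^X}^TD^X/(N-1)$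 and $\hat\Sigma_Y={D^Y}^TD^Y/(N-1)$. 2. Let now $P_\sigma$ be uniformly distributed on the $N\times N$ permutation matrices and independent of $D$, and let $N\to\infty$. With probability tending to one, the two covariance matrices in (1) are nonsingular and the estimate $\tilde R$ from $\tilde D$ and the estimate $\tilde R^{\sigma}$ from the data matrix $[\tilde D^X,\;P_\sigma^T\tilde D^Y]$ with $P+Q$ columns exist. The $X$-$Y$ block $\tilde\Sigma^\sigma_{X,Y}$ of $\tilde R^{\sigma}$ is a consistent estimate of ${D^X}^TP_\sigma^TD^Y/(N-1)$: their difference tends to zero in probability, entrywise. 3. In the same sense, $((A^T\tilde\Sigma_XA)_{k:,k:})^{-1/2}(A^T\tilde\Sigma^\sigma_{X,Y}B)_{k:,k:}((B^T\tilde\Sigma_YB)_{k:,k:})^{-1/2}$ is a consistent estimate of $W$, and its singular values are consistent estimates of $\hat r_1,\dots,\hat r_{K-k}$. -/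

import Mathlib

open MeasureTheory ProbabilityTheory Filter Topology Matrix
open scoped ENNReal Nat

noncomputable section

/-! ### Canonical correlation analysis -/

/-- The sample cross-covariance `D₁ᵀ D₂ / (N - 1)` of two data matrices (variables with mean zero). -/
def sampleCov {N p q : ℕ} (D₁ : Matrix (Fin N) (Fin p) ℝ) (D₂ : Matrix (Fin N) (Fin q) ℝ) :
    Matrix (Fin p) (Fin q) ℝ :=
  ((N : ℝ) - 1)⁻¹ • (D₁ᵀ * D₂)

/-- The symmetric inverse square root `S^(-1/2)`, by functional calculus on the eigenvalues. -/
def invSqrt {n : ℕ} (S : Matrix (Fin n) (Fin n) ℝ) : Matrix (Fin n) (Fin n) ℝ :=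
  cfc (fun x : ℝ => (√x)⁻¹) S

/-- The singular values of a matrix, in decreasing order (the index starts at `0`). -/
def singVal {p q : ℕ} (W : Matrix (Fin p) (Fin q) ℝ) (i : ℕ) : ℝ :=
  (Matrix.toEuclideanLin W).singularValues i

/-- The whitened cross-covariance `Sx^(-1/2) Sxy Sy^(-1/2)`. -/
def whitened {p q : ℕ} (Sx : Matrix (Fin p) (Fin p) ℝ) (Sxy : Matrix (Fin p) (Fin q) ℝ)
    (Sy : Matrix (Fin q) (Fin q) ℝ) : Matrix (Fin p) (Fin q) ℝ :=
  invSqrt Sx * Sxy * invSqrt Sy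

/-- The constraint of the CCA problem. -/
def CCAFeasible {p q d : ℕ} (Sx : Matrix (Fin p) (Fin p) ℝ) (Sy : Matrix (Fin q) (Fin q) ℝ)
    (A : Matrix (Fin p) (Fin d) ℝ) (B : Matrix (Fin q) (Fin d) ℝ) : Prop :=
  Aᵀ * Sx * A = 1 ∧ Bᵀ * Sy * B = 1

/-- `(A, B)` solves the CCA problem: maximize `tr (Aᵀ Sxy B)` subject to
`Aᵀ Sx A = Bᵀ Sy B = I`. -/
def IsCCASolution {p q d : ℕ} (Sx : Matrix (Fin p) (Fin p) ℝ) (Sxy : Matrix (Fin p) (Fin q) ℝ)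
    (Sy : Matrix (Fin q) (Fin q) ℝ)
    (A : Matrix (Fin p) (Fin d) ℝ) (B : Matrix (Fin q) (Fin d) ℝ) : Prop :=
  CCAFeasible Sx Sy A B ∧
    ∀ (A' : Matrix (Fin p) (Fin d) ℝ) (B' : Matrix (Fin q) (Fin d) ℝ),
      CCAFeasible Sx Sy A' B' → (A'ᵀ * Sxy * B').trace ≤ (Aᵀ * Sxy * B).trace

/-- `r` is the decreasing list of CCA scores: the diagonal of `Aᵀ Sxy B` for a solution `(A, B)` of
the CCA problem at which this cross-covariance of the canonical variables is diagonal.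
(`d` is to be the minimum of `p` and `q`.) -/
def IsCCAScores {p q d : ℕ} (Sx : Matrix (Fin p) (Fin p) ℝ) (Sxy : Matrix (Fin p) (Fin q) ℝ)
    (Sy : Matrix (Fin q) (Fin q) ℝ) (r : Fin d → ℝ) : Prop :=
  Antitone r ∧ ∃ (A : Matrix (Fin p) (Fin d) ℝ) (B : Matrix (Fin q) (Fin d) ℝ),
    IsCCASolution Sx Sxy Sy A B ∧ Aᵀ * Sxy * B = Matrix.diagonal r

/-- `W = U diag(s) V` is a (thin) singular value decomposition. -/
def IsSVD {p q K : ℕ} (W : Matrix (Fin p) (Fin q) ℝ) (U : Matrix (Fin p) (Fin K) ℝ)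
    (s : Fin K → ℝ) (V : Matrix (Fin K) (Fin q) ℝ) : Prop :=
  Uᵀ * U = 1 ∧ V * Vᵀ = 1 ∧ Antitone s ∧ (∀ i, 0 ≤ s i) ∧ W = U * Matrix.diagonal s * V

/-- `A = Sx^(-1/2)ᵀ U` and `B = Sy^(-1/2)ᵀ Vᵀ`, where `U S V` is a singular value decomposition of
`Sx^(-1/2) Sxy Sy^(-1/2)`. -/
def IsCCAProjection {p q K : ℕ} (Sx : Matrix (Fin p) (Fin p) ℝ) (Sxy : Matrix (Fin p) (Fin q) ℝ)
    (Sy : Matrix (Fin q) (Fin q) ℝ)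
    (A : Matrix (Fin p) (Fin K) ℝ) (B : Matrix (Fin q) (Fin K) ℝ) : Prop :=
  ∃ (U : Matrix (Fin p) (Fin K) ℝ) (s : Fin K → ℝ) (V : Matrix (Fin K) (Fin q) ℝ),
    IsSVD (whitened Sx Sxy Sy) U s V ∧ A = (invSqrt Sx)ᵀ * U ∧ B = (invSqrt Sy)ᵀ * Vᵀ

/-- The indices from `k` on: `i ↦ k + i`. -/
def tailIdx {K : ℕ} (k : ℕ) (i : Fin (K - k)) : Fin K := ⟨k + i, by omega⟩

/-- `C_{:, k:}`: all columns but the first `k`. -/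
def tailCols {N K : ℕ} (k : ℕ) (C : Matrix (Fin N) (Fin K) ℝ) : Matrix (Fin N) (Fin (K - k)) ℝ :=
  C.submatrix id (tailIdx k)

/-- `S_{k:, k:}`: the block without the first `k` rows and columns. -/
def tailBlock {K : ℕ} (k : ℕ) (S : Matrix (Fin K) (Fin K) ℝ) :
    Matrix (Fin (K - k)) (Fin (K - k)) ℝ :=
  S.submatrix (tailIdx k) (tailIdx k)

/-- The expression
`((Aᵀ SX A)_{k:,k:})^(-1/2) (Aᵀ SXY B)_{k:,k:} ((Bᵀ SY B)_{k:,k:})^(-1/2)`. -/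
def scoreMatrix {p q K : ℕ} (k : ℕ) (A : Matrix (Fin p) (Fin K) ℝ) (B : Matrix (Fin q) (Fin K) ℝ)
    (SX : Matrix (Fin p) (Fin p) ℝ) (SXY : Matrix (Fin p) (Fin q) ℝ)
    (SY : Matrix (Fin q) (Fin q) ℝ) : Matrix (Fin (K - k)) (Fin (K - k)) ℝ :=
  invSqrt (tailBlock k (Aᵀ * SX * A)) * tailBlock k (Aᵀ * SXY * B) *
    invSqrt (tailBlock k (Bᵀ * SY * B))

/-! ### Data and discretization -/

/-- The value `t ∈ {1, …, C}` with `T t < x ≤ T (t + 1)`. -/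
def discretize (C : ℕ) (T : ℕ → EReal) (x : ℝ) : ℝ :=
  open Classical in
  ∑ t ∈ Finset.Icc 1 C, if T t < (x : EReal) ∧ (x : EReal) ≤ T (t + 1) then (t : ℝ) else 0

/-- `T 1, …, T (C + 1)` are the thresholds of a discretization with `C` levels. -/
def IsThresholds (C : ℕ) (T : ℕ → EReal) : Prop :=
  T 1 = ⊥ ∧ T (C + 1) = ⊤ ∧ StrictMonoOn T (Set.Icc 1 (C + 1))

/-- The data matrix of the first `N` observations. -/
def dataMatrix {Ω : Type*} {M : ℕ} (Z : ℕ → Ω → Fin M → ℝ) (N : ℕ) (ω : Ω) :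
    Matrix (Fin N) (Fin M) ℝ :=
  Matrix.of fun n j => Z n ω j

/-- The accessible data: column `j` is discretized if `disc j`, and unchanged otherwise. -/
def observe {N M : ℕ} (disc : Fin M → Bool) (C : Fin M → ℕ) (T : Fin M → ℕ → EReal)
    (D : Matrix (Fin N) (Fin M) ℝ) : Matrix (Fin N) (Fin M) ℝ :=
  Matrix.of fun n j => if disc j then discretize (C j) (T j) (D n j) else D n j

/-- The columns of the variables listed by `e`. -/
def cols {N M p : ℕ} (e : Fin p → Fin M) (D : Matrix (Fin N) (Fin M) ℝ) :
    Matrix (Fin N) (Fin p) ℝ :=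
  D.submatrix id e

/-- Two data matrices side by side. -/
def sideBySide {N p q : ℕ} (D₁ : Matrix (Fin N) (Fin p) ℝ) (D₂ : Matrix (Fin N) (Fin q) ℝ) :
    Matrix (Fin N) (Fin (p + q)) ℝ :=
  Matrix.of fun n => Fin.append (D₁ n) (D₂ n)

/-- The data matrix `(P D^X A)_{:, k:}` of the last canonical variables of `X`, with the rows
permuted by the permutation matrix `P` of `τ`. -/
def canonX {N M p K : ℕ} (k : ℕ) (X : Fin p → Fin M) (A : Matrix (Fin p) (Fin K) ℝ)
    (τ : Equiv.Perm (Fin N)) (D : Matrix (Fin N) (Fin M) ℝ) : Matrix (Fin N) (Fin (K - k)) ℝ :=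
  tailCols k (τ.permMatrix ℝ * cols X D * A)

/-- The data matrix `(D^Y B)_{:, k:}` of the last canonical variables of `Y`. -/
def canonY {N M q K : ℕ} (k : ℕ) (Y : Fin q → Fin M) (B : Matrix (Fin q) (Fin K) ℝ)
    (D : Matrix (Fin N) (Fin M) ℝ) : Matrix (Fin N) (Fin (K - k)) ℝ :=
  tailCols k (cols Y D * B)

/-- The permuted cross-product `(D^X)ᵀ Pᵀ D^Y / (N - 1)`. -/
def permCrossProduct {N M p q : ℕ} (X : Fin p → Fin M) (Y : Fin q → Fin M)
    (τ : Equiv.Perm (Fin N)) (D : Matrix (Fin N) (Fin M) ℝ) : Matrix (Fin p) (Fin q) ℝ :=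
  ((N : ℝ) - 1)⁻¹ • ((cols X D)ᵀ * (τ.permMatrix ℝ)ᵀ * cols Y D)

/-- The columns of `D` for `X` next to the permuted columns `Pᵀ D^Y` for `Y`. -/
def permData {N M p q : ℕ} (X : Fin p → Fin M) (Y : Fin q → Fin M)
    (τ : Equiv.Perm (Fin N)) (D : Matrix (Fin N) (Fin M) ℝ) : Matrix (Fin N) (Fin (p + q)) ℝ :=
  sideBySide (cols X D) ((τ.permMatrix ℝ)ᵀ * cols Y D)

/-! ### Pairwise maximum likelihood estimation of correlations (mean zero, unit variance) -/

/-- The standard normal distribution function on `[-∞, ∞]`. -/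
def stdCdf (a : EReal) : ℝ := (gaussianReal 0 1).real {x | (x : EReal) ≤ a}

/-- The inverse of the standard normal distribution function, with values in `[-∞, ∞]`. -/
def stdQuantile (u : ℝ) : EReal := sInf {a | u ≤ stdCdf a}

/-- The joint distribution function of two standard normal variables with correlation `ρ`. -/
def stdCdf₂ (a b : EReal) (ρ : ℝ) : ℝ :=
  ((gaussianReal 0 1).prod (gaussianReal 0 1)).real
    {z : ℝ × ℝ | (z.1 : EReal) ≤ a ∧ ((ρ * z.1 + √(1 - ρ ^ 2) * z.2 : ℝ) : EReal) ≤ b}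

/-- The estimate of the threshold `T_t` from a discretized column `v`: the standard normal quantile
at the frequency of `v ≤ t - 1`. -/
def estThreshold {N : ℕ} (v : Fin N → ℝ) (t : ℝ) : EReal :=
  open Classical in
  stdQuantile (((Finset.univ.filter fun n => v n ≤ t - 1).card : ℝ) / N)

/-- The empirical correlation of two columns of mean zero variables. -/
def empCorr {N : ℕ} (u v : Fin N → ℝ) : ℝ := (u ⬝ᵥ v) / √((u ⬝ᵥ u) * (v ⬝ᵥ v))

/-- The `2 × 2` correlation matrix with correlation `ρ`. -/
def corr₂ (ρ : ℝ) : Matrix (Fin 2) (Fin 2) ℝ := !![1, ρ; ρ, 1]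

/-- Log-likelihood (up to a constant) of the correlation `ρ` for two continuous columns. -/
def logLikCC {N : ℕ} (u v : Fin N → ℝ) (ρ : ℝ) : ℝ :=
  -((1 / 2) * (((corr₂ ρ)⁻¹ * corr₂ (empCorr u v)).trace + Real.log (corr₂ ρ).det))

/-- Log-likelihood of the correlation `ρ` for a continuous column `u` and a discretized column `v`
(polyserial). -/
def logLikCD {N : ℕ} (u v : Fin N → ℝ) (ρ : ℝ) : ℝ :=
  (1 / N) * ∑ n, Real.log (gaussianPDFReal 0 1 (u n) *
    (stdCdf ((estThreshold v (v n + 1) - ((ρ * u n : ℝ) : EReal)) / ((√(1 - ρ ^ 2) : ℝ) : EReal)) -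
      stdCdf ((estThreshold v (v n) - ((ρ * u n : ℝ) : EReal)) / ((√(1 - ρ ^ 2) : ℝ) : EReal))))

/-- Log-likelihood of the correlation `ρ` for two discretized columns (polychoric). -/
def logLikDD {N : ℕ} (u v : Fin N → ℝ) (ρ : ℝ) : ℝ :=
  (1 / N) * ∑ n, Real.log
    (stdCdf₂ (estThreshold u (u n + 1)) (estThreshold v (v n + 1)) ρ
      + stdCdf₂ (estThreshold u (u n)) (estThreshold v (v n)) ρ
      - stdCdf₂ (estThreshold u (u n + 1)) (estThreshold v (v n)) ρ
      - stdCdf₂ (estThreshold u (u n)) (estThreshold v (v n + 1)) ρ)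

/-- The pairwise log-likelihood; the flags tell which of the two columns are discretized. -/
def pairLogLik {N : ℕ} (du dv : Bool) (u v : Fin N → ℝ) (ρ : ℝ) : ℝ :=
  match du, dv with
  | false, false => logLikCC u v ρ
  | false, true => logLikCD u v ρ
  | true, false => logLikCD v u ρ
  | true, true => logLikDD u v ρ

/-- The objective: the negative pairwise log-likelihood, summed over the pairs `i < j`. -/
def pseudoLoss {N m : ℕ} (disc : Fin m → Bool) (D : Matrix (Fin N) (Fin m) ℝ)
    (R : Matrix (Fin m) (Fin m) ℝ) : ℝ :=
  -∑ i, ∑ j ∈ Finset.Ioi i,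
    pairLogLik (disc i) (disc j) (fun n => D n i) (fun n => D n j) (R i j)

/-- Positive semidefinite matrices with unit diagonal at which every pairwise likelihood is defined
(that is, whose entries off the diagonal lie strictly between `-1` and `1`). -/
def IsPseudoCorrelation {m : ℕ} (R : Matrix (Fin m) (Fin m) ℝ) : Prop :=
  R.PosSemidef ∧ (∀ i, R i i = 1) ∧ ∀ i j, i ≠ j → |R i j| < 1

/-- `R` is a maximum pairwise likelihood estimate of the correlation matrix. -/
def IsPairwiseMLE {N m : ℕ} (disc : Fin m → Bool) (D : Matrix (Fin N) (Fin m) ℝ)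
    (R : Matrix (Fin m) (Fin m) ℝ) : Prop :=
  IsPseudoCorrelation R ∧ ∀ R', IsPseudoCorrelation R' → pseudoLoss disc D R ≤ pseudoLoss disc D R'

/-! ### Asymptotics -/

/-- `est` estimates the (possibly random and `N`-dependent) quantity `target` consistently: their
difference tends to zero in probability. -/
def ConsistentlyEstimates {Ω : Type*} [MeasurableSpace Ω] (μ : Measure Ω)
    (est target : ℕ → Ω → ℝ) : Prop :=
  ∀ ε : ℝ, 0 < ε → Tendsto (fun N => μ {ω | ε ≤ |est N ω - target N ω|}) atTop (𝓝 0)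

/-- `p N ω` holds with probability tending to one. -/
def WithProbTendingToOne {Ω : Type*} [MeasurableSpace Ω] (μ : Measure Ω)
    (p : ℕ → Ω → Prop) : Prop :=
  Tendsto (fun N => μ {ω | ¬ p N ω}) atTop (𝓝 0)

/-- The population covariance matrix. -/
def popCov {Ω : Type*} [MeasurableSpace Ω] {M : ℕ} (μ : Measure Ω) (V : Ω → Fin M → ℝ) :
    Matrix (Fin M) (Fin M) ℝ :=
  Matrix.of fun i j => covariance (fun ω => V ω i) (fun ω => V ω j) μ

/-- `σ` is uniformly distributed on the permutations of `Fin N`, and independent of `D`. -/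
def IsUniformIndepPerm {Ω : Type*} [MeasurableSpace Ω] (μ : Measure Ω) {N M : ℕ}
    (σ : Ω → Equiv.Perm (Fin N)) (D : Ω → Fin N → Fin M → ℝ) : Prop :=
  ∀ τ : Equiv.Perm (Fin N), MeasurableSet {ω | σ ω = τ} ∧
    μ {ω | σ ω = τ} = ((N ! : ℕ) : ℝ≥0∞)⁻¹ ∧
    ∀ E : Set (Fin N → Fin M → ℝ), MeasurableSet E →
      μ ({ω | σ ω = τ} ∩ D ⁻¹' E) = μ {ω | σ ω = τ} * μ (D ⁻¹' E)

end

set_option linter.unusedSectionVars false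

/-! Parts 2 and 3 rest on one observation: every quantity that is compared there tends to zero in
probability. A uniform permutation independent of the data destroys the dependence between the `X`
rows and the `Y` rows, so the permuted cross-product tends to zero, and so does the `X`-`Y` block of
the correlation estimate computed from the permuted accessible data. The projections `A`, `B` need
not converge, since singular vectors are not unique, but they stay bounded: they satisfy `Aᵀ R A =
1` for estimates `R` that converge to a positive definite matrix. For the same reason `Aᵀ S A` tends
to the identity for every consistent `S`, which gives the nonsingularity and bounds the inverse
square roots. Both score matrices are therefore a bounded matrix times one that vanishes times a
bounded matrix, and their singular values vanish as well (`tendsto_scoreMatrix_zero`,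
`tendsto_singVal_zero`).

Part 1 is linear algebra. The substitution `G = S^(-1/2) O` turns the CCA constraint into
orthogonality and the objective into `tr (Oᵀ W O')`; von Neumann's trace inequality, together with a
sign flip that excludes negative diagonal entries, identifies the diagonal at an optimum with the
singular values (`isCCAScores_iff_singVal`). The explicit formula for `W` only uses that a
permutation matrix is orthogonal.

The substantial point is that the maximum pairwise likelihood estimate exists with probability
tending to one and is consistent. Convergence in probability is convergence along the filter
`probFilter` on pairs `(N, ω)`. Along a finer ultrafilter the bounded correlations of any candidate
converge, possibly to the boundary values `±1`. `Separates` says that a pairwise likelihood then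
falls short of its value at the true `ρ₀` by a fixed amount, unless the limit is `ρ₀`. Summing over
the pairs, a candidate that is at least as good as the truth must converge to the truth
(`tendsto_of_separates`); applied to hypothetical better competitors, this also yields existence
(`eventually_exists_minimizer`).

Separation is shown for the three likelihoods from a law of large numbers for functions of at most
quadratic growth (`PairLLN`). For two continuous columns the likelihood is explicit. For two
discretized columns, Gibbs' inequality leaves the misfit of the first cell as a gap, and the
probability of that cell is strictly increasing in the correlation. For a mixed pair, Gibbs'
inequality is applied conditionally on the continuous variable, after a truncation; at the boundary,
a cell that is observed with positive frequency becomes almost impossible. The law of large numbers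
for permuted columns is a second moment estimate, in which the fixed points of the permutation do no
harm because there is on average one of them (`IsGaussianSample.pairLLN_perm`). -/

noncomputable section

/-! ### The filter of events whose probability tends to one -/

section ProbFilter

variable {Ω : Type*} [MeasurableSpace Ω]

/-- The filter of the sets of pairs `(N, ω)` whose section at `N` has probability tending to one.
Convergence in probability is convergence along this filter. -/
def probFilter (μ : Measure Ω) : Filter (ℕ × Ω) where
  sets := {S | Tendsto (fun N => μ {ω | (N, ω) ∉ S}) atTop (𝓝 0)}
  univ_sets := by simp
  sets_of_superset := by
    intro S T hS hST
    refine tendsto_of_tendsto_of_tendsto_of_le_of_le tendsto_const_nhds hS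
      (fun _ => zero_le) fun N => measure_mono fun ω hω h => hω (hST h)
  inter_sets := by
    intro S T hS hT
    have h := Tendsto.add hS hT
    rw [add_zero] at h
    refine tendsto_of_tendsto_of_tendsto_of_le_of_le tendsto_const_nhds h
      (fun _ => zero_le) fun N => ?_
    refine (measure_mono ?_).trans (measure_union_le _ _)
    intro ω hω
    simp only [Set.mem_ofPred_eq, Set.mem_union, Set.mem_inter_iff] at hω ⊢
    tauto

theorem eventually_probFilter_iff {μ : Measure Ω} {p : ℕ × Ω → Prop} :
    (∀ᶠ x in probFilter μ, p x) ↔ Tendsto (fun N => μ {ω | ¬ p (N, ω)}) atTop (𝓝 0) :=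
  Iff.rfl

theorem withProbTendingToOne_iff {μ : Measure Ω} {p : ℕ → Ω → Prop} :
    WithProbTendingToOne μ p ↔ ∀ᶠ x in probFilter μ, p x.1 x.2 :=
  Iff.rfl

theorem consistentlyEstimates_iff {μ : Measure Ω} {f g : ℕ → Ω → ℝ} :
    ConsistentlyEstimates μ f g ↔
      Tendsto (fun x : ℕ × Ω => f x.1 x.2 - g x.1 x.2) (probFilter μ) (𝓝 0) := by
  rw [Metric.tendsto_nhds]
  refine forall₂_congr fun ε _ => ?_
  rw [eventually_probFilter_iff]
  simp

theorem tendsto_fst_probFilter (μ : Measure Ω) : Tendsto Prod.fst (probFilter μ) atTop := by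
  rw [tendsto_atTop]
  intro b
  rw [eventually_probFilter_iff]
  refine tendsto_const_nhds.congr' ?_
  filter_upwards [eventually_ge_atTop b] with N hN
  simp [hN]

theorem eventually_fst_ge_probFilter (μ : Measure Ω) (n : ℕ) :
    ∀ᶠ x in probFilter μ, n ≤ x.1 :=
  (tendsto_fst_probFilter μ).eventually (eventually_ge_atTop n)

theorem tendsto_probFilter_of_tendstoInMeasure {μ : Measure Ω} {f : ℕ → Ω → ℝ} {c : ℝ}
    (h : TendstoInMeasure μ f atTop (fun _ => c)) :
    Tendsto (fun x : ℕ × Ω => f x.1 x.2) (probFilter μ) (𝓝 c) := by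
  rw [Metric.tendsto_nhds]
  intro ε hε
  rw [eventually_probFilter_iff]
  have := tendstoInMeasure_iff_dist.1 h ε hε
  simpa using this

/-- A bounded real function has a limit along every ultrafilter. -/
theorem exists_tendsto_of_eventually_abs_le {α : Type*} (u : Ultrafilter α) {f : α → ℝ} {c : ℝ}
    (h : ∀ᶠ x in (u : Filter α), |f x| ≤ c) :
    ∃ a, |a| ≤ c ∧ Tendsto f u (𝓝 a) := by
  obtain ⟨a, ha, hle⟩ := (isCompact_Icc (a := -c) (b := c)).ultrafilter_le_nhds (u.map f) (by
    rw [le_principal_iff]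
    exact h.mono fun x hx => abs_le.1 hx)
  exact ⟨a, abs_le.2 ha, hle⟩

/-- To show that a property holds along a filter it is enough to refute its negation along every
finer ultrafilter. -/
theorem eventually_of_forall_ultrafilter {α : Type*} {l : Filter α} {p : α → Prop}
    (h : ∀ u : Ultrafilter α, (u : Filter α) ≤ l → ¬ ∀ᶠ x in (u : Filter α), ¬ p x) :
    ∀ᶠ x in l, p x := by
  by_contra hp
  have hne : NeBot (l ⊓ 𝓟 {x | ¬ p x}) := by
    rw [← frequently_iff_neBot]
    exact not_eventually.1 hp
  refine h (Ultrafilter.of (l ⊓ 𝓟 {x | ¬ p x})) ((Ultrafilter.of_le _).trans inf_le_left) ?_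
  exact ((Ultrafilter.of_le _).trans inf_le_right) (mem_principal_self _)

end ProbFilter

/-! ### Bivariate Gaussian distribution functions -/

section Gaussian

theorem gaussianReal_singleton (t : ℝ) : gaussianReal 0 1 {t} = 0 := by
  have := nullSingletonClass_gaussianReal (μ := 0) (v := 1) one_ne_zero
  exact measure_singleton t

/-- A family of probabilities `ν (E p)` is continuous at `p₀` if almost every point keeps its
position relative to `E p₀` near `p₀`. -/
theorem tendsto_measureReal_of_ae_eventually_iff {S ι : Type*} [MeasurableSpace S]
    {l : Filter ι} [l.IsCountablyGenerated] {ν : Measure S} [IsFiniteMeasure ν]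
    {E : ι → Set S} {A : Set S} (hE : ∀ p, MeasurableSet (E p)) (hA : MeasurableSet A)
    (h : ∀ᵐ z ∂ν, ∀ᶠ p in l, (z ∈ E p ↔ z ∈ A)) :
    Tendsto (fun p => ν.real (E p)) l (𝓝 (ν.real A)) :=
  (ENNReal.tendsto_toReal (measure_ne_top ν A)).comp
    (tendsto_measure_of_ae_tendsto_indicator_of_isFiniteMeasure l hA hE h)

theorem eventually_coe_le_iff {ι : Type*} {l : Filter ι} {f : ι → ℝ} {a : ι → EReal} {c : ℝ}
    {b : EReal} (hf : Tendsto f l (𝓝 c)) (ha : Tendsto a l (𝓝 b)) (hcb : (c : EReal) ≠ b) :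
    ∀ᶠ p in l, ((f p : EReal) ≤ a p ↔ (c : EReal) ≤ b) := by
  have hf' : Tendsto (fun p => (f p : EReal)) l (𝓝 (c : EReal)) :=
    (continuous_coe_real_ereal.tendsto c).comp hf
  rcases hcb.lt_or_gt with h | h
  · filter_upwards [hf'.eventually_lt ha h] with p hp
    simp [hp.le, h.le]
  · filter_upwards [ha.eventually_lt hf' h] with p hp
    simp [not_le.2 hp, not_le.2 h]

theorem measurableSet_coe_le {S : Type*} [MeasurableSpace S] {f : S → ℝ} (hf : Measurable f)
    (a : EReal) : MeasurableSet {z | (f z : EReal) ≤ a} :=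
  measurableSet_le (measurable_coe_real_ereal.comp hf) measurable_const

/-- The conditional distribution function at `T` of the second of two standard normal variables
with correlation `ρ`, given that the first is `x`. -/
def condCdf (T : EReal) (ρ x : ℝ) : ℝ :=
  (gaussianReal 0 1).real {y : ℝ | ((ρ * x + √(1 - ρ ^ 2) * y : ℝ) : EReal) ≤ T}

theorem condCdf_nonneg (T : EReal) (ρ x : ℝ) : 0 ≤ condCdf T ρ x := measureReal_nonneg

theorem condCdf_le_one (T : EReal) (ρ x : ℝ) : condCdf T ρ x ≤ 1 := measureReal_le_one

theorem condCdf_bot (ρ x : ℝ) : condCdf ⊥ ρ x = 0 := by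
  simp [condCdf, -EReal.coe_add]

theorem condCdf_top (ρ x : ℝ) : condCdf ⊤ ρ x = 1 := by
  simp [condCdf, -EReal.coe_add]

theorem condCdf_mono {T T' : EReal} (h : T ≤ T') (ρ x : ℝ) : condCdf T ρ x ≤ condCdf T' ρ x :=
  measureReal_mono (fun _ hy => le_trans hy h) (measure_ne_top _ _)

theorem sqrt_one_sub_sq_pos {ρ : ℝ} (hρ : |ρ| < 1) : 0 < √(1 - ρ ^ 2) := by
  apply Real.sqrt_pos.2
  have := (sq_lt_one_iff_abs_lt_one ρ).2 hρ
  linarith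

theorem gaussianReal_affine_eq (c t : ℝ) {s : ℝ} (hs : s ≠ 0) :
    gaussianReal 0 1 {y : ℝ | c + s * y = t} = 0 := by
  refine measure_mono_null (fun y hy => ?_) (gaussianReal_singleton ((t - c) / s))
  have : c + s * y = t := hy
  rw [Set.mem_singleton_iff, eq_div_iff hs]
  linarith

theorem gaussianReal_affine_coe_eq (c : ℝ) (T : EReal) {s : ℝ} (hs : s ≠ 0) :
    ∀ᵐ y ∂gaussianReal 0 1, ((c + s * y : ℝ) : EReal) ≠ T := by
  induction T with
  | bot => exact ae_of_all _ fun y => EReal.coe_ne_bot _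
  | top => exact ae_of_all _ fun y => EReal.coe_ne_top _
  | coe t =>
    rw [ae_iff]
    simpa [-EReal.coe_add] using gaussianReal_affine_eq c t hs

/-- If the square root vanishes, the conditional law is the point mass at `ρ * x`, and continuity
can fail only when `T` is that atom. This degenerate case is needed for correlations that tend to
`±1`. -/
theorem continuousAt_condCdf {T : EReal} {ρ x : ℝ}
    (h : √(1 - ρ ^ 2) ≠ 0 ∨ ((ρ * x : ℝ) : EReal) ≠ T) :
    ContinuousAt (fun p : EReal × ℝ × ℝ => condCdf p.1 p.2.1 p.2.2) (T, ρ, x) := by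
  refine tendsto_measureReal_of_ae_eventually_iff
    (fun p => measurableSet_coe_le (by fun_prop) _) (measurableSet_coe_le (by fun_prop) _) ?_
  have hae : ∀ᵐ y ∂gaussianReal 0 1, ((ρ * x + √(1 - ρ ^ 2) * y : ℝ) : EReal) ≠ T := by
    by_cases hs : √(1 - ρ ^ 2) = 0
    · filter_upwards with y
      simpa [hs] using h
    · exact gaussianReal_affine_coe_eq _ _ hs
  filter_upwards [hae] with y hy
  refine eventually_coe_le_iff
    (f := fun p : EReal × ℝ × ℝ => p.2.1 * p.2.2 + √(1 - p.2.1 ^ 2) * y)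
    (a := fun p => p.1) ?_ ?_ hy
  · exact Continuous.tendsto (by fun_prop) (T, ρ, x)
  · exact continuous_fst.tendsto (T, ρ, x)

theorem measurable_condCdf (T : EReal) (ρ : ℝ) : Measurable (condCdf T ρ) := by
  have : MeasurableSet {z : ℝ × ℝ | ((ρ * z.1 + √(1 - ρ ^ 2) * z.2 : ℝ) : EReal) ≤ T} :=
    measurableSet_coe_le (by fun_prop) _
  exact (measurable_measure_prodMk_left (ν := gaussianReal 0 1) this).ennreal_toReal

theorem stdCdf_eq_condCdf (T : EReal) (x : ℝ) : stdCdf T = condCdf T 0 x := by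
  simp [stdCdf, condCdf]

theorem continuous_stdCdf : Continuous stdCdf := by
  refine continuous_iff_continuousAt.2 fun T => ?_
  have h1 := continuousAt_condCdf (T := T) (ρ := 0) (x := 0) (by simp)
  have h2 : ContinuousAt (fun T : EReal => (T, (0 : ℝ), (0 : ℝ))) T := by fun_prop
  have := ContinuousAt.comp (f := fun T : EReal => (T, (0 : ℝ), (0 : ℝ))) h1 h2
  simpa only [Function.comp_def, ← stdCdf_eq_condCdf] using this

theorem condCdf_coe {ρ : ℝ} (hρ : |ρ| < 1) (t x : ℝ) :
    condCdf t ρ x = stdCdf (((t - ρ * x) / √(1 - ρ ^ 2) : ℝ) : EReal) := by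
  have hs := sqrt_one_sub_sq_pos hρ
  unfold condCdf stdCdf
  congr 1
  ext y
  simp only [Set.mem_ofPred_eq, EReal.coe_le_coe_iff]
  rw [le_div_iff₀ hs]
  constructor <;> intro h <;> linarith

/-- Translates the expression in `logLikCD` into a conditional distribution function. Infinite
thresholds stay infinite, because the divisor is positive and finite. -/
theorem stdCdf_div_eq_condCdf {ρ : ℝ} (hρ : |ρ| < 1) (T : EReal) (x : ℝ) :
    stdCdf ((T - ((ρ * x : ℝ) : EReal)) / ((√(1 - ρ ^ 2) : ℝ) : EReal)) = condCdf T ρ x := by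
  have hs := sqrt_one_sub_sq_pos hρ
  induction T with
  | bot =>
    rw [EReal.bot_sub, EReal.bot_div_of_pos_ne_top (by exact_mod_cast hs) (EReal.coe_ne_top _),
      condCdf_bot, stdCdf_eq_condCdf ⊥ 0, condCdf_bot]
  | top =>
    rw [EReal.top_sub_coe, EReal.top_div_of_pos_ne_top (by exact_mod_cast hs)
      (EReal.coe_ne_top _), condCdf_top, stdCdf_eq_condCdf ⊤ 0, condCdf_top]
  | coe t =>
    rw [condCdf_coe hρ, EReal.coe_div, EReal.coe_sub]

theorem gaussianPDFReal_ge {B x : ℝ} (hx : |x| ≤ B) :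
    gaussianPDFReal 0 1 B ≤ gaussianPDFReal 0 1 x := by
  have : x ^ 2 ≤ B ^ 2 := sq_le_sq.2 (hx.trans (le_abs_self B))
  simp only [gaussianPDFReal, sub_zero]
  gcongr

/-- A lower bound for the conditional probability of an interval. -/
theorem le_condCdf_sub {ρ : ℝ} (hρ : |ρ| < 1) {lo hi : EReal} {m m' : ℝ} (hlo : lo ≤ m)
    (hmm : m ≤ m') (hhi : (m' : EReal) ≤ hi) (x : ℝ) :
    (m' - m) / √(1 - ρ ^ 2) *
        gaussianPDFReal 0 1 ((|m| + |m'| + |x|) / √(1 - ρ ^ 2)) ≤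
      condCdf hi ρ x - condCdf lo ρ x := by
  have hs := sqrt_one_sub_sq_pos hρ
  set s := √(1 - ρ ^ 2) with hs_def
  have h1 : condCdf m' ρ x - condCdf m ρ x ≤ condCdf hi ρ x - condCdf lo ρ x :=
    sub_le_sub (condCdf_mono hhi _ _) (condCdf_mono hlo _ _)
  refine le_trans ?_ h1
  have hab : (m - ρ * x) / s ≤ (m' - ρ * x) / s := by gcongr
  set a := (m - ρ * x) / s with ha
  set b := (m' - ρ * x) / s with hb
  have h2 : condCdf m' ρ x - condCdf m ρ x = ∫ y in Set.Ioc a b, gaussianPDFReal 0 1 y := by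
    rw [condCdf_coe hρ, condCdf_coe hρ]
    have e : ∀ t : ℝ, stdCdf (t : EReal) = ∫ y in Set.Iic t, gaussianPDFReal 0 1 y := by
      intro t
      have : {x : ℝ | (x : EReal) ≤ t} = Set.Iic t := by
        ext; simp
      rw [stdCdf, this, measureReal_def, gaussianReal_apply_eq_integral _ one_ne_zero,
        ENNReal.toReal_ofReal (setIntegral_nonneg measurableSet_Iic
          fun y _ => gaussianPDFReal_nonneg _ _ y)]
    rw [e, e, ← hs_def, ← ha, ← hb, intervalIntegral.integral_Iic_sub_Iic
      (integrable_gaussianPDFReal 0 1).integrableOn (integrable_gaussianPDFReal 0 1).integrableOn,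
      intervalIntegral.integral_of_le hab]
  rw [h2]
  have h3 : (m' - m) / s = b - a := by rw [ha, hb]; ring
  have h4 : (b - a) * gaussianPDFReal 0 1 ((|m| + |m'| + |x|) / s) =
      ∫ _ in Set.Ioc a b, gaussianPDFReal 0 1 ((|m| + |m'| + |x|) / s) := by
    rw [setIntegral_const, measureReal_def, Real.volume_Ioc, ENNReal.toReal_ofReal (by linarith),
      smul_eq_mul]
  rw [h3, h4]
  -- Every point of the interval has absolute value at most `(|m| + |m'| + |x|) / s`, so the density
  -- there is at least its value at that number.
  refine setIntegral_mono_on (by simp) (integrable_gaussianPDFReal 0 1).integrableOn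
    measurableSet_Ioc fun y hy => gaussianPDFReal_ge ?_
  have hrx : |ρ * x| ≤ |x| := by
    rw [abs_mul]
    exact mul_le_of_le_one_left (abs_nonneg _) hρ.le
  have := abs_le.1 hrx
  refine abs_le.2 ⟨?_, ?_⟩
  · refine le_trans ?_ hy.1.le
    rw [ha, ← neg_div]
    gcongr
    linarith [neg_abs_le m, abs_nonneg m']
  · refine hy.2.trans ?_
    rw [hb]
    gcongr
    linarith [le_abs_self m', abs_nonneg m]

theorem condCdf_strictMono {ρ : ℝ} (hρ : |ρ| < 1) (x : ℝ) :
    StrictMono fun T : EReal => condCdf T ρ x := by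
  intro lo hi h
  obtain ⟨m, hm1, hm2⟩ := EReal.lt_iff_exists_real_btwn.1 h
  obtain ⟨m', hm1', hm2'⟩ := EReal.lt_iff_exists_real_btwn.1 hm2
  have hmm : m < m' := EReal.coe_lt_coe_iff.1 hm1'
  have := le_condCdf_sub hρ hm1.le hmm.le hm2'.le x
  have h2 : 0 < (m' - m) / √(1 - ρ ^ 2) *
      gaussianPDFReal 0 1 ((|m| + |m'| + |x|) / √(1 - ρ ^ 2)) :=
    mul_pos (div_pos (by linarith) (sqrt_one_sub_sq_pos hρ)) (gaussianPDFReal_pos _ _ _ one_ne_zero)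
  show condCdf lo ρ x < condCdf hi ρ x
  linarith

theorem stdCdf_strictMono : StrictMono stdCdf := by
  have := condCdf_strictMono (ρ := 0) (by simp) 0
  simpa only [← stdCdf_eq_condCdf] using this

theorem stdCdf_bot : stdCdf ⊥ = 0 := by rw [stdCdf_eq_condCdf ⊥ 0, condCdf_bot]

theorem stdCdf_top : stdCdf ⊤ = 1 := by rw [stdCdf_eq_condCdf ⊤ 0, condCdf_top]

/-- On the extended line the distribution function is a bijection onto the closed unit interval.
Hence the endpoints, whose quantiles are `⊥` and `⊤`, need no exception. -/
theorem stdCdf_stdQuantile {u : ℝ} (h0 : 0 ≤ u) (h1 : u ≤ 1) : stdCdf (stdQuantile u) = u := by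
  obtain ⟨a, -, ha⟩ := intermediate_value_Icc (bot_le (a := (⊤ : EReal)))
    continuous_stdCdf.continuousOn (by rw [stdCdf_bot, stdCdf_top]; exact ⟨h0, h1⟩ : u ∈ _)
  have : {b | u ≤ stdCdf b} = Set.Ici a := by
    ext b
    simp [← ha, stdCdf_strictMono.le_iff_le]
  rw [stdQuantile, this, csInf_Ici, ha]

theorem tendsto_of_tendsto_stdCdf {ι : Type*} {l : Filter ι} {a : ι → EReal} {b : EReal}
    (h : Tendsto (fun i => stdCdf (a i)) l (𝓝 (stdCdf b))) : Tendsto a l (𝓝 b) := by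
  rw [tendsto_order] at h ⊢
  refine ⟨fun c hc => ?_, fun c hc => ?_⟩
  · filter_upwards [h.1 _ (stdCdf_strictMono hc)] with i hi
    exact stdCdf_strictMono.lt_iff_lt.1 hi
  · filter_upwards [h.2 _ (stdCdf_strictMono hc)] with i hi
    exact stdCdf_strictMono.lt_iff_lt.1 hi

/-- The joint law of two standard normal variables with correlation `ρ`. -/
def bivariateGaussian (ρ : ℝ) : Measure (ℝ × ℝ) :=
  ((gaussianReal 0 1).prod (gaussianReal 0 1)).map
    fun z => (z.1, ρ * z.1 + √(1 - ρ ^ 2) * z.2)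

theorem measurable_correlate (ρ : ℝ) :
    Measurable fun z : ℝ × ℝ => (z.1, ρ * z.1 + √(1 - ρ ^ 2) * z.2) := by fun_prop

instance (ρ : ℝ) : IsProbabilityMeasure (bivariateGaussian ρ) :=
  Measure.isProbabilityMeasure_map (measurable_correlate ρ).aemeasurable

theorem bivariateGaussian_zero :
    bivariateGaussian 0 = (gaussianReal 0 1).prod (gaussianReal 0 1) := by
  simp [bivariateGaussian]

theorem map_fst_bivariateGaussian (ρ : ℝ) :
    (bivariateGaussian ρ).map Prod.fst = gaussianReal 0 1 := by
  rw [bivariateGaussian, Measure.map_map measurable_fst (measurable_correlate ρ)]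
  exact Measure.map_fst_prod.trans (by simp)

/-- The two independent summands have variances `ρ ^ 2` and `1 - ρ ^ 2`, which add up to one. -/
theorem map_snd_bivariateGaussian {ρ : ℝ} (hρ : |ρ| < 1) :
    (bivariateGaussian ρ).map Prod.snd = gaussianReal 0 1 := by
  rw [bivariateGaussian, Measure.map_map measurable_snd (measurable_correlate ρ)]
  have hi : IndepFun (fun z : ℝ × ℝ => ρ * z.1) (fun z : ℝ × ℝ => √(1 - ρ ^ 2) * z.2)
      ((gaussianReal 0 1).prod (gaussianReal 0 1)) :=
    indepFun_prod (X := fun x : ℝ => ρ * x) (Y := fun x : ℝ => √(1 - ρ ^ 2) * x)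
      (by fun_prop) (by fun_prop)
  have hfst : ((gaussianReal 0 1).prod (gaussianReal 0 1)).map Prod.fst = gaussianReal 0 1 :=
    Measure.map_fst_prod.trans (by simp)
  have hsnd : ((gaussianReal 0 1).prod (gaussianReal 0 1)).map Prod.snd = gaussianReal 0 1 :=
    Measure.map_snd_prod.trans (by simp)
  have h1 : ((gaussianReal 0 1).prod (gaussianReal 0 1)).map (fun z : ℝ × ℝ => ρ * z.1) =
      gaussianReal (ρ * 0) (NNReal.mk (ρ ^ 2) (sq_nonneg _) * 1) := by
    rw [← gaussianReal_map_const_mul]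
    nth_rw 3 [← hfst]
    rw [Measure.map_map (by fun_prop) (by fun_prop)]
    rfl
  have h2 : ((gaussianReal 0 1).prod (gaussianReal 0 1)).map
      (fun z : ℝ × ℝ => √(1 - ρ ^ 2) * z.2) =
      gaussianReal (√(1 - ρ ^ 2) * 0) (NNReal.mk (√(1 - ρ ^ 2) ^ 2) (sq_nonneg _) * 1) := by
    rw [← gaussianReal_map_const_mul]
    nth_rw 3 [← hsnd]
    rw [Measure.map_map (by fun_prop) (by fun_prop)]
    rfl
  have := gaussianReal_add_gaussianReal_of_indepFun hi h1 h2
  have hs : 0 ≤ 1 - ρ ^ 2 := by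
    have := (sq_lt_one_iff_abs_lt_one ρ).2 hρ
    linarith
  have h1 : (1 : NNReal) = NNReal.mk (ρ ^ 2) (sq_nonneg _) * 1 +
      NNReal.mk (√(1 - ρ ^ 2) ^ 2) (sq_nonneg _) * 1 := by
    ext
    simp [Real.sq_sqrt hs]
  have e : gaussianReal 0 1 = gaussianReal (ρ * 0 + √(1 - ρ ^ 2) * 0)
      (NNReal.mk (ρ ^ 2) (sq_nonneg _) * 1 + NNReal.mk (√(1 - ρ ^ 2) ^ 2) (sq_nonneg _) * 1) := by
    rw [← h1]
    simp
  exact this.trans e.symm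

theorem integral_bivariateGaussian (ρ : ℝ) {f : ℝ × ℝ → ℝ} (hf : Measurable f) :
    ∫ z, f z ∂bivariateGaussian ρ = ∫ z, f (z.1, ρ * z.1 + √(1 - ρ ^ 2) * z.2)
      ∂(gaussianReal 0 1).prod (gaussianReal 0 1) :=
  integral_map (measurable_correlate ρ).aemeasurable hf.aestronglyMeasurable

theorem memLp_fst_bivariateGaussian (ρ : ℝ) (p : ℝ≥0∞) (hp : p ≠ ⊤) :
    MemLp Prod.fst p (bivariateGaussian ρ) := by
  have : MemLp id p ((bivariateGaussian ρ).map Prod.fst) := by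
    rw [map_fst_bivariateGaussian]
    exact memLp_id_gaussianReal' p hp
  exact (memLp_map_measure_iff (g := id) (by fun_prop) (by fun_prop)).1 this

theorem memLp_snd_bivariateGaussian {ρ : ℝ} (hρ : |ρ| < 1) (p : ℝ≥0∞) (hp : p ≠ ⊤) :
    MemLp Prod.snd p (bivariateGaussian ρ) := by
  have : MemLp id p ((bivariateGaussian ρ).map Prod.snd) := by
    rw [map_snd_bivariateGaussian hρ]
    exact memLp_id_gaussianReal' p hp
  exact (memLp_map_measure_iff (g := id) (by fun_prop) (by fun_prop)).1 this

theorem memLp_two_mul_of_memLp_four {S : Type*} [MeasurableSpace S] {ν : Measure S}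
    {f : S → ℝ} (hf : MemLp f 4 ν) : MemLp (fun z => f z ^ 2) 2 ν := by
  have := MemLp.norm_rpow_div hf 2
  have e : (4 : ℝ≥0∞) / 2 = 2 := by
    have h4 : (4 : ℝ≥0∞) = 2 * 2 := by norm_num
    rw [h4]
    exact ENNReal.mul_div_cancel_right (by simp) (by simp)
  rw [e] at this
  simpa using this

/-- A function of at most quadratic growth is square integrable for the bivariate Gaussian law. -/
theorem memLp_two_of_quadratic_growth {ρ : ℝ} (hρ : |ρ| < 1) {f : ℝ × ℝ → ℝ} (hf : Measurable f)
    {c : ℝ} (hc : ∀ z, |f z| ≤ c * (1 + z.1 ^ 2 + z.2 ^ 2)) :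
    MemLp f 2 (bivariateGaussian ρ) := by
  have h1 : MemLp (fun z : ℝ × ℝ => z.1 ^ 2) 2 (bivariateGaussian ρ) :=
    memLp_two_mul_of_memLp_four (memLp_fst_bivariateGaussian ρ 4 (by simp))
  have h2 : MemLp (fun z : ℝ × ℝ => z.2 ^ 2) 2 (bivariateGaussian ρ) :=
    memLp_two_mul_of_memLp_four (memLp_snd_bivariateGaussian hρ 4 (by simp))
  have h : MemLp (fun z : ℝ × ℝ => c * (1 + z.1 ^ 2 + z.2 ^ 2)) 2 (bivariateGaussian ρ) :=
    (((memLp_const (1 : ℝ)).add h1).add h2).const_mul c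
  refine h.mono hf.aestronglyMeasurable (ae_of_all _ fun z => ?_)
  rw [Real.norm_eq_abs, Real.norm_eq_abs]
  exact (hc z).trans (le_abs_self _)

theorem stdCdf₂_eq_bivariateGaussian (a b : EReal) (ρ : ℝ) :
    stdCdf₂ a b ρ = (bivariateGaussian ρ).real {z | (z.1 : EReal) ≤ a ∧ (z.2 : EReal) ≤ b} := by
  rw [bivariateGaussian, map_measureReal_apply (measurable_correlate ρ)]
  · rfl
  · exact (measurableSet_coe_le measurable_fst a).inter (measurableSet_coe_le measurable_snd b)

/-- Fubini, conditioning on the first variable. Comparisons of correlations thereby reduce to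
comparisons of conditional distribution functions. -/
theorem stdCdf₂_eq_integral (a b : EReal) (ρ : ℝ) :
    stdCdf₂ a b ρ = ∫ x in {x : ℝ | (x : EReal) ≤ a}, condCdf b ρ x ∂gaussianReal 0 1 := by
  have hE : MeasurableSet {z : ℝ × ℝ | (z.1 : EReal) ≤ a ∧
      ((ρ * z.1 + √(1 - ρ ^ 2) * z.2 : ℝ) : EReal) ≤ b} :=
    (measurableSet_coe_le measurable_fst a).inter (measurableSet_coe_le (by fun_prop) b)
  have hm := measurable_measure_prodMk_left (ν := gaussianReal 0 1) hE
  rw [stdCdf₂, measureReal_def, Measure.prod_apply hE, ← integral_toReal hm.aemeasurable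
    (ae_of_all _ fun x => measure_lt_top _ _), ← integral_indicator
    (measurableSet_coe_le (f := fun x : ℝ => x) measurable_id a)]
  refine integral_congr_ae (ae_of_all _ fun x => ?_)
  by_cases hx : (x : EReal) ≤ a
  · rw [Set.indicator_of_mem (by exact hx)]
    simp [condCdf, hx, measureReal_def, Set.preimage, -EReal.coe_add]
  · rw [Set.indicator_of_notMem (by exact hx)]
    simp [hx, Set.preimage]

/-- Almost every point lies off the two boundary lines of the quadrant, and such a point keeps its
position under small changes of the thresholds and the correlation. -/
theorem continuousAt_stdCdf₂ (a b : EReal) {ρ : ℝ} (hρ : |ρ| < 1) :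
    ContinuousAt (fun p : EReal × EReal × ℝ => stdCdf₂ p.1 p.2.1 p.2.2) (a, b, ρ) := by
  have hs := (sqrt_one_sub_sq_pos hρ).ne'
  refine tendsto_measureReal_of_ae_eventually_iff
    (fun p => (measurableSet_coe_le measurable_fst _).inter (measurableSet_coe_le (by fun_prop) _))
    ((measurableSet_coe_le measurable_fst _).inter (measurableSet_coe_le (by fun_prop) _)) ?_
  have h1 : ∀ᵐ z ∂(gaussianReal 0 1).prod (gaussianReal 0 1), (z.1 : EReal) ≠ a := by
    have := gaussianReal_affine_coe_eq 0 a one_ne_zero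
    simp only [zero_add, one_mul] at this
    exact Measure.quasiMeasurePreserving_fst.ae this
  have h2 : ∀ᵐ z ∂(gaussianReal 0 1).prod (gaussianReal 0 1),
      ((ρ * z.1 + √(1 - ρ ^ 2) * z.2 : ℝ) : EReal) ≠ b := by
    refine (Measure.ae_prod_iff_ae_ae ?_).2 (ae_of_all _ fun x =>
      gaussianReal_affine_coe_eq (ρ * x) b hs)
    exact (measurableSet_eq_fun (measurable_coe_real_ereal.comp (by fun_prop))
      measurable_const).compl
  filter_upwards [h1, h2] with z hz1 hz2
  refine (eventually_coe_le_iff (l := 𝓝 (a, b, ρ)) (f := fun p : EReal × EReal × ℝ => z.1)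
    (a := fun p => p.1) tendsto_const_nhds (continuous_fst.tendsto (a, b, ρ)) hz1).and
    (eventually_coe_le_iff (l := 𝓝 (a, b, ρ))
      (f := fun p : EReal × EReal × ℝ => p.2.2 * z.1 + √(1 - p.2.2 ^ 2) * z.2)
      (a := fun p => p.2.1) (c := ρ * z.1 + √(1 - ρ ^ 2) * z.2) ?_ ?_ hz2) |>.mono ?_
  · exact Continuous.tendsto (by fun_prop) (a, b, ρ)
  · exact Continuous.tendsto (by fun_prop) (a, b, ρ)
  · rintro p ⟨hp1, hp2⟩
    exact and_congr hp1 hp2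

theorem integrable_condCdf (T : EReal) (ρ : ℝ) : Integrable (condCdf T ρ) (gaussianReal 0 1) :=
  (integrable_const 1).mono' (measurable_condCdf T ρ).aestronglyMeasurable
    (ae_of_all _ fun x => by
      rw [Real.norm_eq_abs, abs_of_nonneg (condCdf_nonneg _ _ _)]
      exact condCdf_le_one _ _ _)

theorem stdCdf₂_top_left {ρ : ℝ} (hρ : |ρ| < 1) (b : EReal) : stdCdf₂ ⊤ b ρ = stdCdf b := by
  rw [stdCdf₂_eq_bivariateGaussian, stdCdf, ← map_snd_bivariateGaussian hρ,
    map_measureReal_apply measurable_snd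
      (measurableSet_coe_le (f := fun x : ℝ => x) measurable_id b)]
  simp [Set.preimage]

theorem integral_condCdf {ρ : ℝ} (hρ : |ρ| < 1) (b : EReal) :
    ∫ x, condCdf b ρ x ∂gaussianReal 0 1 = stdCdf b := by
  rw [← stdCdf₂_top_left hρ, stdCdf₂_eq_integral]
  simp

theorem stdCdf₂_top_right (a : EReal) (ρ : ℝ) : stdCdf₂ a ⊤ ρ = stdCdf a := by
  simp [stdCdf₂_eq_integral, condCdf_top, stdCdf]

theorem stdCdf₂_bot_left (b : EReal) (ρ : ℝ) : stdCdf₂ ⊥ b ρ = 0 := by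
  simp [stdCdf₂_eq_integral, Set.ofPred_false]

theorem stdCdf₂_bot_right (a : EReal) (ρ : ℝ) : stdCdf₂ a ⊥ ρ = 0 := by
  simp [stdCdf₂_eq_integral, condCdf_bot]

end Gaussian

/-! ### Monotonicity in the correlation and positivity of cell probabilities -/

section Correlation

theorem gaussianReal_ne_zero_of_volume_ne_zero {s : Set ℝ} (h : volume s ≠ 0) :
    gaussianReal 0 1 s ≠ 0 :=
  fun h0 => h (gaussianReal_absolutelyContinuous' 0 one_ne_zero h0)

/-- The Gaussian integral of a nonnegative function is positive if the function is positive on a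
set of positive volume. -/
theorem setIntegral_gaussianReal_pos {f : ℝ → ℝ} {s t : Set ℝ}
    (hf : IntegrableOn f s (gaussianReal 0 1)) (hs : MeasurableSet s) (h0 : ∀ x ∈ s, 0 ≤ f x)
    (hts : t ⊆ s) (ht : ∀ x ∈ t, 0 < f x) (hvol : volume t ≠ 0) :
    0 < ∫ x in s, f x ∂gaussianReal 0 1 := by
  rw [setIntegral_pos_iff_support_of_nonneg_ae
    ((ae_restrict_iff' hs).2 (ae_of_all _ h0)) hf]
  refine (pos_iff_ne_zero.2 (gaussianReal_ne_zero_of_volume_ne_zero hvol)).trans_le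
    (measure_mono fun x hx => ⟨(ht x hx).ne', hts hx⟩)

/-- On the open interval the function is `tan ∘ arcsin`, a composition of strictly increasing
functions. -/
theorem div_sqrt_lt_div_sqrt {a b : ℝ} (ha : |a| < 1) (hb : |b| < 1) (hab : a < b) :
    a / √(1 - a ^ 2) < b / √(1 - b ^ 2) := by
  rw [← Real.tan_arcsin, ← Real.tan_arcsin]
  obtain ⟨ha1, ha2⟩ := abs_lt.1 ha
  obtain ⟨hb1, hb2⟩ := abs_lt.1 hb
  exact Real.tan_lt_tan_of_lt_of_lt_pi_div_two (Real.neg_pi_div_two_lt_arcsin.2 ha1)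
    (Real.arcsin_lt_pi_div_two.2 hb2)
    (Real.strictMonoOn_arcsin ⟨ha1.le, ha2.le⟩ ⟨hb1.le, hb2.le⟩ hab)

/-- For two correlations the conditional distribution functions cross exactly once. -/
theorem exists_condCdf_crossing {ρ₁ ρ₂ : ℝ} (h₁ : |ρ₁| < 1) (h₂ : |ρ₂| < 1) (h : ρ₁ < ρ₂) (b : ℝ) :
    ∃ x₀, (∀ x < x₀, condCdf b ρ₁ x < condCdf b ρ₂ x) ∧
      ∀ x > x₀, condCdf b ρ₂ x < condCdf b ρ₁ x := by
  -- By `condCdf_coe` both functions are `stdCdf` at an affine function of `x`. The slopes differ by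
  -- `β > 0`, so the affine functions cross exactly once, at `α / β`.
  set β := ρ₂ / √(1 - ρ₂ ^ 2) - ρ₁ / √(1 - ρ₁ ^ 2) with hβ
  have hβ0 : 0 < β := sub_pos.2 (div_sqrt_lt_div_sqrt h₁ h₂ h)
  set α := b / √(1 - ρ₂ ^ 2) - b / √(1 - ρ₁ ^ 2) with hα
  have key : ∀ x, (b - ρ₂ * x) / √(1 - ρ₂ ^ 2) - (b - ρ₁ * x) / √(1 - ρ₁ ^ 2) = α - β * x := by
    intro x
    rw [hα, hβ]
    ring
  refine ⟨α / β, fun x hx => ?_, fun x hx => ?_⟩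
  · rw [condCdf_coe h₁, condCdf_coe h₂]
    refine stdCdf_strictMono (EReal.coe_lt_coe_iff.2 ?_)
    rw [lt_div_iff₀ hβ0] at hx
    linarith [key x, mul_comm x β]
  · rw [condCdf_coe h₁, condCdf_coe h₂]
    refine stdCdf_strictMono (EReal.coe_lt_coe_iff.2 ?_)
    rw [gt_iff_lt, div_lt_iff₀ hβ0] at hx
    linarith [key x, mul_comm x β]

/-- The bivariate normal distribution function is strictly increasing in the correlation. -/
theorem stdCdf₂_lt_stdCdf₂ {ρ₁ ρ₂ : ℝ} (h₁ : |ρ₁| < 1) (h₂ : |ρ₂| < 1) (h : ρ₁ < ρ₂) (a b : ℝ) :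
    stdCdf₂ a b ρ₁ < stdCdf₂ a b ρ₂ := by
  obtain ⟨x₀, hlt, hgt⟩ := exists_condCdf_crossing h₁ h₂ h b
  have hset : {x : ℝ | (x : EReal) ≤ a} = Set.Iic a := by
    ext
    simp
  rw [stdCdf₂_eq_integral, stdCdf₂_eq_integral, hset]
  have hint : Integrable (fun x => condCdf b ρ₂ x - condCdf b ρ₁ x) (gaussianReal 0 1) :=
    (integrable_condCdf _ _).sub (integrable_condCdf _ _)
  rw [← sub_pos, ← integral_sub (integrable_condCdf _ _).integrableOn
    (integrable_condCdf _ _).integrableOn]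
  -- To the left of the crossing point the integrand is positive. If `a` lies to the right of it,
  -- the complementary integral is negative, while the total is zero because the second marginal
  -- does not depend on the correlation.
  rcases le_or_gt a x₀ with hax | hax
  · have hnn : ∀ x ∈ Set.Iio a, 0 < condCdf b ρ₂ x - condCdf b ρ₁ x := fun x hx =>
      sub_pos.2 (hlt x (lt_of_lt_of_le hx hax))
    have hpos : 0 < ∫ x in Set.Iio a, (condCdf b ρ₂ x - condCdf b ρ₁ x) ∂gaussianReal 0 1 :=
      setIntegral_gaussianReal_pos hint.integrableOn measurableSet_Iio (fun x hx => (hnn x hx).le)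
        subset_rfl hnn (by simp)
    rwa [integral_Iic_eq_integral_Iio' (gaussianReal_singleton a)]
  · have htot : ∫ x, (condCdf b ρ₂ x - condCdf b ρ₁ x) ∂gaussianReal 0 1 = 0 := by
      rw [integral_sub (integrable_condCdf _ _) (integrable_condCdf _ _), integral_condCdf h₁,
        integral_condCdf h₂, sub_self]
    have hsplit := integral_add_compl (measurableSet_Iic (a := a)) hint
    rw [htot, Set.compl_Iic] at hsplit
    have hneg : 0 < ∫ x in Set.Ioi a, (condCdf b ρ₁ x - condCdf b ρ₂ x) ∂gaussianReal 0 1 :=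
      setIntegral_gaussianReal_pos ((integrable_condCdf _ _).sub (integrable_condCdf _ _)).integrableOn
        measurableSet_Ioi (fun x hx => (sub_pos.2 (hgt x (hax.trans hx))).le) subset_rfl
        (fun x hx => sub_pos.2 (hgt x (hax.trans hx))) (by simp)
    have : ∫ x in Set.Ioi a, (condCdf b ρ₁ x - condCdf b ρ₂ x) ∂gaussianReal 0 1 =
        -∫ x in Set.Ioi a, (condCdf b ρ₂ x - condCdf b ρ₁ x) ∂gaussianReal 0 1 := by
      rw [← integral_neg]
      simp
    linarith

/-- Strictness is lost only at infinite thresholds, where the joint function is zero or a marginal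
and so does not depend on the correlation. -/
theorem stdCdf₂_mono {ρ₁ ρ₂ : ℝ} (h₁ : |ρ₁| < 1) (h₂ : |ρ₂| < 1) (h : ρ₁ ≤ ρ₂) (a b : EReal) :
    stdCdf₂ a b ρ₁ ≤ stdCdf₂ a b ρ₂ := by
  rcases h.eq_or_lt with rfl | h
  · rfl
  induction a with
  | bot => simp [stdCdf₂_bot_left]
  | top => simp [stdCdf₂_top_left h₁, stdCdf₂_top_left h₂]
  | coe a =>
    induction b with
    | bot => simp [stdCdf₂_bot_right]
    | top => simp [stdCdf₂_top_right]
    | coe b => exact (stdCdf₂_lt_stdCdf₂ h₁ h₂ h a b).le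

/-- The probability of a cell `(a, a'] × (b, b']` under the bivariate normal law. -/
def cellProb (a a' b b' : EReal) (ρ : ℝ) : ℝ :=
  stdCdf₂ a' b' ρ + stdCdf₂ a b ρ - stdCdf₂ a' b ρ - stdCdf₂ a b' ρ

theorem cellProb_eq_integral {a a' : EReal} (ha : a ≤ a') (b b' : EReal) (ρ : ℝ) :
    cellProb a a' b b' ρ = ∫ x in {x : ℝ | (x : EReal) ≤ a'} \ {x : ℝ | (x : EReal) ≤ a},
      (condCdf b' ρ x - condCdf b ρ x) ∂gaussianReal 0 1 := by
  have hsub : {x : ℝ | (x : EReal) ≤ a} ⊆ {x : ℝ | (x : EReal) ≤ a'} := fun x hx => le_trans hx ha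
  have hm : MeasurableSet {x : ℝ | (x : EReal) ≤ a} := measurableSet_coe_le measurable_id a
  rw [integral_sub (integrable_condCdf _ _).integrableOn (integrable_condCdf _ _).integrableOn,
    setIntegral_sdiff hm (integrable_condCdf _ _).integrableOn hsub,
    setIntegral_sdiff hm (integrable_condCdf _ _).integrableOn hsub]
  simp only [cellProb, stdCdf₂_eq_integral]
  ring

theorem cellProb_nonneg {a a' b b' : EReal} (ha : a ≤ a') (hb : b ≤ b') (ρ : ℝ) :
    0 ≤ cellProb a a' b b' ρ := by
  rw [cellProb_eq_integral ha]
  exact integral_nonneg fun x => sub_nonneg.2 (condCdf_mono hb _ _)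

theorem cellProb_pos {a a' b b' : EReal} (ha : a < a') (hb : b < b') {ρ : ℝ} (hρ : |ρ| < 1) :
    0 < cellProb a a' b b' ρ := by
  rw [cellProb_eq_integral ha.le]
  obtain ⟨m, hm1, hm2⟩ := EReal.lt_iff_exists_real_btwn.1 ha
  obtain ⟨m', hm1', hm2'⟩ := EReal.lt_iff_exists_real_btwn.1 hm2
  have hmm : m < m' := EReal.coe_lt_coe_iff.1 hm1'
  have hpos : ∀ x, 0 < condCdf b' ρ x - condCdf b ρ x := fun x =>
    sub_pos.2 (condCdf_strictMono hρ x hb)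
  refine setIntegral_gaussianReal_pos (t := Set.Ioo m m')
    ((integrable_condCdf _ _).sub (integrable_condCdf _ _)).integrableOn
    ((measurableSet_coe_le measurable_id a').diff (measurableSet_coe_le measurable_id a))
    (fun x _ => (hpos x).le) (fun x hx => ⟨?_, ?_⟩) (fun x _ => hpos x) (by simp [hmm])
  · exact (EReal.coe_le_coe_iff.2 hx.2.le).trans hm2'.le
  · exact not_le.2 (hm1.trans (EReal.coe_lt_coe_iff.2 hx.1))

theorem continuousAt_cellProb (a a' b b' : EReal) {ρ : ℝ} (hρ : |ρ| < 1) :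
    ContinuousAt (fun p : EReal × EReal × EReal × EReal × ℝ =>
      cellProb p.1 p.2.1 p.2.2.1 p.2.2.2.1 p.2.2.2.2) (a, a', b, b', ρ) := by
  unfold cellProb
  have h : ∀ (f g : EReal × EReal × EReal × EReal × ℝ → EReal), Continuous f → Continuous g →
      ContinuousAt (fun p => stdCdf₂ (f p) (g p) p.2.2.2.2) (a, a', b, b', ρ) := by
    intro f g hf hg
    exact ContinuousAt.comp (f := fun p : EReal × EReal × EReal × EReal × ℝ =>
      (f p, g p, p.2.2.2.2)) (continuousAt_stdCdf₂ _ _ hρ)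
      (Continuous.continuousAt (by fun_prop))
  exact (((h _ _ (by fun_prop) (by fun_prop)).add (h _ _ (by fun_prop) (by fun_prop))).sub
    (h _ _ (by fun_prop) (by fun_prop))).sub (h _ _ (by fun_prop) (by fun_prop))

/-- Inclusion and exclusion for indicators. It connects the four-term expression in the polychoric
likelihood with the measure to which cell frequencies converge. -/
theorem cellProb_eq_bivariateGaussian {a a' b b' : EReal} (ha : a ≤ a') (hb : b ≤ b') (ρ : ℝ) :
    cellProb a a' b b' ρ = (bivariateGaussian ρ).real
      {z | (a < z.1 ∧ (z.1 : EReal) ≤ a') ∧ (b < z.2 ∧ (z.2 : EReal) ≤ b')} := by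
  have hm : ∀ x y : EReal, MeasurableSet {z : ℝ × ℝ | (z.1 : EReal) ≤ x ∧ (z.2 : EReal) ≤ y} :=
    fun x y => (measurableSet_coe_le measurable_fst x).inter (measurableSet_coe_le measurable_snd y)
  have hc : MeasurableSet {z : ℝ × ℝ | (a < z.1 ∧ (z.1 : EReal) ≤ a') ∧
      (b < z.2 ∧ (z.2 : EReal) ≤ b')} := by
    have : {z : ℝ × ℝ | (a < z.1 ∧ (z.1 : EReal) ≤ a') ∧ (b < z.2 ∧ (z.2 : EReal) ≤ b')} =
        {z : ℝ × ℝ | (z.1 : EReal) ≤ a' ∧ (z.2 : EReal) ≤ b'} ∩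
          ({z : ℝ × ℝ | (z.1 : EReal) ≤ a}ᶜ ∩ {z : ℝ × ℝ | (z.2 : EReal) ≤ b}ᶜ) := by
      ext z
      simp only [Set.mem_ofPred_eq, Set.mem_inter_iff, Set.mem_compl_iff, not_le]
      tauto
    rw [this]
    exact (hm _ _).inter ((measurableSet_coe_le measurable_fst a).compl.inter
      (measurableSet_coe_le measurable_snd b).compl)
  have hi : ∀ {s : Set (ℝ × ℝ)}, MeasurableSet s →
      Integrable (s.indicator (1 : ℝ × ℝ → ℝ)) (bivariateGaussian ρ) :=
    fun hs => (integrable_const (1 : ℝ)).indicator hs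
  simp only [cellProb, stdCdf₂_eq_bivariateGaussian]
  rw [← integral_indicator_one (hm _ _), ← integral_indicator_one (hm _ _),
    ← integral_indicator_one (hm _ _), ← integral_indicator_one (hm _ _),
    ← integral_indicator_one hc, ← integral_add' (hi (hm _ _)) (hi (hm _ _)),
    ← integral_sub' ((hi (hm _ _)).add (hi (hm _ _))) (hi (hm _ _)),
    ← integral_sub' (((hi (hm _ _)).add (hi (hm _ _))).sub (hi (hm _ _))) (hi (hm _ _))]
  congr 1
  ext z
  have h1 : (z.1 : EReal) ≤ a → (z.1 : EReal) ≤ a' := fun h => h.trans ha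
  have h2 : (z.2 : EReal) ≤ b → (z.2 : EReal) ≤ b' := fun h => h.trans hb
  simp only [Set.indicator_apply, Set.mem_ofPred_eq, Pi.one_apply, Pi.add_apply, Pi.sub_apply,
    ← not_le]
  by_cases c1 : (z.1 : EReal) ≤ a <;> by_cases c2 : (z.1 : EReal) ≤ a' <;>
    by_cases c3 : (z.2 : EReal) ≤ b <;> by_cases c4 : (z.2 : EReal) ≤ b' <;>
    first
    | exact absurd (h1 c1) c2
    | exact absurd (h2 c3) c4
    | simp only [c1, c2, c3, c4, not_true_eq_false, not_false_eq_true, and_self, and_true,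
        and_false, if_true, if_false] <;> norm_num

/-- `log x ≤ x - 1` at `x = √q / √p` gives the bound `2 * (√p * √q - p)`, which is the right-hand
side. The Hellinger square makes the gap in Gibbs' inequality quantitative. The hypothesis `h` is
indispensable because `Real.log 0 = 0`. -/
theorem mul_log_sub_le {p q : ℝ} (hp : 0 ≤ p) (hq : 0 ≤ q) (h : 0 < p → 0 < q) :
    p * (Real.log q - Real.log p) ≤ -(√p - √q) ^ 2 + q - p := by
  have e : -(√p - √q) ^ 2 + q - p = 2 * (√p * √q - p) := by
    have h1 := Real.sq_sqrt hp
    have h2 := Real.sq_sqrt hq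
    linear_combination -h1 - h2
  rw [e]
  rcases hp.eq_or_lt with rfl | hp
  · simp
  have hq := h hp
  have h3 : Real.log (√q / √p) ≤ √q / √p - 1 :=
    Real.log_le_sub_one_of_pos (by positivity)
  rw [Real.log_div (by positivity) (by positivity), Real.log_sqrt hq.le, Real.log_sqrt hp.le] at h3
  have h4 : p * (√q / √p) = √p * √q := by
    rw [mul_div_assoc', div_eq_iff (by positivity)]
    linear_combination (-√q) * Real.mul_self_sqrt hp.le
  nlinarith

/-- `p - q` factors as `(√p - √q) * (√p + √q)`, and the second factor is at most two. -/
theorem sq_sub_le_sq_sqrt_sub {p q : ℝ} (hp : 0 ≤ p) (hp1 : p ≤ 1) (hq : 0 ≤ q) (hq1 : q ≤ 1) :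
    (p - q) ^ 2 / 4 ≤ (√p - √q) ^ 2 := by
  have h1 := Real.sq_sqrt hp
  have h2 := Real.sq_sqrt hq
  have e : (p - q) ^ 2 = (√p - √q) ^ 2 * (√p + √q) ^ 2 := by
    rw [← mul_pow]
    congr 1
    linear_combination -h1 + h2
  have h3 : √p + √q ≤ 2 := by
    have := Real.sqrt_le_one.2 hp1
    have := Real.sqrt_le_one.2 hq1
    linarith
  have h4 : (√p + √q) ^ 2 ≤ 4 := by nlinarith [Real.sqrt_nonneg p, Real.sqrt_nonneg q]
  rw [e]
  nlinarith [sq_nonneg (√p - √q)]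

/-- Gibbs' inequality, with a bound for the gap in terms of one of the classes. -/
theorem sum_mul_log_sub_le {ι : Type*} (s : Finset ι) {p q : ι → ℝ} (hp : ∀ i ∈ s, 0 ≤ p i)
    (hq : ∀ i ∈ s, 0 ≤ q i) (h : ∀ i ∈ s, 0 < p i → 0 < q i) (hp1 : ∑ i ∈ s, p i = 1)
    (hq1 : ∑ i ∈ s, q i = 1) {i₀ : ι} (hi₀ : i₀ ∈ s) :
    ∑ i ∈ s, p i * (Real.log (q i) - Real.log (p i)) ≤ -((p i₀ - q i₀) ^ 2 / 4) := by
  calc ∑ i ∈ s, p i * (Real.log (q i) - Real.log (p i))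
      ≤ ∑ i ∈ s, (-(√(p i) - √(q i)) ^ 2 + q i - p i) :=
        Finset.sum_le_sum fun i hi => mul_log_sub_le (hp i hi) (hq i hi) (h i hi)
    _ = -∑ i ∈ s, (√(p i) - √(q i)) ^ 2 := by
        rw [Finset.sum_sub_distrib, Finset.sum_add_distrib, hp1, hq1, Finset.sum_neg_distrib]
        ring
    _ ≤ -(√(p i₀) - √(q i₀)) ^ 2 :=
        neg_le_neg (Finset.single_le_sum (f := fun i => (√(p i) - √(q i)) ^ 2)
          (fun i _ => sq_nonneg _) hi₀)
    _ ≤ _ := by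
        have h1 := (Finset.single_le_sum hp hi₀).trans_eq hp1
        have h2 := (Finset.single_le_sum hq hi₀).trans_eq hq1
        exact neg_le_neg (sq_sub_le_sq_sqrt_sub (hp _ hi₀) h1 (hq _ hi₀) h2)

end Correlation

/-! ### Laws of large numbers for pairs of columns -/

section LawOfLargeNumbers

variable {Ω : Type*} [MeasurableSpace Ω]

/-- Averages of functions of at most quadratic growth over the rows of a pair of columns converge
to their expectations for standard normal variables with correlation `ρ`. -/
def PairLLN (l : Filter (ℕ × Ω)) (U V : (N : ℕ) → Ω → Fin N → ℝ) (ρ : ℝ) : Prop :=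
  ∀ f : ℝ × ℝ → ℝ, Measurable f → (∃ c, ∀ z, |f z| ≤ c * (1 + z.1 ^ 2 + z.2 ^ 2)) →
    Tendsto (fun x : ℕ × Ω => (1 / (x.1 : ℝ)) * ∑ n, f (U x.1 x.2 n, V x.1 x.2 n)) l
      (𝓝 (∫ z, f z ∂bivariateGaussian ρ))

theorem PairLLN.mono {l l' : Filter (ℕ × Ω)} {U V : (N : ℕ) → Ω → Fin N → ℝ} {ρ : ℝ}
    (h : PairLLN l U V ρ) (hl : l' ≤ l) : PairLLN l' U V ρ :=
  fun f hf hc => (h f hf hc).mono_left hl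

/-- An i.i.d. sample of a Gaussian vector with mean zero and unit variances. -/
structure IsGaussianSample {M : ℕ} (μ : Measure Ω) (Z : ℕ → Ω → Fin M → ℝ) : Prop where
  meas : ∀ n, Measurable (Z n)
  indep : iIndepFun Z μ
  ident : ∀ n, IdentDistrib (Z n) (Z 0) μ μ
  gauss : HasGaussianLaw (Z 0) μ
  mean : ∀ j, ∫ ω, Z 0 ω j ∂μ = 0
  var : ∀ j, popCov μ (Z 0) j j = 1

namespace IsGaussianSample

variable {M : ℕ} {μ : Measure Ω} [IsProbabilityMeasure μ] {Z : ℕ → Ω → Fin M → ℝ}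

theorem measurable_eval (h : IsGaussianSample μ Z) (n : ℕ) (j : Fin M) :
    Measurable fun ω => Z n ω j :=
  (measurable_pi_apply j).comp (h.meas n)

theorem measurable_pair (h : IsGaussianSample μ Z) (n m : ℕ) (i j : Fin M) :
    Measurable fun ω => (Z n ω i, Z m ω j) :=
  (h.measurable_eval n i).prodMk (h.measurable_eval m j)

theorem identDistrib_pair (h : IsGaussianSample μ Z) (n : ℕ) (i j : Fin M) :
    IdentDistrib (fun ω => (Z n ω i, Z n ω j)) (fun ω => (Z 0 ω i, Z 0 ω j)) μ μ :=
  (h.ident n).comp (u := fun v : Fin M → ℝ => (v i, v j)) (by fun_prop)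

theorem map_eval (h : IsGaussianSample μ Z) (n : ℕ) (j : Fin M) :
    μ.map (fun ω => Z n ω j) = gaussianReal 0 1 := by
  have h0 : μ.map (fun ω => Z n ω j) = μ.map (fun ω => Z 0 ω j) :=
    ((h.ident n).comp (u := fun v : Fin M → ℝ => v j) (by fun_prop)).map_eq
  rw [h0]
  have h1 : HasGaussianLaw (fun ω => Z 0 ω j) μ := h.gauss.eval j
  have h2 := h1.map_eq_gaussianReal
  have h3 : Var[fun ω => Z 0 ω j; μ] = 1 := by
    rw [← covariance_self (h.measurable_eval 0 j).aemeasurable]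
    exact h.var j
  rw [h.mean j, h3] at h2
  simpa [Function.comp_def] using h2

theorem memLp_eval (h : IsGaussianSample μ Z) (n : ℕ) (j : Fin M) (p : ℝ≥0∞) (hp : p ≠ ⊤) :
    MemLp (fun ω => Z n ω j) p μ := by
  have : MemLp id p (μ.map (fun ω => Z n ω j)) := by
    rw [h.map_eval]
    exact memLp_id_gaussianReal' p hp
  exact (memLp_map_measure_iff (g := id) (by fun_prop)
    (h.measurable_eval n j).aemeasurable).1 this

/-- The standardized residual `W` of `Z 0 j` given `Z 0 i` is uncorrelated with `Z 0 i`. As the two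
are jointly Gaussian, they are independent and standard normal, and `Z 0 j = ρ * Z 0 i + s * W`. -/
theorem map_pair (h : IsGaussianSample μ Z) (n : ℕ) {i j : Fin M}
    (hij : |popCov μ (Z 0) i j| < 1) :
    μ.map (fun ω => (Z n ω i, Z n ω j)) = bivariateGaussian (popCov μ (Z 0) i j) := by
  rw [(h.identDistrib_pair n i j).map_eq]
  set ρ := popCov μ (Z 0) i j with hρ
  have hs := sqrt_one_sub_sq_pos hij
  set s := √(1 - ρ ^ 2) with hs_def
  have hs2 : s ^ 2 = 1 - ρ ^ 2 := Real.sq_sqrt (Real.sqrt_pos.1 hs).le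
  have hcov : cov[fun ω => Z 0 ω i, fun ω => Z 0 ω j; μ] = ρ := rfl
  have hcov' : cov[fun ω => Z 0 ω j, fun ω => Z 0 ω i; μ] = ρ := by rw [covariance_comm, hcov]
  have hvi : cov[fun ω => Z 0 ω i, fun ω => Z 0 ω i; μ] = 1 := h.var i
  have hvj : cov[fun ω => Z 0 ω j, fun ω => Z 0 ω j; μ] = 1 := h.var j
  set W : Ω → ℝ := fun ω => (Z 0 ω j - ρ * Z 0 ω i) / s with hW
  have hWm : Measurable W :=
    ((h.measurable_eval 0 j).sub ((h.measurable_eval 0 i).const_mul ρ)).div_const s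
  have hLi := h.memLp_eval 0 i 2 (by simp)
  have hLj := h.memLp_eval 0 j 2 (by simp)
  have hLρ : MemLp (fun ω => ρ * Z 0 ω i) 2 μ := hLi.const_mul ρ
  have hLd : MemLp (fun ω => Z 0 ω j - ρ * Z 0 ω i) 2 μ := hLj.sub hLρ
  have hgauss : HasGaussianLaw (fun ω => (Z 0 ω i, W ω)) μ := by
    have hp := HasGaussianLaw.prodMk (X := fun i ω => Z 0 ω i) (P := μ) h.gauss i j
    have := hp.map_fun ((ContinuousLinearMap.fst ℝ ℝ ℝ).prod
      (s⁻¹ • (ContinuousLinearMap.snd ℝ ℝ ℝ - ρ • ContinuousLinearMap.fst ℝ ℝ ℝ)))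
    have e : (fun ω => (Z 0 ω i, W ω)) = fun ω => ((ContinuousLinearMap.fst ℝ ℝ ℝ).prod
        (s⁻¹ • (ContinuousLinearMap.snd ℝ ℝ ℝ - ρ • ContinuousLinearMap.fst ℝ ℝ ℝ)))
        (Z 0 ω i, Z 0 ω j) := by
      ext ω
      · simp
      · simp [hW, div_eq_inv_mul]
    rw [e]
    exact this
  have hcW : cov[fun ω => Z 0 ω i, W; μ] = 0 := by
    rw [hW, covariance_fun_div_right, covariance_fun_sub_right hLi hLj hLρ,
      covariance_const_mul_right, hcov, hvi]
    simp
  have hind : IndepFun (fun ω => Z 0 ω i) W μ := hgauss.indepFun_of_covariance_eq_zero hcW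
  have hmapW : μ.map W = gaussianReal 0 1 := by
    have h2 := hgauss.snd.map_eq_gaussianReal
    have hm : ∫ ω, W ω ∂μ = 0 := by
      rw [hW, integral_div, integral_sub (hLj.integrable one_le_two)
        (hLρ.integrable one_le_two), integral_const_mul, h.mean, h.mean]
      simp
    have hv : Var[W; μ] = 1 := by
      rw [← covariance_self hWm.aemeasurable, hW, covariance_fun_div_left,
        covariance_fun_div_right, covariance_fun_sub_left hLj hLρ  hLd,
        covariance_fun_sub_right hLj hLj hLρ, covariance_fun_sub_right hLρ hLj hLρ,
        covariance_const_mul_right, covariance_const_mul_left, covariance_const_mul_left,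
        covariance_const_mul_right, hvi, hvj, hcov, hcov']
      field_simp
      rw [hs2]
      ring
    rw [hm, hv] at h2
    simpa using h2
  have hpair := (indepFun_iff_map_prod_eq_prod_map_map (h.measurable_eval 0 i).aemeasurable
    hWm.aemeasurable).1 hind
  rw [h.map_eval, hmapW] at hpair
  rw [bivariateGaussian, ← hpair, Measure.map_map (measurable_correlate ρ)
    ((h.measurable_eval 0 i).prodMk hWm)]
  congr 1
  ext ω : 1
  simp only [Function.comp_apply, hW, ← hs_def]
  rw [mul_div_cancel₀ _ hs.ne']
  simp

/-- Different rows are independent whatever the columns are. The case `i = j` is included, which is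
why `X` and `Y` may overlap. -/
theorem map_pair_of_ne (h : IsGaussianSample μ Z) {n m : ℕ} (hnm : n ≠ m) (i j : Fin M) :
    μ.map (fun ω => (Z n ω i, Z m ω j)) = bivariateGaussian 0 := by
  have hind : IndepFun (fun ω => Z n ω i) (fun ω => Z m ω j) μ :=
    (h.indep.indepFun hnm).comp (measurable_pi_apply i) (measurable_pi_apply j)
  rw [(indepFun_iff_map_prod_eq_prod_map_map (h.measurable_eval n i).aemeasurable
    (h.measurable_eval m j).aemeasurable).1 hind, h.map_eval, h.map_eval, bivariateGaussian_zero]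

theorem memLp_pair (h : IsGaussianSample μ Z) (n m : ℕ) (i j : Fin M) {f : ℝ × ℝ → ℝ}
    (hf : Measurable f) {c : ℝ} (hc : ∀ z, |f z| ≤ c * (1 + z.1 ^ 2 + z.2 ^ 2)) :
    MemLp (fun ω => f (Z n ω i, Z m ω j)) 2 μ := by
  have h1 : MemLp (fun ω => Z n ω i ^ 2) 2 μ :=
    memLp_two_mul_of_memLp_four (h.memLp_eval n i 4 (by simp))
  have h2 : MemLp (fun ω => Z m ω j ^ 2) 2 μ :=
    memLp_two_mul_of_memLp_four (h.memLp_eval m j 4 (by simp))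
  have h3 : MemLp (fun ω => c * (1 + Z n ω i ^ 2 + Z m ω j ^ 2)) 2 μ :=
    (((memLp_const (1 : ℝ)).add h1).add h2).const_mul c
  refine h3.mono (hf.comp (h.measurable_pair n m i j)).aestronglyMeasurable
    (ae_of_all _ fun ω => ?_)
  rw [Real.norm_eq_abs, Real.norm_eq_abs]
  exact (hc _).trans (le_abs_self _)

/-- Two columns of an i.i.d. Gaussian sample obey the law of large numbers. -/
theorem pairLLN (h : IsGaussianSample μ Z) {i j : Fin M} (hij : |popCov μ (Z 0) i j| < 1) :
    PairLLN (probFilter μ) (fun _ ω n => Z n ω i) (fun _ ω n => Z n ω j)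
      (popCov μ (Z 0) i j) := by
  rintro f hf ⟨c, hc⟩
  have hmeas : ∀ n, Measurable fun ω => f (Z n ω i, Z n ω j) := fun n =>
    hf.comp (h.measurable_pair n n i j)
  have hφ : Measurable fun v : Fin M → ℝ => f (v i, v j) := by fun_prop
  have hpw : Pairwise (Function.onFun (fun A B : Ω → ℝ => A ⟂ᵢ[μ] B)
      fun n ω => f (Z n ω i, Z n ω j)) := fun n m hnm =>
    (h.indep.indepFun hnm).comp hφ hφ
  have hid : ∀ n, IdentDistrib (fun ω => f (Z n ω i, Z n ω j)) (fun ω => f (Z 0 ω i, Z 0 ω j))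
      μ μ := fun n => (h.identDistrib_pair n i j).comp hf
  have hint0 : Integrable (fun ω => f (Z 0 ω i, Z 0 ω j)) μ :=
    (h.memLp_pair 0 0 i j hf hc).integrable one_le_two
  have hlaw := strong_law_ae (μ := μ) (fun n ω => f (Z n ω i, Z n ω j)) hint0 hpw hid
  have hint : ∫ ω, f (Z 0 ω i, Z 0 ω j) ∂μ = ∫ z, f z ∂bivariateGaussian (popCov μ (Z 0) i j) := by
    rw [← h.map_pair 0 hij, integral_map (h.measurable_pair 0 0 i j).aemeasurable
      hf.aestronglyMeasurable]
  rw [hint] at hlaw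
  have hsm : ∀ N : ℕ, AEStronglyMeasurable (fun ω => (N : ℝ)⁻¹ •
      ∑ n ∈ Finset.range N, f (Z n ω i, Z n ω j)) μ := fun N =>
    (Measurable.const_mul (Finset.measurable_sum _ fun n _ => hmeas n) _).aestronglyMeasurable
  have hconv := tendsto_probFilter_of_tendstoInMeasure (tendstoInMeasure_of_tendsto_ae hsm hlaw)
  refine hconv.congr fun x => ?_
  have e := Fin.sum_univ_eq_sum_range (fun n => f (Z n x.2 i, Z n x.2 j)) x.1
  rw [smul_eq_mul, one_div, ← e]

/-- Burnside's lemma for the transitive action of the symmetric group: a permutation has one fixed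
point on average. -/
theorem sum_card_fixed (N : ℕ) [NeZero N] :
    ∑ τ : Equiv.Perm (Fin N), ((Finset.univ.filter fun n => τ n = n).card : ℝ) = (N ! : ℕ) := by
  classical
  have h := MulAction.sum_card_fixedBy_eq_card_orbits_mul_card_group (Equiv.Perm (Fin N)) (Fin N)
  have h1 : Fintype.card (Quotient (MulAction.orbitRel (Equiv.Perm (Fin N)) (Fin N))) = 1 := by
    have : Subsingleton (Quotient (MulAction.orbitRel (Equiv.Perm (Fin N)) (Fin N))) :=
      (MulAction.pretransitive_iff_subsingleton_quotient _ _).1 inferInstance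
    exact Fintype.card_eq_one_iff.2 ⟨⟦0⟧, fun y => Subsingleton.elim _ _⟩
  rw [h1, one_mul, Fintype.card_perm, Fintype.card_fin] at h
  rw [← h]
  push_cast
  refine Finset.sum_congr rfl fun τ _ => ?_
  rw [Fintype.card_of_subtype (Finset.univ.filter fun n => τ n = n)]
  simp [MulAction.mem_fixedBy]

/-- The second moment of a sum of centred functions of the pairs `(n, π n)` of rows. -/
theorem integral_sq_sum_le (h : IsGaussianSample μ Z) (i j : Fin M) {f : ℝ × ℝ → ℝ}
    (hf : Measurable f) {c : ℝ} (hc : ∀ z, |f z| ≤ c * (1 + z.1 ^ 2 + z.2 ^ 2))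
    (hf0 : ∫ z, f z ∂bivariateGaussian 0 = 0) {S : ℝ}
    (hS : ∀ n m, ∫ ω, f (Z n ω i, Z m ω j) ^ 2 ∂μ ≤ S) {N : ℕ} (π : Equiv.Perm (Fin N)) :
    ∫ ω, (∑ n : Fin N, f (Z n ω i, Z (π n) ω j)) ^ 2 ∂μ ≤
      S * (N * (3 + (Finset.univ.filter fun n => π n = n).card)) := by
  set W : Fin N → Ω → ℝ := fun n ω => f (Z n ω i, Z (π n) ω j) with hW
  have hL : ∀ n, MemLp (W n) 2 μ := fun n => h.memLp_pair _ _ i j hf hc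
  have hint : ∀ n m, Integrable (fun ω => W n ω * W m ω) μ := fun n m =>
    (hL n).integrable_mul (hL m)
  have hS0 : 0 ≤ S := (integral_nonneg fun ω => sq_nonneg _).trans (hS 0 0)
  have hbound : ∀ n m, ∫ ω, W n ω * W m ω ∂μ ≤ S := by
    intro n m
    have h2 : ∫ ω, W n ω * W m ω ∂μ ≤ ∫ ω, (W n ω ^ 2 + W m ω ^ 2) / 2 ∂μ :=
      integral_mono (hint n m) (((hL n).integrable_sq.add (hL m).integrable_sq).div_const 2)
        fun ω => by
          show W n ω * W m ω ≤ (W n ω ^ 2 + W m ω ^ 2) / 2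
          nlinarith [sq_nonneg (W n ω - W m ω)]
    rw [integral_div, integral_add (hL n).integrable_sq (hL m).integrable_sq] at h2
    have := hS n (π n)
    have := hS m (π m)
    linarith
  -- The four conditions make the row pairs `(n, π n)` and `(m, π m)` disjoint, hence independent,
  -- and make the first term centred. A fixed point would pair a row with itself, where the mean
  -- need not vanish.
  have hzero : ∀ n m, n ≠ m → n ≠ π m → π n ≠ m → π n ≠ n → ∫ ω, W n ω * W m ω ∂μ = 0 := by
    intro n m h1 h2 h3 h4
    have hne : π n ≠ π m := fun h => h1 (π.injective h)
    have hv : ∀ {a b : Fin N}, a ≠ b → (a : ℕ) ≠ b := fun hab h => hab (Fin.ext h)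
    have hφ : Measurable fun v : (Fin M → ℝ) × (Fin M → ℝ) => f (v.1 i, v.2 j) := by fun_prop
    have hind : IndepFun (W n) (W m) μ :=
      (h.indep.indepFun_prodMk_prodMk h.meas n (π n) m (π m) (hv h1) (hv h2) (hv h3)
        (hv hne)).comp hφ hφ
    have hmean : ∫ ω, W n ω ∂μ = 0 := by
      rw [hW]
      rw [← hf0, ← h.map_pair_of_ne (hv h4.symm) i j,
        integral_map (h.measurable_pair _ _ i j).aemeasurable hf.aestronglyMeasurable]
    rw [hind.integral_fun_mul_eq_mul_integral (hL n).aestronglyMeasurable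
      (hL m).aestronglyMeasurable, hmean, zero_mul]
  have hexp : ∫ ω, (∑ n, W n ω) ^ 2 ∂μ = ∑ n, ∑ m, ∫ ω, W n ω * W m ω ∂μ := by
    simp_rw [sq, Finset.sum_mul_sum]
    rw [integral_finsetSum _ fun n _ => integrable_finsetSum _ fun m _ => hint n m]
    exact Finset.sum_congr rfl fun n _ => integral_finsetSum _ fun m _ => hint n m
  rw [hexp]
  -- Each of the first three exceptional coincidences occurs for exactly `N` pairs, and the last one
  -- for `N` pairs per fixed point. Every exceptional pair contributes at most `S`.
  calc ∑ n, ∑ m, ∫ ω, W n ω * W m ω ∂μ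
      ≤ ∑ n, ∑ m, S * ((if n = m then 1 else 0) + (if n = π m then 1 else 0) +
          (if π n = m then 1 else 0) + (if π n = n then 1 else 0)) := by
        refine Finset.sum_le_sum fun n _ => Finset.sum_le_sum fun m _ => ?_
        by_cases hgood : n ≠ m ∧ n ≠ π m ∧ π n ≠ m ∧ π n ≠ n
        · obtain ⟨h1, h2, h3, h4⟩ := hgood
          simp [hzero n m h1 h2 h3 h4, h1, h2, h3, h4]
        · refine (hbound n m).trans (le_mul_of_one_le_right hS0 ?_)
          have h0 : ∀ p : Prop, ∀ [Decidable p], (0 : ℝ) ≤ if p then 1 else 0 := by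
            intro p _
            positivity
          have a1 := h0 (n = m)
          have a2 := h0 (n = π m)
          have a3 := h0 (π n = m)
          have a4 := h0 (π n = n)
          by_cases c1 : n = m
          · rw [if_pos c1] at *; linarith
          by_cases c2 : n = π m
          · rw [if_pos c2] at *; linarith
          by_cases c3 : π n = m
          · rw [if_pos c3] at *; linarith
          by_cases c4 : π n = n
          · rw [if_pos c4] at *; linarith
          exact absurd ⟨c1, c2, c3, c4⟩ hgood
    _ = _ := by
        simp_rw [← Finset.mul_sum, Finset.sum_add_distrib]
        have e2 : ∀ n : Fin N, (∑ m, if n = π m then (1 : ℝ) else 0) = 1 := by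
          intro n
          rw [Finset.sum_eq_single (π.symm n)]
          · simp
          · intro b _ hb
            exact if_neg fun h => hb (by simp [h])
          · simp
        simp_rw [e2]
        simp only [Finset.sum_ite_eq, Finset.mem_univ, if_true, Finset.sum_const, Finset.card_univ,
          Fintype.card_fin, nsmul_eq_mul, mul_one, ← Finset.mul_sum, Finset.sum_boole]
        ring

/-- A column and a randomly permuted column of an i.i.d. Gaussian sample obey the law of large
numbers for independent variables. -/
theorem pairLLN_perm (h : IsGaussianSample μ Z) (i j : Fin M)
    {σ : (N : ℕ) → Ω → Equiv.Perm (Fin N)}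
    (hσ : ∀ N, IsUniformIndepPerm μ (σ N) (fun ω (n : Fin N) => Z n ω)) :
    PairLLN (probFilter μ) (fun _ ω n => Z n ω i) (fun N ω n => Z ((σ N ω)⁻¹ n) ω j) 0 := by
  rintro f hf ⟨c, hc⟩
  set m := ∫ z, f z ∂bivariateGaussian 0 with hm
  have hfint : Integrable f (bivariateGaussian 0) :=
    (memLp_two_of_quadratic_growth (by simp) hf hc).integrable one_le_two
  set g : ℝ × ℝ → ℝ := fun z => f z - m with hg
  have hgm : Measurable g := hf.sub_const m
  have hgc : ∀ z, |g z| ≤ (c + |m|) * (1 + z.1 ^ 2 + z.2 ^ 2) := by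
    intro z
    have h1 : |g z| ≤ |f z| + |m| := abs_sub _ _
    nlinarith [hc z, abs_nonneg m, sq_nonneg z.1, sq_nonneg z.2,
      mul_nonneg (abs_nonneg m) (sq_nonneg z.1), mul_nonneg (abs_nonneg m) (sq_nonneg z.2)]
  have hg0 : ∫ z, g z ∂bivariateGaussian 0 = 0 := by
    rw [hg, integral_sub hfint (integrable_const m)]
    simp [← hm]
  set S := max (∫ ω, g (Z 0 ω i, Z 0 ω j) ^ 2 ∂μ) (∫ z, g z ^ 2 ∂bivariateGaussian 0) with hS_def
  -- Only two laws occur: that of two entries of one row and that of entries of two independent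
  -- rows.
  have hS : ∀ n m, ∫ ω, g (Z n ω i, Z m ω j) ^ 2 ∂μ ≤ S := by
    intro n l
    by_cases hnl : n = l
    · subst hnl
      have := ((h.identDistrib_pair n i j).comp (u := fun z => g z ^ 2) (by fun_prop)).integral_eq
      exact (le_of_eq this).trans (le_max_left _ _)
    · refine (le_of_eq ?_).trans (le_max_right _ _)
      rw [← h.map_pair_of_ne hnl i j, integral_map (h.measurable_pair n l i j).aemeasurable
        (by fun_prop)]
  have hS0 : 0 ≤ S := (integral_nonneg fun ω => sq_nonneg _).trans (hS 0 0)
  have hfix : ∀ {N : ℕ} (τ : Equiv.Perm (Fin N)), (Finset.univ.filter fun n => τ⁻¹ n = n) =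
      Finset.univ.filter fun n => τ n = n := by
    intro N τ
    ext n
    simp only [Finset.mem_filter, Finset.mem_univ, true_and, Equiv.Perm.inv_eq_iff_eq]
    exact eq_comm
  rw [Metric.tendsto_nhds]
  intro ε hε
  rw [eventually_probFilter_iff]
  have hmain : ∀ N : ℕ, 1 ≤ N → μ.real {ω | ¬ dist ((1 / (N : ℝ)) *
      ∑ n : Fin N, f (Z n ω i, Z ((σ N ω)⁻¹ n) ω j)) m < ε} ≤ 4 * S / ε ^ 2 * (1 / (N : ℝ)) := by
    intro N hN
    have hN0 : (0 : ℝ) < N := by exact_mod_cast hN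
    have : NeZero N := ⟨by omega⟩
    -- For a fixed permutation Chebyshev's inequality applies to the event `E τ`, which depends on
    -- the data alone. Independence then allows averaging over `τ`.
    set E : Equiv.Perm (Fin N) → Set Ω := fun τ =>
      {ω | (N * ε) ^ 2 ≤ (∑ n : Fin N, g (Z n ω i, Z (τ⁻¹ n) ω j)) ^ 2} with hE
    have hEle : ∀ τ, μ.real (E τ) ≤
        S / (N * ε ^ 2) * (3 + (Finset.univ.filter fun n => τ n = n).card) := by
      intro τ
      have hL : MemLp (fun ω => ∑ n : Fin N, g (Z n ω i, Z (τ⁻¹ n) ω j)) 2 μ :=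
        memLp_finsetSum _ fun n _ => h.memLp_pair _ _ i j hgm hgc
      have h1 := mul_meas_ge_le_integral_of_nonneg (ae_of_all μ fun ω =>
        sq_nonneg (∑ n : Fin N, g (Z n ω i, Z (τ⁻¹ n) ω j))) hL.integrable_sq ((N * ε) ^ 2)
      have h2 := h1.trans (h.integral_sq_sum_le i j hgm hgc hg0 hS τ⁻¹)
      rw [hfix] at h2
      rw [div_mul_eq_mul_div, le_div_iff₀ (by positivity)]
      have h3 : (N : ℝ) * (μ.real (E τ) * (N * ε ^ 2)) ≤
          N * (S * (3 + (Finset.univ.filter fun n => τ n = n).card)) := by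
        calc _ = (N * ε) ^ 2 * μ.real (E τ) := by ring
          _ ≤ _ := h2
          _ = _ := by ring
      exact le_of_mul_le_mul_left h3 hN0
    have hindep : ∀ τ, μ.real ({ω | σ N ω = τ} ∩ E τ) = ((N ! : ℕ) : ℝ)⁻¹ * μ.real (E τ) := by
      intro τ
      obtain ⟨-, h1, h2⟩ := hσ N τ
      have hB : MeasurableSet {v : Fin N → Fin M → ℝ |
          (N * ε) ^ 2 ≤ (∑ n : Fin N, g (v n i, v (τ⁻¹ n) j)) ^ 2} :=
        measurableSet_le measurable_const (by fun_prop)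
      have h3 := h2 _ hB
      rw [h1] at h3
      rw [measureReal_def, measureReal_def]
      have h4 := congrArg ENNReal.toReal h3
      rw [ENNReal.toReal_mul, ENNReal.toReal_inv, ENNReal.toReal_natCast] at h4
      exact h4
    have hsub : {ω | ¬ dist ((1 / (N : ℝ)) *
        ∑ n : Fin N, f (Z n ω i, Z ((σ N ω)⁻¹ n) ω j)) m < ε} ⊆
        ⋃ τ ∈ (Finset.univ : Finset (Equiv.Perm (Fin N))), ({ω | σ N ω = τ} ∩ E τ) := by
      intro ω hω
      simp only [Finset.mem_univ, Set.iUnion_true, Set.mem_iUnion]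
      refine ⟨σ N ω, rfl, ?_⟩
      have h1 : ε ≤ |(1 / (N : ℝ)) * ∑ n : Fin N, f (Z n ω i, Z ((σ N ω)⁻¹ n) ω j) - m| :=
        not_lt.1 hω
      have h2 : ∑ n : Fin N, g (Z n ω i, Z ((σ N ω)⁻¹ n) ω j) =
          N * ((1 / (N : ℝ)) * ∑ n : Fin N, f (Z n ω i, Z ((σ N ω)⁻¹ n) ω j) - m) := by
        rw [hg, Finset.sum_sub_distrib]
        simp only [Finset.sum_const, Finset.card_univ, Fintype.card_fin, nsmul_eq_mul]
        field_simp
      show (N * ε) ^ 2 ≤ (∑ n : Fin N, g (Z n ω i, Z ((σ N ω)⁻¹ n) ω j)) ^ 2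
      rw [h2, mul_pow, mul_pow]
      have := sq_le_sq' (by linarith [abs_nonneg ε, hε]) h1
      rw [sq_abs] at this
      gcongr
    calc μ.real {ω | ¬ dist ((1 / (N : ℝ)) *
        ∑ n : Fin N, f (Z n ω i, Z ((σ N ω)⁻¹ n) ω j)) m < ε}
        ≤ μ.real (⋃ τ ∈ (Finset.univ : Finset (Equiv.Perm (Fin N))), ({ω | σ N ω = τ} ∩ E τ)) :=
          measureReal_mono hsub (measure_ne_top _ _)
      _ ≤ ∑ τ, μ.real ({ω | σ N ω = τ} ∩ E τ) := measureReal_biUnion_finset_le _ _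
      _ ≤ ∑ τ : Equiv.Perm (Fin N), ((N ! : ℕ) : ℝ)⁻¹ *
          (S / (N * ε ^ 2) * (3 + (Finset.univ.filter fun n => τ n = n).card)) := by
          refine Finset.sum_le_sum fun τ _ => ?_
          rw [hindep]
          gcongr
          exact hEle τ
      _ = _ := by
          have hfac : ((N ! : ℕ) : ℝ) ≠ 0 := by exact_mod_cast N.factorial_ne_zero
          -- The average of `3 +` the number of fixed points is four.
          rw [← Finset.mul_sum, ← Finset.mul_sum, Finset.sum_add_distrib, sum_card_fixed]
          simp only [Finset.sum_const, Finset.card_univ, Fintype.card_perm, Fintype.card_fin,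
            nsmul_eq_mul]
          field_simp
          ring
  have hlim : Tendsto (fun N : ℕ => ENNReal.ofReal (4 * S / ε ^ 2 * (1 / (N : ℝ)))) atTop (𝓝 0) := by
    have := ENNReal.tendsto_ofReal (tendsto_one_div_atTop_nhds_zero_nat.const_mul (4 * S / ε ^ 2))
    simpa using this
  refine tendsto_of_tendsto_of_tendsto_of_le_of_le' tendsto_const_nhds hlim
    (Eventually.of_forall fun _ => zero_le) ?_
  filter_upwards [eventually_ge_atTop 1] with N hN
  rw [← ofReal_measureReal (measure_ne_top _ _)]
  exact ENNReal.ofReal_le_ofReal (hmain N hN)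

end IsGaussianSample

/-- For correlation zero the law is a product of two equal factors, hence invariant under the swap.
-/
theorem PairLLN.swap_zero {l : Filter (ℕ × Ω)} {U V : (N : ℕ) → Ω → Fin N → ℝ}
    (h : PairLLN l U V 0) : PairLLN l V U 0 := by
  rintro f hf ⟨c, hc⟩
  have := h (fun z => f z.swap) (hf.comp measurable_swap)
    ⟨c, fun z => (hc _).trans_eq (by simp only [Prod.fst_swap, Prod.snd_swap]; ring)⟩
  rw [bivariateGaussian_zero] at this ⊢
  rwa [integral_prod_swap] at this

end LawOfLargeNumbers

/-! ### Levels and empirical thresholds -/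

section Levels

/-- The level `t ∈ {1, …, C}` with `T t < x ≤ T (t + 1)`. -/
def level (C : ℕ) (T : ℕ → EReal) (x : ℝ) : ℕ :=
  open Classical in
  ∑ t ∈ Finset.Icc 1 C, if T t < (x : EReal) ∧ (x : EReal) ≤ T (t + 1) then t else 0

theorem discretize_eq_level (C : ℕ) (T : ℕ → EReal) (x : ℝ) :
    discretize C T x = (level C T x : ℝ) := by
  simp [discretize, level]

theorem IsThresholds.monotoneOn {C : ℕ} {T : ℕ → EReal} (h : IsThresholds C T) {s t : ℕ}
    (hs : 1 ≤ s) (hst : s ≤ t) (ht : t ≤ C + 1) : T s ≤ T t :=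
  h.2.2.monotoneOn ⟨hs, hst.trans ht⟩ ⟨hs.trans hst, ht⟩ hst

theorem IsThresholds.lt {C : ℕ} {T : ℕ → EReal} (h : IsThresholds C T) {s t : ℕ}
    (hs : 1 ≤ s) (hst : s < t) (ht : t ≤ C + 1) : T s < T t :=
  h.2.2 ⟨hs, hst.le.trans ht⟩ ⟨hs.trans hst.le, ht⟩ hst

theorem IsThresholds.exists_cell {C : ℕ} {T : ℕ → EReal} (h : IsThresholds C T) (hC : 1 ≤ C)
    (x : ℝ) : ∃ t ∈ Finset.Icc 1 C, T t < (x : EReal) ∧ (x : EReal) ≤ T (t + 1) := by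
  classical
  have hex : ∃ t, 1 ≤ t ∧ (x : EReal) ≤ T (t + 1) := ⟨C, hC, by rw [h.2.1]; exact le_top⟩
  obtain ⟨h1, h2⟩ := Nat.find_spec hex
  have hle : Nat.find hex ≤ C := Nat.find_min' hex ⟨hC, by rw [h.2.1]; exact le_top⟩
  refine ⟨Nat.find hex, Finset.mem_Icc.2 ⟨h1, hle⟩, ?_, h2⟩
  rcases h1.eq_or_lt with h3 | h3
  · rw [← h3, h.1]
    exact EReal.bot_lt_coe x
  · have := Nat.find_min hex (m := Nat.find hex - 1) (by omega)
    rw [Nat.sub_add_cancel h1] at this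
    by_contra hx
    exact this ⟨by omega, not_lt.1 hx⟩

theorem IsThresholds.cell_unique {C : ℕ} {T : ℕ → EReal} (h : IsThresholds C T) {x : ℝ} {s t : ℕ}
    (hs : s ∈ Finset.Icc 1 C) (ht : t ∈ Finset.Icc 1 C)
    (hxs : T s < (x : EReal) ∧ (x : EReal) ≤ T (s + 1))
    (hxt : T t < (x : EReal) ∧ (x : EReal) ≤ T (t + 1)) : s = t := by
  rw [Finset.mem_Icc] at hs ht
  rcases lt_trichotomy s t with hst | hst | hst
  · exact absurd (hxs.2.trans (h.monotoneOn (by omega) hst (by omega))) (not_le.2 hxt.1)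
  · exact hst
  · exact absurd (hxt.2.trans (h.monotoneOn (by omega) hst (by omega))) (not_le.2 hxs.1)

/-- A sum over the cells of a function supported on the cell of `x`. -/
theorem IsThresholds.sum_cell {C : ℕ} {T : ℕ → EReal} (h : IsThresholds C T) {R : Type*}
    [AddCommMonoid R] {x : ℝ} {s : ℕ} (hs : s ∈ Finset.Icc 1 C)
    (hxs : T s < (x : EReal) ∧ (x : EReal) ≤ T (s + 1)) (g : ℕ → R)
    [∀ t, Decidable (T t < (x : EReal) ∧ (x : EReal) ≤ T (t + 1))] :
    (∑ t ∈ Finset.Icc 1 C, if T t < (x : EReal) ∧ (x : EReal) ≤ T (t + 1) then g t else 0) =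
      g s := by
  rw [Finset.sum_eq_single s]
  · exact if_pos hxs
  · intro t ht hts
    exact if_neg fun hxt => hts (h.cell_unique ht hs hxt hxs)
  · exact fun hn => absurd hs hn

theorem IsThresholds.level_spec {C : ℕ} {T : ℕ → EReal} (h : IsThresholds C T) (hC : 1 ≤ C)
    (x : ℝ) : level C T x ∈ Finset.Icc 1 C ∧ T (level C T x) < (x : EReal) ∧
      (x : EReal) ≤ T (level C T x + 1) := by
  classical
  obtain ⟨t, ht, hx⟩ := h.exists_cell hC x
  have : level C T x = t := by
    rw [level]
    exact h.sum_cell ht hx (fun t => t)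
  rw [this]
  exact ⟨ht, hx⟩

theorem IsThresholds.level_eq_iff {C : ℕ} {T : ℕ → EReal} (h : IsThresholds C T) (hC : 1 ≤ C)
    {x : ℝ} {t : ℕ} (ht : t ∈ Finset.Icc 1 C) :
    level C T x = t ↔ T t < (x : EReal) ∧ (x : EReal) ≤ T (t + 1) := by
  obtain ⟨h1, h2⟩ := h.level_spec hC x
  constructor
  · rintro rfl
    exact h2
  · exact fun hx => h.cell_unique h1 ht h2 hx

theorem IsThresholds.level_le_iff {C : ℕ} {T : ℕ → EReal} (h : IsThresholds C T) (hC : 1 ≤ C)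
    {x : ℝ} {t : ℕ} (ht : t ≤ C) : level C T x ≤ t ↔ (x : EReal) ≤ T (t + 1) := by
  obtain ⟨h1, h2, h3⟩ := h.level_spec hC x
  rw [Finset.mem_Icc] at h1
  constructor
  · intro hle
    exact h3.trans (h.monotoneOn (by omega) (by omega) (by omega))
  · intro hx
    by_contra hlt
    exact absurd (hx.trans (h.monotoneOn (by omega) (not_le.1 hlt) (by omega))) (not_le.2 h2)

/-- The threshold estimate from the number of observations at most `a`. -/
def empThreshold {N : ℕ} (V : Fin N → ℝ) (a : EReal) : EReal :=
  open Classical in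
  stdQuantile (((Finset.univ.filter fun n => (V n : EReal) ≤ a).card : ℝ) / N)

/-- The level of `x` is at most `t - 1` exactly when `x ≤ T t`. So the estimated thresholds see the
latent column only through its empirical distribution function at the true thresholds. -/
theorem estThreshold_discretize {C : ℕ} {T : ℕ → EReal} (h : IsThresholds C T) (hC : 1 ≤ C)
    {N : ℕ} (V : Fin N → ℝ) {t : ℕ} (ht1 : 1 ≤ t) (ht : t ≤ C + 1) :
    estThreshold (fun n => discretize C T (V n)) (t : ℝ) = empThreshold V (T t) := by
  classical
  obtain ⟨s, rfl⟩ : ∃ s, t = s + 1 := ⟨t - 1, by omega⟩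
  rw [estThreshold, empThreshold]
  congr 4
  ext n
  simp only [Finset.mem_filter, Finset.mem_univ, true_and]
  rw [discretize_eq_level, ← h.level_le_iff hC (by omega)]
  push_cast
  rw [add_sub_cancel_right, Nat.cast_le]

theorem stdCdf_empThreshold {N : ℕ} (V : Fin N → ℝ) (a : EReal) :
    stdCdf (empThreshold V a) = (1 / (N : ℝ)) * ∑ n, {x : ℝ | (x : EReal) ≤ a}.indicator 1 (V n) := by
  classical
  have hcard : ((Finset.univ.filter fun n => (V n : EReal) ≤ a).card : ℝ) ≤ N := by
    exact_mod_cast (Finset.card_filter_le _ _).trans_eq (by simp)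
  rw [empThreshold, stdCdf_stdQuantile (by positivity)]
  · simp only [Set.indicator_apply, Set.mem_ofPred_eq, Pi.one_apply, Finset.sum_boole]
    rw [one_div, div_eq_inv_mul]
  · rcases Nat.eq_zero_or_pos N with rfl | hN
    · simp
    · rw [div_le_one (by exact_mod_cast hN)]
      exact hcard

theorem empThreshold_mono {N : ℕ} (V : Fin N → ℝ) {a b : EReal} (hab : a ≤ b) :
    empThreshold V a ≤ empThreshold V b := by
  rw [← stdCdf_strictMono.le_iff_le, stdCdf_empThreshold, stdCdf_empThreshold]
  refine mul_le_mul_of_nonneg_left (Finset.sum_le_sum fun n _ => ?_) (by positivity)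
  exact Set.indicator_le_indicator_of_subset (fun x hx => le_trans hx hab) (fun _ => (zero_le_one : (0 : ℝ) ≤ 1)) _

/-- An observation between `a` and `b` separates the empirical frequencies. Consequently every
observed cell has positive fitted probability, and the default value of the logarithm at zero never
enters the likelihood of a row. -/
theorem empThreshold_lt {N : ℕ} (V : Fin N → ℝ) {a b : EReal} {n : Fin N} (ha : a < V n)
    (hb : (V n : EReal) ≤ b) : empThreshold V a < empThreshold V b := by
  have hN : (0 : ℝ) < N := by exact_mod_cast n.pos
  rw [← stdCdf_strictMono.lt_iff_lt, stdCdf_empThreshold, stdCdf_empThreshold]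
  refine mul_lt_mul_of_pos_left (Finset.sum_lt_sum (fun m _ => ?_) ⟨n, Finset.mem_univ n, ?_⟩)
    (by positivity)
  · exact Set.indicator_le_indicator_of_subset (fun x hx => le_trans hx (ha.le.trans hb))
      (fun _ => (zero_le_one : (0 : ℝ) ≤ 1)) _
  · rw [Set.indicator_of_notMem (by exact not_le.2 ha), Set.indicator_of_mem (by exact hb)]
    exact zero_lt_one

theorem empThreshold_bot {N : ℕ} (V : Fin N → ℝ) : empThreshold V ⊥ = ⊥ := by
  apply stdCdf_strictMono.injective
  rw [stdCdf_empThreshold, stdCdf_bot]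
  simp

theorem empThreshold_top {N : ℕ} (hN : 1 ≤ N) (V : Fin N → ℝ) : empThreshold V ⊤ = ⊤ := by
  have hN' : (N : ℝ) ≠ 0 := by positivity
  apply stdCdf_strictMono.injective
  rw [stdCdf_empThreshold, stdCdf_top]
  simp [hN']

variable {Ω : Type*} {l : Filter (ℕ × Ω)} {U V : (N : ℕ) → Ω → Fin N → ℝ} {ρ : ℝ}

theorem PairLLN.tendsto_freq (h : PairLLN l U V ρ) {E : Set (ℝ × ℝ)} (hE : MeasurableSet E) :
    Tendsto (fun x : ℕ × Ω => (1 / (x.1 : ℝ)) * ∑ n, E.indicator 1 (U x.1 x.2 n, V x.1 x.2 n)) l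
      (𝓝 ((bivariateGaussian ρ).real E)) := by
  rw [← integral_indicator_one hE]
  refine h _ (measurable_one.indicator hE) ⟨1, fun z => ?_⟩
  have h1 : |E.indicator (1 : ℝ × ℝ → ℝ) z| ≤ 1 := by
    by_cases hz : z ∈ E <;> simp [hz]
  nlinarith [sq_nonneg z.1, sq_nonneg z.2]

/-- The frequency of `U ≤ a` tends to `stdCdf a`, and convergence passes through the inverse of the
strictly increasing `stdCdf`, also at infinite `a`. -/
theorem PairLLN.tendsto_empThreshold_fst (h : PairLLN l U V ρ) (a : EReal) :
    Tendsto (fun x : ℕ × Ω => empThreshold (U x.1 x.2) a) l (𝓝 a) := by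
  apply tendsto_of_tendsto_stdCdf
  have h1 := h.tendsto_freq (measurableSet_coe_le measurable_fst a)
  have h2 : (bivariateGaussian ρ).real {z | (z.1 : EReal) ≤ a} = stdCdf a := by
    rw [stdCdf, ← map_fst_bivariateGaussian ρ, map_measureReal_apply measurable_fst
      (measurableSet_coe_le (f := fun x : ℝ => x) measurable_id a)]
    rfl
  rw [h2] at h1
  refine h1.congr fun x => ?_
  rw [stdCdf_empThreshold]
  rfl

theorem PairLLN.tendsto_empThreshold_snd (hρ : |ρ| < 1) (h : PairLLN l U V ρ) (a : EReal) :
    Tendsto (fun x : ℕ × Ω => empThreshold (V x.1 x.2) a) l (𝓝 a) := by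
  apply tendsto_of_tendsto_stdCdf
  have h1 := h.tendsto_freq (measurableSet_coe_le measurable_snd a)
  have h2 : (bivariateGaussian ρ).real {z | (z.2 : EReal) ≤ a} = stdCdf a := by
    rw [stdCdf, ← map_snd_bivariateGaussian hρ, map_measureReal_apply measurable_snd
      (measurableSet_coe_le (f := fun x : ℝ => x) measurable_id a)]
    rfl
  rw [h2] at h1
  refine h1.congr fun x => ?_
  rw [stdCdf_empThreshold]
  rfl

end Levels

/-! ### Identification of the correlation by the pairwise likelihoods -/

section Likelihood

/-- Along every ultrafilter finer than `l`, the criterion `ℓ` at parameters that converge to `ρ` is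
asymptotically at most the criterion at `ρ₀`, and smaller by a fixed amount if `ρ ≠ ρ₀`. -/
def Separates {α : Type*} (l : Filter α) (ℓ : α → ℝ → ℝ) (ρ₀ : ℝ) : Prop :=
  ∀ u : Ultrafilter α, (u : Filter α) ≤ l → ∀ (r : α → ℝ) (ρ : ℝ),
    (∀ᶠ x in (u : Filter α), |r x| < 1) → Tendsto r u (𝓝 ρ) →
    ∃ d, 0 ≤ d ∧ (ρ ≠ ρ₀ → 0 < d) ∧
      ∀ η > 0, ∀ᶠ x in (u : Filter α), ℓ x (r x) ≤ ℓ x ρ₀ - d + η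

/-- A convergent bound for the criterion suffices. -/
theorem separates_bound {α : Type*} {u : Filter α} {a b e d : α → ℝ} {d₀ : ℝ}
    (he : Tendsto e u (𝓝 0)) (hd : Tendsto d u (𝓝 d₀))
    (h : ∀ᶠ x in u, a x ≤ b x + e x - d x) :
    ∀ η > 0, ∀ᶠ x in u, a x ≤ b x - d₀ + η := by
  intro η hη
  have h1 : Tendsto (fun x => e x - d x) u (𝓝 (0 - d₀)) := he.sub hd
  filter_upwards [h, h1.eventually (gt_mem_nhds (show 0 - d₀ < -d₀ + η by linarith))] with x hx hx'
  linarith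

theorem det_corr₂ (ρ : ℝ) : (corr₂ ρ).det = (1 + ρ) * (1 - ρ) := by
  rw [corr₂, det_fin_two_of]
  ring

/-- The matrices `corr₂` have the common eigenvectors `(1, ±1)` with eigenvalues `1 ± ρ`, so the
trace and the determinant split into two scalar terms. -/
theorem logLikCC_eq {N : ℕ} (u v : Fin N → ℝ) {ρ : ℝ} (hρ : |ρ| < 1) :
    logLikCC u v ρ = -((1 / 2) * ((1 + empCorr u v) / (1 + ρ) + (1 - empCorr u v) / (1 - ρ) +
      (Real.log (1 + ρ) + Real.log (1 - ρ)))) := by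
  obtain ⟨h1, h2⟩ := abs_lt.1 hρ
  have hp : 1 + ρ ≠ 0 := by linarith
  have hm : 1 - ρ ≠ 0 := by linarith
  rw [logLikCC, det_corr₂, Real.log_mul hp hm]
  congr 3
  rw [Matrix.inv_def, det_corr₂, corr₂, corr₂, adjugate_fin_two_of, Ring.inverse_eq_inv']
  simp [Matrix.trace_fin_two]
  field_simp
  ring

theorem continuousOn_logLikCC {N : ℕ} (u v : Fin N → ℝ) :
    ContinuousOn (logLikCC u v) (Set.Ioo (-1) 1) := by
  have h : Set.EqOn (logLikCC u v) (fun ρ => -((1 / 2) * ((1 + empCorr u v) / (1 + ρ) +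
      (1 - empCorr u v) / (1 - ρ) + (Real.log (1 + ρ) + Real.log (1 - ρ))))) (Set.Ioo (-1) 1) :=
    fun ρ hρ => logLikCC_eq u v (abs_lt.2 hρ)
  refine ContinuousOn.congr ?_ h
  have hp : ∀ ρ ∈ Set.Ioo (-1 : ℝ) 1, 1 + ρ ≠ 0 := fun ρ hρ => by linarith [hρ.1]
  have hm : ∀ ρ ∈ Set.Ioo (-1 : ℝ) 1, 1 - ρ ≠ 0 := fun ρ hρ => by linarith [hρ.2]
  fun_prop (disch := assumption)

theorem integral_mul_bivariateGaussian (ρ : ℝ) : ∫ z, z.1 * z.2 ∂bivariateGaussian ρ = ρ := by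
  have hL : MemLp (fun x : ℝ => x) 2 (gaussianReal 0 1) := memLp_id_gaussianReal' 2 (by simp)
  have h2 : ∫ x, x ^ 2 ∂gaussianReal 0 1 = 1 := by
    have := variance_fun_id_gaussianReal (μ := 0) (v := 1)
    rw [variance_eq_sub hL] at this
    simpa using this
  have hL1 : Integrable (fun x : ℝ => x) (gaussianReal 0 1) := hL.integrable one_le_two
  rw [integral_bivariateGaussian ρ (by fun_prop)]
  have e : ∀ z : ℝ × ℝ, z.1 * (ρ * z.1 + √(1 - ρ ^ 2) * z.2) =
      ρ * z.1 ^ 2 + √(1 - ρ ^ 2) * (z.1 * z.2) := fun z => by ring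
  have hi1 : Integrable (fun z : ℝ × ℝ => z.1 ^ 2) ((gaussianReal 0 1).prod (gaussianReal 0 1)) :=
    hL.integrable_sq.comp_fst _
  have hi2 : Integrable (fun z : ℝ × ℝ => z.1 * z.2)
      ((gaussianReal 0 1).prod (gaussianReal 0 1)) := hL1.mul_prod hL1
  simp_rw [e]
  rw [integral_add (hi1.const_mul _) (hi2.const_mul _), integral_const_mul, integral_const_mul,
    integral_prod_mul (fun x : ℝ => x) (fun x : ℝ => x), integral_fun_fst (fun x : ℝ => x ^ 2), h2]
  simp

theorem integral_fst_sq_bivariateGaussian (ρ : ℝ) : ∫ z, z.1 ^ 2 ∂bivariateGaussian ρ = 1 := by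
  have hL : MemLp (fun x : ℝ => x) 2 (gaussianReal 0 1) := memLp_id_gaussianReal' 2 (by simp)
  have h2 : ∫ x, x ^ 2 ∂gaussianReal 0 1 = 1 := by
    have := variance_fun_id_gaussianReal (μ := 0) (v := 1)
    rw [variance_eq_sub hL] at this
    simpa using this
  have h3 := integral_map (μ := bivariateGaussian ρ) measurable_fst.aemeasurable
    (f := fun x : ℝ => x ^ 2) (by fun_prop)
  rw [map_fst_bivariateGaussian, h2] at h3
  exact h3.symm

theorem integral_snd_sq_bivariateGaussian {ρ : ℝ} (hρ : |ρ| < 1) :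
    ∫ z, z.2 ^ 2 ∂bivariateGaussian ρ = 1 := by
  have h2 := integral_fst_sq_bivariateGaussian 0
  have h3 := integral_map (μ := bivariateGaussian ρ) measurable_snd.aemeasurable
    (f := fun x : ℝ => x ^ 2) (by fun_prop)
  have h4 := integral_map (μ := bivariateGaussian 0) measurable_fst.aemeasurable
    (f := fun x : ℝ => x ^ 2) (by fun_prop)
  rw [map_snd_bivariateGaussian hρ] at h3
  rw [map_fst_bivariateGaussian] at h4
  exact h3.symm.trans (h4.trans h2)

variable {Ω : Type*} {l : Filter (ℕ × Ω)} {U V : (N : ℕ) → Ω → Fin N → ℝ} {ρ₀ : ℝ}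

/-- The law of large numbers is applied to `u * v`, `u ^ 2` and `v ^ 2`; the factors `1 / N` cancel
in the quotient as soon as `N ≥ 1`. -/
theorem PairLLN.tendsto_empCorr (hl : ∀ᶠ x in l, 1 ≤ x.1) (hρ : |ρ₀| < 1)
    (h : PairLLN l U V ρ₀) :
    Tendsto (fun x : ℕ × Ω => empCorr (U x.1 x.2) (V x.1 x.2)) l (𝓝 ρ₀) := by
  have huv := h (fun z => z.1 * z.2) (by fun_prop) ⟨1, fun z => by
    rw [abs_mul]
    nlinarith [sq_nonneg (|z.1| - |z.2|), sq_abs z.1, sq_abs z.2]⟩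
  have huu := h (fun z => z.1 ^ 2) (by fun_prop) ⟨1, fun z => by
    rw [abs_of_nonneg (sq_nonneg _)]
    nlinarith [sq_nonneg z.2]⟩
  have hvv := h (fun z => z.2 ^ 2) (by fun_prop) ⟨1, fun z => by
    rw [abs_of_nonneg (sq_nonneg _)]
    nlinarith [sq_nonneg z.1]⟩
  rw [integral_mul_bivariateGaussian] at huv
  rw [integral_fst_sq_bivariateGaussian] at huu
  rw [integral_snd_sq_bivariateGaussian hρ] at hvv
  have hlim := huv.div (huu.mul hvv).sqrt (by simp)
  rw [mul_one, Real.sqrt_one, div_one] at hlim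
  refine hlim.congr' ?_
  filter_upwards [hl] with x hx
  have hN : (0 : ℝ) < x.1 := by exact_mod_cast hx
  rw [empCorr]
  have e : (1 / (x.1 : ℝ) * ∑ n, U x.1 x.2 n ^ 2) * (1 / (x.1 : ℝ) * ∑ n, V x.1 x.2 n ^ 2) =
      (1 / (x.1 : ℝ)) ^ 2 * ((U x.1 x.2 ⬝ᵥ U x.1 x.2) * (V x.1 x.2 ⬝ᵥ V x.1 x.2)) := by
    simp only [dotProduct, ← sq]
    ring
  simp only [Pi.div_apply]
  rw [e, Real.sqrt_mul (by positivity), Real.sqrt_sq (by positivity),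
    mul_div_mul_left _ _ (by positivity)]
  rfl

theorem sub_one_sub_log_nonneg {x : ℝ} (hx : 0 < x) : 0 ≤ x - 1 - Real.log x := by
  linarith [Real.log_le_sub_one_of_pos hx]

/-- The Gaussian log-likelihood identifies the correlation. -/
theorem PairLLN.separates_logLikCC (hl : ∀ᶠ x in l, 1 ≤ x.1) (hρ : |ρ₀| < 1)
    (h : PairLLN l U V ρ₀) :
    Separates l (fun x => logLikCC (U x.1 x.2) (V x.1 x.2)) ρ₀ := by
  intro u hu r ρ hr hrρ
  obtain ⟨h01, h02⟩ := abs_lt.1 hρ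
  set c : ℕ × Ω → ℝ := fun x => empCorr (U x.1 x.2) (V x.1 x.2) with hc_def
  have hc : Tendsto c u (𝓝 ρ₀) := (h.tendsto_empCorr hl hρ).mono_left hu
  have hρabs : |ρ| ≤ 1 := le_of_tendsto hrρ.abs (hr.mono fun x hx => hx.le)
  obtain ⟨hρ1, hρ2⟩ := abs_le.1 hρabs
  have hc1 : ∀ᶠ x in (u : Filter (ℕ × Ω)), -1 < c x := hc.eventually (lt_mem_nhds h01)
  have hc2 : ∀ᶠ x in (u : Filter (ℕ × Ω)), c x < 1 := hc.eventually (gt_mem_nhds h02)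
  -- The shortfall of `ρ₀` against the unconstrained maximizer `c x`. It vanishes in the limit since
  -- `c` tends to `ρ₀`.
  set e : ℕ × Ω → ℝ := fun x => (1 / 2) * (((1 + c x) / (1 + ρ₀) + (1 - c x) / (1 - ρ₀) +
      (Real.log (1 + ρ₀) + Real.log (1 - ρ₀))) -
      (2 + (Real.log (1 + c x) + Real.log (1 - c x)))) with he_def
  have he : Tendsto e u (𝓝 0) := by
    have h1 : Tendsto (fun x => 1 + c x) u (𝓝 (1 + ρ₀)) := hc.const_add 1
    have h2 : Tendsto (fun x => 1 - c x) u (𝓝 (1 - ρ₀)) := hc.const_sub 1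
    have h3 := (((h1.div_const (1 + ρ₀)).add (h2.div_const (1 - ρ₀))).add_const
      (Real.log (1 + ρ₀) + Real.log (1 - ρ₀))).sub
      (((h1.log (by linarith)).add (h2.log (by linarith))).const_add 2)
    have h4 := h3.const_mul (1 / 2)
    rw [div_self (by linarith), div_self (by linarith)] at h4
    convert h4 using 2
    ring
  have key : ∀ᶠ x in (u : Filter (ℕ × Ω)), logLikCC (U x.1 x.2) (V x.1 x.2) (r x) =
      logLikCC (U x.1 x.2) (V x.1 x.2) ρ₀ + e x -
        ((1 / 2) * ((1 + c x) / (1 + r x) - 1 - Real.log ((1 + c x) / (1 + r x))) +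
          (1 / 2) * ((1 - c x) / (1 - r x) - 1 - Real.log ((1 - c x) / (1 - r x)))) := by
    filter_upwards [hr, hc1, hc2] with x hx hx1 hx2
    obtain ⟨hr1, hr2⟩ := abs_lt.1 hx
    rw [logLikCC_eq _ _ hx, logLikCC_eq _ _ hρ, Real.log_div (by linarith) (by linarith),
      Real.log_div (by linarith) (by linarith), he_def]
    ring
  have hpos1 : ∀ᶠ x in (u : Filter (ℕ × Ω)), 0 < (1 + c x) / (1 + r x) := by
    filter_upwards [hr, hc1] with x hx hx1
    exact div_pos (by linarith) (by linarith [(abs_lt.1 hx).1])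
  have hpos2 : ∀ᶠ x in (u : Filter (ℕ × Ω)), 0 < (1 - c x) / (1 - r x) := by
    filter_upwards [hr, hc2] with x hx hx1
    exact div_pos (by linarith) (by linarith [(abs_lt.1 hx).2])
  have hψ : ∀ y : ℝ, 0 < y → y ≠ 1 → 0 < y - 1 - Real.log y := fun y hy hy1 => by
    linarith [Real.log_lt_sub_one_of_pos hy hy1]
  -- For `ρ < ρ₀` the denominator `1 - r x` stays away from zero even if `ρ = -1`. The term with `1
  -- - r x` then has a positive limit, which serves as the gap, and the other nonnegative term is
  -- dropped. The case `ρ > ρ₀` is symmetric.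
  rcases lt_trichotomy ρ ρ₀ with hlt | heq | hgt
  · have hlim : Tendsto (fun x => (1 - c x) / (1 - r x)) u (𝓝 ((1 - ρ₀) / (1 - ρ))) :=
      (hc.const_sub 1).div (hrρ.const_sub 1) (by linarith)
    have hy : 0 < (1 - ρ₀) / (1 - ρ) := div_pos (by linarith) (by linarith)
    have hy1 : (1 - ρ₀) / (1 - ρ) ≠ 1 := by
      rw [Ne, div_eq_one_iff_eq (by linarith)]
      linarith
    refine ⟨1 / 2 * ((1 - ρ₀) / (1 - ρ) - 1 - Real.log ((1 - ρ₀) / (1 - ρ))), ?_, fun _ => ?_,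
      separates_bound he (((hlim.sub_const 1).sub (hlim.log hy.ne')).const_mul (1 / 2)) ?_⟩
    · exact mul_nonneg (by norm_num) (hψ _ hy hy1).le
    · exact mul_pos (by norm_num) (hψ _ hy hy1)
    · filter_upwards [key, hpos1] with x hx hx1
      rw [hx]
      linarith [sub_one_sub_log_nonneg hx1]
  · refine ⟨0, le_rfl, fun hne => absurd heq hne,
      separates_bound he tendsto_const_nhds (d := fun _ => 0) ?_⟩
    filter_upwards [key, hpos1, hpos2] with x hx hx1 hx2
    rw [hx]
    linarith [sub_one_sub_log_nonneg hx1, sub_one_sub_log_nonneg hx2]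
  · have hlim : Tendsto (fun x => (1 + c x) / (1 + r x)) u (𝓝 ((1 + ρ₀) / (1 + ρ))) :=
      (hc.const_add 1).div (hrρ.const_add 1) (by linarith)
    have hy : 0 < (1 + ρ₀) / (1 + ρ) := div_pos (by linarith) (by linarith)
    have hy1 : (1 + ρ₀) / (1 + ρ) ≠ 1 := by
      rw [Ne, div_eq_one_iff_eq (by linarith)]
      linarith
    refine ⟨1 / 2 * ((1 + ρ₀) / (1 + ρ) - 1 - Real.log ((1 + ρ₀) / (1 + ρ))), ?_, fun _ => ?_,
      separates_bound he (((hlim.sub_const 1).sub (hlim.log hy.ne')).const_mul (1 / 2)) ?_⟩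
    · exact mul_nonneg (by norm_num) (hψ _ hy hy1).le
    · exact mul_pos (by norm_num) (hψ _ hy hy1)
    · filter_upwards [key, hpos2] with x hx hx1
      rw [hx]
      linarith [sub_one_sub_log_nonneg hx1]

end Likelihood

/-! ### The polychoric likelihood -/

section Polychoric

theorem tendsto_stdCdf₂ {α : Type*} {l : Filter α} {f g : α → EReal} {a b : EReal} {ρ : ℝ}
    (hρ : |ρ| < 1) (hf : Tendsto f l (𝓝 a)) (hg : Tendsto g l (𝓝 b)) :
    Tendsto (fun x => stdCdf₂ (f x) (g x) ρ) l (𝓝 (stdCdf₂ a b ρ)) :=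
  Tendsto.comp (g := fun p : EReal × EReal × ℝ => stdCdf₂ p.1 p.2.1 p.2.2)
    (f := fun x => (f x, g x, ρ)) (y := 𝓝 (a, b, ρ)) (continuousAt_stdCdf₂ a b hρ)
    (hf.prodMk_nhds (hg.prodMk_nhds tendsto_const_nhds))

theorem tendsto_cellProb {α : Type*} {l : Filter α} {f f' g g' : α → EReal} {a a' b b' : EReal}
    {ρ : ℝ} (hρ : |ρ| < 1) (hf : Tendsto f l (𝓝 a)) (hf' : Tendsto f' l (𝓝 a'))
    (hg : Tendsto g l (𝓝 b)) (hg' : Tendsto g' l (𝓝 b')) :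
    Tendsto (fun x => cellProb (f x) (f' x) (g x) (g' x) ρ) l (𝓝 (cellProb a a' b b' ρ)) :=
  (((tendsto_stdCdf₂ hρ hf' hg').add (tendsto_stdCdf₂ hρ hf hg)).sub
    (tendsto_stdCdf₂ hρ hf' hg)).sub (tendsto_stdCdf₂ hρ hf hg')

/-- The cell `(Tu s, Tu (s + 1)] × (Tv t, Tv (t + 1)]`. -/
def gridCell (Tu Tv : ℕ → EReal) (p : ℕ × ℕ) : Set (ℝ × ℝ) :=
  {z | (Tu p.1 < z.1 ∧ (z.1 : EReal) ≤ Tu (p.1 + 1)) ∧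
    (Tv p.2 < z.2 ∧ (z.2 : EReal) ≤ Tv (p.2 + 1))}

theorem measurableSet_gridCell (Tu Tv : ℕ → EReal) (p : ℕ × ℕ) :
    MeasurableSet (gridCell Tu Tv p) :=
  ((measurableSet_lt measurable_const (measurable_coe_real_ereal.comp measurable_fst)).inter
    (measurableSet_le (measurable_coe_real_ereal.comp measurable_fst) measurable_const)).inter
    ((measurableSet_lt measurable_const (measurable_coe_real_ereal.comp measurable_snd)).inter
    (measurableSet_le (measurable_coe_real_ereal.comp measurable_snd) measurable_const))

/-- The cell probabilities at the estimated thresholds. -/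
def empCellProb {N : ℕ} (Tu Tv : ℕ → EReal) (U V : Fin N → ℝ) (p : ℕ × ℕ) (ρ : ℝ) : ℝ :=
  cellProb (empThreshold U (Tu p.1)) (empThreshold U (Tu (p.1 + 1))) (empThreshold V (Tv p.2))
    (empThreshold V (Tv (p.2 + 1))) ρ

/-- The frequency of a cell. -/
def cellFreq {N : ℕ} (Tu Tv : ℕ → EReal) (U V : Fin N → ℝ) (p : ℕ × ℕ) : ℝ :=
  (1 / (N : ℝ)) * ∑ n, (gridCell Tu Tv p).indicator 1 (U n, V n)

variable {Cu Cv : ℕ} {Tu Tv : ℕ → EReal}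

theorem level_mem_gridCell (hu : IsThresholds Cu Tu) (hv : IsThresholds Cv Tv) (hCu : 1 ≤ Cu)
    (hCv : 1 ≤ Cv) (z : ℝ × ℝ) : z ∈ gridCell Tu Tv (level Cu Tu z.1, level Cv Tv z.2) :=
  ⟨(hu.level_spec hCu z.1).2, (hv.level_spec hCv z.2).2⟩

theorem sum_grid (hu : IsThresholds Cu Tu) (hv : IsThresholds Cv Tv) (hCu : 1 ≤ Cu)
    (hCv : 1 ≤ Cv) (F : ℕ × ℕ → ℝ) (z : ℝ × ℝ) :
    ∑ p ∈ Finset.Icc 1 Cu ×ˢ Finset.Icc 1 Cv, (gridCell Tu Tv p).indicator 1 z * F p =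
      F (level Cu Tu z.1, level Cv Tv z.2) := by
  rw [Finset.sum_eq_single (level Cu Tu z.1, level Cv Tv z.2)]
  · rw [Set.indicator_of_mem (level_mem_gridCell hu hv hCu hCv z), Pi.one_apply, one_mul]
  · rintro ⟨s, t⟩ hp hne
    rw [Finset.mem_product] at hp
    rw [Set.indicator_of_notMem, zero_mul]
    rintro ⟨h1, h2⟩
    exact hne (Prod.ext ((hu.level_eq_iff hCu hp.1).2 h1).symm
      ((hv.level_eq_iff hCv hp.2).2 h2).symm)
  · exact fun hn => absurd (Finset.mem_product.2
      ⟨(hu.level_spec hCu z.1).1, (hv.level_spec hCv z.2).1⟩) hn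

theorem empCellProb_level_pos (hu : IsThresholds Cu Tu) (hv : IsThresholds Cv Tv) (hCu : 1 ≤ Cu)
    (hCv : 1 ≤ Cv) {N : ℕ} (U V : Fin N → ℝ) (n : Fin N) {ρ : ℝ} (hρ : |ρ| < 1) :
    0 < empCellProb Tu Tv U V (level Cu Tu (U n), level Cv Tv (V n)) ρ :=
  have h1 := (hu.level_spec hCu (U n)).2
  have h2 := (hv.level_spec hCv (V n)).2
  cellProb_pos (empThreshold_lt U h1.1 h1.2) (empThreshold_lt V h2.1 h2.2) hρ

theorem logLikDD_eq (hu : IsThresholds Cu Tu) (hv : IsThresholds Cv Tv) (hCu : 1 ≤ Cu)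
    (hCv : 1 ≤ Cv) {N : ℕ} (U V : Fin N → ℝ) (ρ : ℝ) :
    logLikDD (fun n => discretize Cu Tu (U n)) (fun n => discretize Cv Tv (V n)) ρ =
      (1 / (N : ℝ)) * ∑ n, Real.log
        (empCellProb Tu Tv U V (level Cu Tu (U n), level Cv Tv (V n)) ρ) := by
  rw [logLikDD]
  congr 2
  ext n
  have h1 := Finset.mem_Icc.1 (hu.level_spec hCu (U n)).1
  have h2 := Finset.mem_Icc.1 (hv.level_spec hCv (V n)).1
  have e1 := estThreshold_discretize hu hCu U h1.1 (h1.2.trans (Nat.le_succ _))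
  have e1' := estThreshold_discretize hu hCu U (Nat.le_add_left 1 (level Cu Tu (U n)))
    (Nat.succ_le_succ h1.2)
  have e2 := estThreshold_discretize hv hCv V h2.1 (h2.2.trans (Nat.le_succ _))
  have e2' := estThreshold_discretize hv hCv V (Nat.le_add_left 1 (level Cv Tv (V n)))
    (Nat.succ_le_succ h2.2)
  push_cast at e1' e2'
  rw [discretize_eq_level Cu Tu (U n), discretize_eq_level Cv Tv (V n), e1, e1', e2, e2']
  rfl

/-- Grouping the rows by cells gives a multinomial log-likelihood, to which Gibbs' inequality
applies. -/
theorem logLikDD_eq_sum_grid (hu : IsThresholds Cu Tu) (hv : IsThresholds Cv Tv) (hCu : 1 ≤ Cu)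
    (hCv : 1 ≤ Cv) {N : ℕ} (U V : Fin N → ℝ) (ρ : ℝ) :
    logLikDD (fun n => discretize Cu Tu (U n)) (fun n => discretize Cv Tv (V n)) ρ =
      ∑ p ∈ Finset.Icc 1 Cu ×ˢ Finset.Icc 1 Cv,
        cellFreq Tu Tv U V p * Real.log (empCellProb Tu Tv U V p ρ) := by
  rw [logLikDD_eq hu hv hCu hCv]
  simp_rw [cellFreq, mul_assoc, Finset.sum_mul]
  rw [← Finset.mul_sum, Finset.sum_comm]
  congr 2
  ext n
  exact (sum_grid hu hv hCu hCv (fun p => Real.log (empCellProb Tu Tv U V p ρ)) (U n, V n)).symm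

theorem continuousOn_logLikDD (hu : IsThresholds Cu Tu) (hv : IsThresholds Cv Tv) (hCu : 1 ≤ Cu)
    (hCv : 1 ≤ Cv) {N : ℕ} (U V : Fin N → ℝ) :
    ContinuousOn (logLikDD (fun n => discretize Cu Tu (U n)) (fun n => discretize Cv Tv (V n)))
      (Set.Ioo (-1) 1) := by
  rw [funext (logLikDD_eq hu hv hCu hCv U V)]
  intro ρ hρ
  have hρ' : |ρ| < 1 := abs_lt.2 hρ
  refine ContinuousAt.continuousWithinAt (continuousAt_const.mul ?_)
  refine tendsto_finsetSum _ fun n _ => ?_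
  refine ContinuousAt.log ?_ (empCellProb_level_pos hu hv hCu hCv U V n hρ').ne'
  exact ContinuousAt.comp (f := fun ρ : ℝ => ((_, _, _, _, ρ) :
    EReal × EReal × EReal × EReal × ℝ)) (continuousAt_cellProb _ _ _ _ hρ') (by fun_prop)

theorem cellFreq_nonneg {N : ℕ} (U V : Fin N → ℝ) (p : ℕ × ℕ) : 0 ≤ cellFreq Tu Tv U V p :=
  mul_nonneg (by positivity) (Finset.sum_nonneg fun n _ =>
    Set.indicator_nonneg (fun _ _ => zero_le_one) _)

theorem sum_cellFreq (hu : IsThresholds Cu Tu) (hv : IsThresholds Cv Tv) (hCu : 1 ≤ Cu)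
    (hCv : 1 ≤ Cv) {N : ℕ} (hN : 1 ≤ N) (U V : Fin N → ℝ) :
    ∑ p ∈ Finset.Icc 1 Cu ×ˢ Finset.Icc 1 Cv, cellFreq Tu Tv U V p = 1 := by
  have hN' : (N : ℝ) ≠ 0 := by positivity
  simp_rw [cellFreq]
  rw [← Finset.mul_sum, Finset.sum_comm]
  have : ∀ n, ∑ p ∈ Finset.Icc 1 Cu ×ˢ Finset.Icc 1 Cv,
      (gridCell Tu Tv p).indicator (1 : ℝ × ℝ → ℝ) (U n, V n) = 1 := by
    intro n
    have := sum_grid hu hv hCu hCv (fun _ => 1) (U n, V n)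
    simpa using this
  simp [this, hN']

theorem sum_Icc_one_sub (g : ℕ → ℝ) (C : ℕ) :
    ∑ t ∈ Finset.Icc 1 C, (g (t + 1) - g t) = g (C + 1) - g 1 := by
  induction C with
  | zero => simp
  | succ C ih => rw [Finset.sum_Icc_succ_top (by omega), ih]; ring

/-- The sum telescopes in both directions, because the outer estimated thresholds are infinite. For
`N = 0` the top one would be `⊥`. -/
theorem sum_empCellProb (hu : IsThresholds Cu Tu) (hv : IsThresholds Cv Tv)
    {N : ℕ} (hN : 1 ≤ N) (U V : Fin N → ℝ) {ρ : ℝ} (hρ : |ρ| < 1) :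
    ∑ p ∈ Finset.Icc 1 Cu ×ˢ Finset.Icc 1 Cv, empCellProb Tu Tv U V p ρ = 1 := by
  set Φ : ℕ → ℕ → ℝ := fun s t => stdCdf₂ (empThreshold U (Tu s)) (empThreshold V (Tv t)) ρ with hΦ
  have e : ∀ p : ℕ × ℕ, empCellProb Tu Tv U V p ρ =
      (Φ (p.1 + 1) (p.2 + 1) - Φ p.1 (p.2 + 1)) - (Φ (p.1 + 1) p.2 - Φ p.1 p.2) := by
    intro p
    simp only [empCellProb, cellProb, hΦ]
    ring
  rw [Finset.sum_product]
  simp_rw [e]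
  have h1 : ∀ s, ∑ t ∈ Finset.Icc 1 Cv, ((Φ (s + 1) (t + 1) - Φ s (t + 1)) -
      (Φ (s + 1) t - Φ s t)) = (Φ (s + 1) (Cv + 1) - Φ (s + 1) 1) - (Φ s (Cv + 1) - Φ s 1) := by
    intro s
    rw [sum_Icc_one_sub (fun t => Φ (s + 1) t - Φ s t) Cv]
    ring
  simp_rw [h1]
  rw [sum_Icc_one_sub (fun s => Φ s (Cv + 1) - Φ s 1) Cu]
  simp only [hΦ, hu.1, hu.2.1, hv.1, hv.2.1, empThreshold_bot, empThreshold_top hN,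
    stdCdf₂_bot_left, stdCdf₂_bot_right, stdCdf₂_top_left hρ, stdCdf_top, stdCdf_bot]
  norm_num

variable {Ω : Type*} {l : Filter (ℕ × Ω)} {U V : (N : ℕ) → Ω → Fin N → ℝ} {ρ₀ : ℝ}

/-- Gibbs' inequality for the polychoric likelihood: it is at most the saturated likelihood minus a
term that measures the misfit of the first cell. -/
theorem logLikDD_le (hu : IsThresholds Cu Tu) (hv : IsThresholds Cv Tv) (hCu : 1 ≤ Cu)
    (hCv : 1 ≤ Cv) {N : ℕ} (hN : 1 ≤ N) (U V : Fin N → ℝ) {ρ : ℝ} (hρ : |ρ| < 1) :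
    logLikDD (fun n => discretize Cu Tu (U n)) (fun n => discretize Cv Tv (V n)) ρ ≤
      ∑ p ∈ Finset.Icc 1 Cu ×ˢ Finset.Icc 1 Cv,
        cellFreq Tu Tv U V p * Real.log (cellFreq Tu Tv U V p) -
      (cellFreq Tu Tv U V (1, 1) -
        stdCdf₂ (empThreshold U (Tu 2)) (empThreshold V (Tv 2)) ρ) ^ 2 / 4 := by
  rw [logLikDD_eq_sum_grid hu hv hCu hCv]
  have hmono : ∀ {C : ℕ} {T : ℕ → EReal}, IsThresholds C T → ∀ W : Fin N → ℝ, ∀ t ∈ Finset.Icc 1 C,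
      empThreshold W (T t) ≤ empThreshold W (T (t + 1)) := by
    intro C T h W t ht
    rw [Finset.mem_Icc] at ht
    exact empThreshold_mono W (h.monotoneOn ht.1 (by omega) (by omega))
  -- The positivity required by Gibbs' inequality: a cell of positive frequency contains an
  -- observation, which keeps its estimated thresholds apart.
  have hpos : ∀ p ∈ Finset.Icc 1 Cu ×ˢ Finset.Icc 1 Cv, 0 < cellFreq Tu Tv U V p →
      0 < empCellProb Tu Tv U V p ρ := by
    intro p hp hfreq
    rw [Finset.mem_product] at hp
    have hex : ∃ n, (U n, V n) ∈ gridCell Tu Tv p := by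
      by_contra hno
      push Not at hno
      rw [cellFreq, Finset.sum_eq_zero fun n _ => Set.indicator_of_notMem (hno n) _] at hfreq
      simp at hfreq
    obtain ⟨n, h1, h2⟩ := hex
    exact cellProb_pos (empThreshold_lt U h1.1 h1.2) (empThreshold_lt V h2.1 h2.2) hρ
  have h := sum_mul_log_sub_le (Finset.Icc 1 Cu ×ˢ Finset.Icc 1 Cv) (i₀ := (1, 1))
    (fun p _ => cellFreq_nonneg (Tu := Tu) (Tv := Tv) U V p)
    (fun p hp => cellProb_nonneg (hmono hu U _ (Finset.mem_product.1 hp).1)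
      (hmono hv V _ (Finset.mem_product.1 hp).2) ρ) hpos (sum_cellFreq hu hv hCu hCv hN U V)
    (sum_empCellProb hu hv hN U V hρ)
    (Finset.mem_product.2 ⟨Finset.mem_Icc.2 ⟨le_rfl, hCu⟩, Finset.mem_Icc.2 ⟨le_rfl, hCv⟩⟩)
  -- The first cell is unbounded below in both directions, so its probability is a value of the
  -- joint distribution function, which is monotone in the correlation.
  have e : empCellProb Tu Tv U V (1, 1) ρ =
      stdCdf₂ (empThreshold U (Tu 2)) (empThreshold V (Tv 2)) ρ := by
    simp [empCellProb, cellProb, hu.1, hv.1, empThreshold_bot, stdCdf₂_bot_left, stdCdf₂_bot_right]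
  have e1 : cellProb (empThreshold U (Tu (1, 1).1)) (empThreshold U (Tu ((1, 1).1 + 1)))
      (empThreshold V (Tv (1, 1).2)) (empThreshold V (Tv ((1, 1).2 + 1))) ρ =
      stdCdf₂ (empThreshold U (Tu 2)) (empThreshold V (Tv 2)) ρ := e
  rw [e1] at h
  simp only [mul_sub, Finset.sum_sub_distrib] at h
  have h' : ∑ p ∈ Finset.Icc 1 Cu ×ˢ Finset.Icc 1 Cv, cellFreq Tu Tv U V p *
      Real.log (empCellProb Tu Tv U V p ρ) - ∑ p ∈ Finset.Icc 1 Cu ×ˢ Finset.Icc 1 Cv,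
      cellFreq Tu Tv U V p * Real.log (cellFreq Tu Tv U V p) ≤ _ := h
  linarith

/-- The polychoric log-likelihood identifies the correlation. -/
theorem PairLLN.separates_logLikDD (hl : ∀ᶠ x in l, 1 ≤ x.1) (hρ : |ρ₀| < 1)
    (h : PairLLN l U V ρ₀) (hu : IsThresholds Cu Tu) (hv : IsThresholds Cv Tv) (hCu : 2 ≤ Cu)
    (hCv : 2 ≤ Cv) :
    Separates l (fun x => logLikDD (fun n => discretize Cu Tu (U x.1 x.2 n))
      (fun n => discretize Cv Tv (V x.1 x.2 n))) ρ₀ := by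
  intro w hw r ρ hr hrρ
  have hCu1 : 1 ≤ Cu := by omega
  have hCv1 : 1 ≤ Cv := by omega
  -- With at least two levels the threshold `T 2` is neither the lowest nor the highest, hence
  -- finite. Only then is the first cell informative about the correlation.
  have hreal : ∀ {C : ℕ} {T : ℕ → EReal}, IsThresholds C T → 2 ≤ C → ∃ t : ℝ, T 2 = t := by
    intro C T hT hC
    have h1 : T 2 ≠ ⊥ := by
      rw [← hT.1]
      exact (hT.lt le_rfl (by omega) (by omega)).ne'
    have h2 : T 2 ≠ ⊤ := by
      rw [← hT.2.1]
      exact (hT.lt (by omega) (by omega) le_rfl).ne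
    exact ⟨(T 2).toReal, (EReal.coe_toReal h2 h1).symm⟩
  obtain ⟨a, ha⟩ := hreal hu hCu
  obtain ⟨b, hb⟩ := hreal hv hCv
  set G := Finset.Icc 1 Cu ×ˢ Finset.Icc 1 Cv with hG
  have hTu := fun t => (h.tendsto_empThreshold_fst (Tu t)).mono_left hw
  have hTv := fun t => (h.tendsto_empThreshold_snd hρ (Tv t)).mono_left hw
  have hle : ∀ {C : ℕ} {T : ℕ → EReal}, IsThresholds C T → ∀ t ∈ Finset.Icc 1 C,
      T t < T (t + 1) := by
    intro C T hT t ht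
    rw [Finset.mem_Icc] at ht
    exact hT.lt ht.1 (by omega) (by omega)
  have hfreq : ∀ p ∈ G, Tendsto (fun x : ℕ × Ω => cellFreq Tu Tv (U x.1 x.2) (V x.1 x.2) p) w
      (𝓝 (cellProb (Tu p.1) (Tu (p.1 + 1)) (Tv p.2) (Tv (p.2 + 1)) ρ₀)) := by
    intro p hp
    rw [hG, Finset.mem_product] at hp
    rw [cellProb_eq_bivariateGaussian (hle hu _ hp.1).le (hle hv _ hp.2).le]
    exact (h.tendsto_freq (measurableSet_gridCell Tu Tv p)).mono_left hw
  have hprob : ∀ p, Tendsto (fun x : ℕ × Ω => empCellProb Tu Tv (U x.1 x.2) (V x.1 x.2) p ρ₀) w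
      (𝓝 (cellProb (Tu p.1) (Tu (p.1 + 1)) (Tv p.2) (Tv (p.2 + 1)) ρ₀)) := by
    intro p
    exact tendsto_cellProb hρ (hTu _) (hTu _) (hTv _) (hTv _)
  have hpos : ∀ p ∈ G, cellProb (Tu p.1) (Tu (p.1 + 1)) (Tv p.2) (Tv (p.2 + 1)) ρ₀ ≠ 0 := by
    intro p hp
    rw [hG, Finset.mem_product] at hp
    exact (cellProb_pos (hle hu _ hp.1) (hle hv _ hp.2) hρ).ne'
  -- The shortfall of `ρ₀` against the saturated likelihood. It tends to zero because the
  -- frequencies and the fitted probabilities at `ρ₀` have the same positive limits.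
  set e : ℕ × Ω → ℝ := fun x =>
    ∑ p ∈ G, cellFreq Tu Tv (U x.1 x.2) (V x.1 x.2) p *
      Real.log (cellFreq Tu Tv (U x.1 x.2) (V x.1 x.2) p) -
    logLikDD (fun n => discretize Cu Tu (U x.1 x.2 n))
      (fun n => discretize Cv Tv (V x.1 x.2 n)) ρ₀ with he_def
  have he : Tendsto e w (𝓝 0) := by
    set c : ℕ × ℕ → ℝ := fun p => cellProb (Tu p.1) (Tu (p.1 + 1)) (Tv p.2) (Tv (p.2 + 1)) ρ₀
    have h1 : Tendsto (fun x : ℕ × Ω => ∑ p ∈ G, cellFreq Tu Tv (U x.1 x.2) (V x.1 x.2) p *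
        Real.log (cellFreq Tu Tv (U x.1 x.2) (V x.1 x.2) p)) w
        (𝓝 (∑ p ∈ G, c p * Real.log (c p))) :=
      tendsto_finsetSum G fun p hp => (hfreq p hp).mul ((hfreq p hp).log (hpos p hp))
    have h2 : Tendsto (fun x : ℕ × Ω => ∑ p ∈ G, cellFreq Tu Tv (U x.1 x.2) (V x.1 x.2) p *
        Real.log (empCellProb Tu Tv (U x.1 x.2) (V x.1 x.2) p ρ₀)) w
        (𝓝 (∑ p ∈ G, c p * Real.log (c p))) :=
      tendsto_finsetSum G fun p hp => (hfreq p hp).mul ((hprob p).log (hpos p hp))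
    have h3 := h1.sub h2
    rw [sub_self] at h3
    refine h3.congr fun x => ?_
    simp only [he_def, logLikDD_eq_sum_grid hu hv hCu1 hCv1, hG]
  have h11 : (1, 1) ∈ G := Finset.mem_product.2
    ⟨Finset.mem_Icc.2 ⟨le_rfl, hCu1⟩, Finset.mem_Icc.2 ⟨le_rfl, hCv1⟩⟩
  have hfreq11 := hfreq _ h11
  have e11 : cellProb (Tu (1, 1).1) (Tu ((1, 1).1 + 1)) (Tv (1, 1).2) (Tv ((1, 1).2 + 1)) ρ₀ =
      stdCdf₂ a b ρ₀ := by
    simp [cellProb, hu.1, hv.1, stdCdf₂_bot_left, stdCdf₂_bot_right, ha, hb]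
  rw [e11] at hfreq11
  have hΦ : ∀ ρ₁ : ℝ, |ρ₁| < 1 → Tendsto (fun x : ℕ × Ω => stdCdf₂
      (empThreshold (U x.1 x.2) (Tu 2)) (empThreshold (V x.1 x.2) (Tv 2)) ρ₁) w
      (𝓝 (stdCdf₂ a b ρ₁)) := by
    intro ρ₁ h₁
    rw [← ha, ← hb]
    exact tendsto_stdCdf₂ h₁ (hTu 2) (hTv 2)
  have hmain : ∀ᶠ x in (w : Filter (ℕ × Ω)), logLikDD (fun n => discretize Cu Tu (U x.1 x.2 n))
      (fun n => discretize Cv Tv (V x.1 x.2 n)) (r x) ≤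
      logLikDD (fun n => discretize Cu Tu (U x.1 x.2 n))
      (fun n => discretize Cv Tv (V x.1 x.2 n)) ρ₀ + e x -
      (cellFreq Tu Tv (U x.1 x.2) (V x.1 x.2) (1, 1) - stdCdf₂ (empThreshold (U x.1 x.2) (Tu 2))
        (empThreshold (V x.1 x.2) (Tv 2)) (r x)) ^ 2 / 4 := by
    filter_upwards [hr, hl.filter_mono hw] with x hx hN
    have := logLikDD_le hu hv hCu1 hCv1 hN (U x.1 x.2) (V x.1 x.2) hx
    rw [he_def]
    linarith
  have hρabs : |ρ| ≤ 1 := le_of_tendsto hrρ.abs (hr.mono fun x hx => hx.le)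
  obtain ⟨hρ1, hρ2⟩ := abs_le.1 hρabs
  obtain ⟨h01, h02⟩ := abs_lt.1 hρ
  -- The limit `ρ` may be `±1`, where continuity is not available. The midpoint lies strictly
  -- inside, and monotonicity compares `r x` with it.
  have hmid : |(ρ + ρ₀) / 2| < 1 := abs_lt.2 ⟨by linarith, by linarith⟩
  rcases lt_trichotomy ρ ρ₀ with hlt | heq | hgt
  · have hstep := stdCdf₂_lt_stdCdf₂ hmid hρ (show (ρ + ρ₀) / 2 < ρ₀ by linarith) a b
    refine ⟨(stdCdf₂ a b ρ₀ - stdCdf₂ a b ((ρ + ρ₀) / 2)) ^ 2 / 4, by positivity, fun _ => ?_,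
      separates_bound he (((hfreq11.sub (hΦ _ hmid)).pow 2).div_const 4) ?_⟩
    · have := sub_pos.2 hstep
      positivity
    · filter_upwards [hmain, hr, hrρ.eventually (gt_mem_nhds (show ρ < (ρ + ρ₀) / 2 by linarith)),
        (hfreq11.sub (hΦ _ hmid)).eventually (lt_mem_nhds (sub_pos.2 hstep))] with x h1 h2 h3 h4
      have h5 := stdCdf₂_mono h2 hmid h3.le (empThreshold (U x.1 x.2) (Tu 2))
        (empThreshold (V x.1 x.2) (Tv 2))
      refine h1.trans (sub_le_sub_left (div_le_div_of_nonneg_right ?_ (by norm_num)) _)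
      exact pow_le_pow_left₀ h4.le (sub_le_sub_left h5 _) 2
  · refine ⟨0, le_rfl, fun hne => absurd heq hne,
      separates_bound he tendsto_const_nhds (d := fun _ => 0) ?_⟩
    filter_upwards [hmain] with x hx
    refine hx.trans (sub_le_sub_left (by positivity) _)
  · have hstep := stdCdf₂_lt_stdCdf₂ hρ hmid (show ρ₀ < (ρ + ρ₀) / 2 by linarith) a b
    refine ⟨(stdCdf₂ a b ((ρ + ρ₀) / 2) - stdCdf₂ a b ρ₀) ^ 2 / 4, by positivity, fun _ => ?_,
      separates_bound he ((((hΦ _ hmid).sub hfreq11).pow 2).div_const 4) ?_⟩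
    · have := sub_pos.2 hstep
      positivity
    · filter_upwards [hmain, hr, hrρ.eventually (lt_mem_nhds (show (ρ + ρ₀) / 2 < ρ by linarith)),
        ((hΦ _ hmid).sub hfreq11).eventually (lt_mem_nhds (sub_pos.2 hstep))] with x h1 h2 h3 h4
      have h5 := stdCdf₂_mono hmid h2 h3.le (empThreshold (U x.1 x.2) (Tu 2))
        (empThreshold (V x.1 x.2) (Tv 2))
      refine h1.trans (sub_le_sub_left (div_le_div_of_nonneg_right ?_ (by norm_num)) _)
      rw [sub_sq_comm (cellFreq Tu Tv (U x.1 x.2) (V x.1 x.2) (1, 1)) (stdCdf₂ _ _ (r x))]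
      exact pow_le_pow_left₀ h4.le (sub_le_sub_right h5 _) 2

end Polychoric

/-! ### The polyserial likelihood -/

section Polyserial

/-- The conditional probability of `(a, a']` for the second of two standard normal variables with
correlation `ρ`, given that the first is `y`. -/
def condCell (a a' : EReal) (ρ y : ℝ) : ℝ := condCdf a' ρ y - condCdf a ρ y

theorem condCell_nonneg {a a' : EReal} (h : a ≤ a') (ρ y : ℝ) : 0 ≤ condCell a a' ρ y :=
  sub_nonneg.2 (condCdf_mono h ρ y)

theorem condCell_le_one (a a' : EReal) (ρ y : ℝ) : condCell a a' ρ y ≤ 1 := by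
  have h1 := condCdf_le_one a' ρ y
  have h2 := condCdf_nonneg a ρ y
  unfold condCell
  linarith

theorem condCell_pos {a a' : EReal} (h : a < a') {ρ : ℝ} (hρ : |ρ| < 1) (y : ℝ) :
    0 < condCell a a' ρ y :=
  sub_pos.2 (condCdf_strictMono hρ y h)

theorem log_condCell_nonpos {a a' : EReal} (h : a ≤ a') (ρ y : ℝ) :
    Real.log (condCell a a' ρ y) ≤ 0 :=
  Real.log_nonpos (condCell_nonneg h ρ y) (condCell_le_one a a' ρ y)

theorem measurable_condCell (a a' : EReal) (ρ : ℝ) : Measurable (condCell a a' ρ) :=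
  (measurable_condCdf a' ρ).sub (measurable_condCdf a ρ)

theorem continuousAt_condCell {a a' : EReal} {ρ y : ℝ}
    (h : √(1 - ρ ^ 2) ≠ 0 ∨ (((ρ * y : ℝ) : EReal) ≠ a ∧ ((ρ * y : ℝ) : EReal) ≠ a')) :
    ContinuousAt (fun p : (EReal × EReal × ℝ) × ℝ => condCell p.1.1 p.1.2.1 p.1.2.2 p.2)
      ((a, a', ρ), y) := by
  have h1 : ContinuousAt (fun p : EReal × ℝ × ℝ => condCdf p.1 p.2.1 p.2.2) (a, ρ, y) :=
    continuousAt_condCdf (h.imp_right fun h => h.1)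
  have h2 : ContinuousAt (fun p : EReal × ℝ × ℝ => condCdf p.1 p.2.1 p.2.2) (a', ρ, y) :=
    continuousAt_condCdf (h.imp_right fun h => h.2)
  have h1' := ContinuousAt.comp (f := fun p : (EReal × EReal × ℝ) × ℝ => (p.1.1, p.1.2.2, p.2))
    (x := ((a, a', ρ), y)) h1 (Continuous.continuousAt (by fun_prop))
  have h2' := ContinuousAt.comp (f := fun p : (EReal × EReal × ℝ) × ℝ => (p.1.2.1, p.1.2.2, p.2))
    (x := ((a, a', ρ), y)) h2 (Continuous.continuousAt (by fun_prop))
  exact h2'.sub h1'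

theorem condCell_eq_measureReal {a a' : EReal} (h : a ≤ a') (ρ y : ℝ) :
    condCell a a' ρ y = (gaussianReal 0 1).real
      {w : ℝ | a < ((ρ * y + √(1 - ρ ^ 2) * w : ℝ) : EReal) ∧
        ((ρ * y + √(1 - ρ ^ 2) * w : ℝ) : EReal) ≤ a'} := by
  have hm : MeasurableSet {w : ℝ | ((ρ * y + √(1 - ρ ^ 2) * w : ℝ) : EReal) ≤ a} :=
    measurableSet_coe_le (by fun_prop) _
  have hsub : {w : ℝ | ((ρ * y + √(1 - ρ ^ 2) * w : ℝ) : EReal) ≤ a} ⊆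
      {w : ℝ | ((ρ * y + √(1 - ρ ^ 2) * w : ℝ) : EReal) ≤ a'} :=
    fun w (hw : ((ρ * y + √(1 - ρ ^ 2) * w : ℝ) : EReal) ≤ a) => hw.trans h
  rw [condCell, condCdf, condCdf, ← measureReal_sdiff hsub hm]
  congr 1
  ext w
  simp only [Set.mem_sdiff, Set.mem_ofPred_eq, not_le]
  exact and_comm

/-- The cell contains the part between `m` and `m'`, where the density is at least that at a point
of size linear in `|y|`. Its logarithm is quadratic in `y`, uniformly over all such cells. -/
theorem exists_log_condCell_ge {ρ : ℝ} (hρ : |ρ| < 1) {m m' : ℝ} (hm : m < m') :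
    ∃ c, 0 ≤ c ∧ ∀ a a' : EReal, a ≤ m → (m' : EReal) ≤ a' → ∀ y : ℝ,
      -(c * (1 + y ^ 2)) ≤ Real.log (condCell a a' ρ y) := by
  have hs := sqrt_one_sub_sq_pos hρ
  set s := √(1 - ρ ^ 2) with hs_def
  set b := |m| + |m'| with hb
  have hpi : 0 < √(2 * Real.pi) := by positivity
  refine ⟨|Real.log ((m' - m) / s)| + |Real.log (√(2 * Real.pi))| + (b ^ 2 + 1) / s ^ 2,
    by positivity, fun a a' ha ha' y => ?_⟩
  have h1 := le_condCdf_sub hρ ha hm.le ha' y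
  rw [← hs_def, ← hb] at h1
  have hd : 0 < (m' - m) / s := div_pos (by linarith) hs
  have hφ := gaussianPDFReal_pos 0 1 ((b + |y|) / s) one_ne_zero
  have h2 := Real.log_le_log (mul_pos hd hφ) h1
  rw [Real.log_mul hd.ne' hφ.ne'] at h2
  have h3 : Real.log (gaussianPDFReal 0 1 ((b + |y|) / s)) =
      -Real.log (√(2 * Real.pi)) - ((b + |y|) / s) ^ 2 / 2 := by
    rw [gaussianPDFReal, Real.log_mul (by positivity) (Real.exp_pos _).ne', Real.log_exp]
    simp only [NNReal.coe_one, mul_one, sub_zero, Real.log_inv]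
    ring
  have h4 : ((b + |y|) / s) ^ 2 / 2 ≤ (b ^ 2 + 1) / s ^ 2 * (1 + y ^ 2) := by
    rw [div_pow, div_mul_eq_mul_div, div_div, div_le_div_iff₀ (by positivity) (by positivity)]
    have : (b + |y|) ^ 2 ≤ (b ^ 2 + 1) * (1 + y ^ 2) * 2 := by
      nlinarith [sq_nonneg (b - |y|), sq_abs y, mul_nonneg (sq_nonneg b) (sq_nonneg y)]
    nlinarith [sq_nonneg s]
  have h5 := neg_abs_le (Real.log ((m' - m) / s))
  have h6 := le_abs_self (Real.log (√(2 * Real.pi)))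
  have h7 := mul_nonneg (abs_nonneg (Real.log ((m' - m) / s))) (sq_nonneg y)
  have h8 := mul_nonneg (abs_nonneg (Real.log (√(2 * Real.pi)))) (sq_nonneg y)
  unfold condCell
  rw [h3] at h2
  nlinarith

variable {C : ℕ} {T : ℕ → EReal}

/-- A quadratic lower bound for the logarithms of the conditional cell probabilities that is uniform
over the cells and over thresholds close to the given ones. -/
theorem exists_eventually_log_condCell_ge (hT : IsThresholds C T) {ρ : ℝ} (hρ : |ρ| < 1)
    {α : Type*} {l : Filter α} {S : α → ℕ → EReal} (hS : ∀ t, Tendsto (fun x => S x t) l (𝓝 (T t))) :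
    ∃ c, 0 ≤ c ∧ ∀ᶠ x in l, ∀ t ∈ Finset.Icc 1 C, ∀ y : ℝ,
      -(c * (1 + y ^ 2)) ≤ Real.log (condCell (S x t) (S x (t + 1)) ρ y) := by
  have h : ∀ t ∈ Finset.Icc 1 C, ∃ c, 0 ≤ c ∧ ∀ᶠ x in l, ∀ y : ℝ,
      -(c * (1 + y ^ 2)) ≤ Real.log (condCell (S x t) (S x (t + 1)) ρ y) := by
    intro t ht
    rw [Finset.mem_Icc] at ht
    -- Two real numbers strictly between neighbouring limit thresholds eventually lie between the
    -- estimated ones too.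
    obtain ⟨m, hm1, hm2⟩ := EReal.lt_iff_exists_real_btwn.1
      (hT.lt ht.1 (Nat.lt_succ_self t) (by omega))
    obtain ⟨m', hm1', hm2'⟩ := EReal.lt_iff_exists_real_btwn.1 hm2
    obtain ⟨c, hc0, hc⟩ := exists_log_condCell_ge hρ (EReal.coe_lt_coe_iff.1 hm1')
    refine ⟨c, hc0, ?_⟩
    filter_upwards [(hS t).eventually (gt_mem_nhds hm1),
      (hS (t + 1)).eventually (lt_mem_nhds hm2')] with x hx1 hx2
    exact hc _ _ hx1.le hx2.le
  choose! c hc0 hc using h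
  refine ⟨∑ t ∈ Finset.Icc 1 C, c t, Finset.sum_nonneg hc0, ?_⟩
  filter_upwards [(Finset.eventually_all _).2 hc] with x hx t ht y
  refine le_trans (neg_le_neg (mul_le_mul_of_nonneg_right ?_ (by positivity))) (hx t ht y)
  exact Finset.single_le_sum hc0 ht

/-- Near the limits of the parameters the logarithm of the conditional cell probability is close to
its limit, uniformly on compact sets. -/
theorem eventually_log_condCell_close {α : Type*} {l : Filter α} {a a' : α → EReal} {r : α → ℝ}
    {A A' : EReal} {ρ : ℝ} (ha : Tendsto a l (𝓝 A)) (ha' : Tendsto a' l (𝓝 A'))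
    (hr : Tendsto r l (𝓝 ρ)) (hA : A < A') (hρ : |ρ| < 1) {J : Set ℝ} (hJ : IsCompact J) {ε : ℝ}
    (hε : 0 < ε) :
    ∀ᶠ x in l, ∀ y ∈ J, |Real.log (condCell (a x) (a' x) (r x) y) -
      Real.log (condCell A A' ρ y)| < ε := by
  have hs := (sqrt_one_sub_sq_pos hρ).ne'
  have hev : ∀ᶠ p in 𝓝 (A, A', ρ), ∀ y ∈ J, |Real.log (condCell p.1 p.2.1 p.2.2 y) -
      Real.log (condCell A A' ρ y)| < ε := by
    refine hJ.eventually_forall_of_forall_eventually fun y _ => ?_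
    have h1 : ContinuousAt (fun z : (EReal × EReal × ℝ) × ℝ =>
        Real.log (condCell z.1.1 z.1.2.1 z.1.2.2 z.2)) ((A, A', ρ), y) :=
      (continuousAt_condCell (Or.inl hs)).log (condCell_pos hA hρ y).ne'
    have h2 : ContinuousAt (fun z : (EReal × EReal × ℝ) × ℝ =>
        Real.log (condCell A A' ρ z.2)) ((A, A', ρ), y) :=
      ContinuousAt.comp (f := fun z : (EReal × EReal × ℝ) × ℝ => ((A, A', ρ), z.2))
        (x := ((A, A', ρ), y)) h1 (Continuous.continuousAt (by fun_prop))
    have h3 : Tendsto (fun z : (EReal × EReal × ℝ) × ℝ =>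
        |Real.log (condCell z.1.1 z.1.2.1 z.1.2.2 z.2) - Real.log (condCell A A' ρ z.2)|)
        (𝓝 ((A, A', ρ), y)) (𝓝 0) := by
      simpa using (h1.sub h2).abs.tendsto
    exact h3.eventually (gt_mem_nhds hε)
  exact (ha.prodMk_nhds (ha'.prodMk_nhds hr)).eventually hev

/-- The density of the continuous column contributes a term that is free of `ρ` and cancels in every
comparison. -/
theorem logLikCD_eq (hT : IsThresholds C T) (hC : 1 ≤ C) {N : ℕ} (U V : Fin N → ℝ) {ρ : ℝ}
    (hρ : |ρ| < 1) :
    logLikCD U (fun n => discretize C T (V n)) ρ =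
      (1 / (N : ℝ)) * ∑ n, Real.log (gaussianPDFReal 0 1 (U n)) +
      (1 / (N : ℝ)) * ∑ n, Real.log (condCell (empThreshold V (T (level C T (V n))))
        (empThreshold V (T (level C T (V n) + 1))) ρ (U n)) := by
  rw [logLikCD, ← mul_add, ← Finset.sum_add_distrib]
  congr 2
  ext n
  obtain ⟨h1, h2⟩ := hT.level_spec hC (V n)
  rw [Finset.mem_Icc] at h1
  have e := estThreshold_discretize hT hC V h1.1 (h1.2.trans (Nat.le_succ _))
  have e' := estThreshold_discretize hT hC V (Nat.le_add_left 1 (level C T (V n)))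
    (Nat.succ_le_succ h1.2)
  push_cast at e'
  rw [discretize_eq_level C T (V n), e, e', stdCdf_div_eq_condCdf hρ, stdCdf_div_eq_condCdf hρ,
    ← condCell, Real.log_mul (gaussianPDFReal_pos _ _ _ one_ne_zero).ne'
      (condCell_pos (empThreshold_lt V h2.1 h2.2) hρ _).ne']

theorem continuousOn_logLikCD (hT : IsThresholds C T) (hC : 1 ≤ C) {N : ℕ} (U V : Fin N → ℝ) :
    ContinuousOn (logLikCD U (fun n => discretize C T (V n))) (Set.Ioo (-1) 1) := by
  refine ContinuousOn.congr ?_ fun ρ hρ => logLikCD_eq hT hC U V (abs_lt.2 hρ)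
  intro ρ hρ
  have hρ' : |ρ| < 1 := abs_lt.2 hρ
  refine ContinuousAt.continuousWithinAt (continuousAt_const.add (continuousAt_const.mul ?_))
  refine tendsto_finsetSum _ fun n _ => ?_
  have h2 := (hT.level_spec hC (V n)).2
  refine ContinuousAt.log ?_ (condCell_pos (empThreshold_lt V h2.1 h2.2) hρ' _).ne'
  exact ContinuousAt.comp (f := fun ρ : ℝ => (((_, _, ρ), U n) : (EReal × EReal × ℝ) × ℝ))
    (continuousAt_condCell (Or.inl (sqrt_one_sub_sq_pos hρ').ne')) (by fun_prop)

/-- The difference of the logarithms of the conditional cell probabilities at two correlations,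
as a function of both variables, cut off at `K` in the first one. -/
def logRatio (C : ℕ) (T : ℕ → EReal) (ρ ρ₀ K : ℝ) (z : ℝ × ℝ) : ℝ :=
  ∑ t ∈ Finset.Icc 1 C, {z : ℝ × ℝ | |z.1| ≤ K ∧ T t < z.2 ∧ (z.2 : EReal) ≤ T (t + 1)}.indicator
    (fun z => Real.log (condCell (T t) (T (t + 1)) ρ z.1) -
      Real.log (condCell (T t) (T (t + 1)) ρ₀ z.1)) z

theorem measurable_logRatio (C : ℕ) (T : ℕ → EReal) (ρ ρ₀ K : ℝ) :
    Measurable (logRatio C T ρ ρ₀ K) := by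
  refine Finset.measurable_sum _ fun t _ => Measurable.indicator ?_ ?_
  · exact ((measurable_condCell _ _ _).comp measurable_fst).log.sub
      ((measurable_condCell _ _ _).comp measurable_fst).log
  · exact (measurableSet_le (f := fun z : ℝ × ℝ => |z.1|) measurable_fst.abs measurable_const).inter
      ((measurableSet_lt measurable_const (measurable_coe_real_ereal.comp measurable_snd)).inter
      (measurableSet_le (measurable_coe_real_ereal.comp measurable_snd) measurable_const))

theorem logRatio_eq (hT : IsThresholds C T) (hC : 1 ≤ C) (ρ ρ₀ K : ℝ) (z : ℝ × ℝ) :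
    logRatio C T ρ ρ₀ K z = if |z.1| ≤ K then
      Real.log (condCell (T (level C T z.2)) (T (level C T z.2 + 1)) ρ z.1) -
      Real.log (condCell (T (level C T z.2)) (T (level C T z.2 + 1)) ρ₀ z.1) else 0 := by
  classical
  obtain ⟨h1, h2⟩ := hT.level_spec hC z.2
  by_cases hz : |z.1| ≤ K
  · rw [if_pos hz, logRatio]
    simp only [Set.indicator_apply, Set.mem_ofPred_eq, hz, true_and]
    exact hT.sum_cell h1 h2 fun t => Real.log (condCell (T t) (T (t + 1)) ρ z.1) -
      Real.log (condCell (T t) (T (t + 1)) ρ₀ z.1)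
  · rw [if_neg hz, logRatio]
    exact Finset.sum_eq_zero fun t _ => Set.indicator_of_notMem (fun h => hz h.1) _

/-- Both logarithms are nonpositive and have quadratic lower bounds. This brings the ratio within
the reach of `PairLLN`, with a constant that does not depend on the cutoff. -/
theorem exists_abs_logRatio_le (hT : IsThresholds C T) (hC : 1 ≤ C) {ρ ρ₀ : ℝ} (hρ : |ρ| < 1)
    (hρ₀ : |ρ₀| < 1) : ∃ c, 0 ≤ c ∧ ∀ K z, |logRatio C T ρ ρ₀ K z| ≤ c * (1 + z.1 ^ 2 + z.2 ^ 2) := by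
  -- The exact thresholds are a constant convergent family, so the bound for estimated thresholds
  -- covers them.
  have hS : ∀ t, Tendsto (fun _ : Unit => T t) ⊤ (𝓝 (T t)) := fun t => tendsto_const_nhds
  obtain ⟨c, hc0, hc⟩ := exists_eventually_log_condCell_ge hT hρ hS
  obtain ⟨c', hc0', hc'⟩ := exists_eventually_log_condCell_ge hT hρ₀ hS
  obtain ⟨-, hc⟩ := hc.exists
  obtain ⟨-, hc'⟩ := hc'.exists
  refine ⟨c + c', by positivity, fun K z => ?_⟩
  rw [logRatio_eq hT hC]
  split_ifs
  · obtain ⟨h1, h2⟩ := hT.level_spec hC z.2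
    have hle := (h2.1.trans_le h2.2).le
    have a1 := hc _ h1 z.1
    have a2 := hc' _ h1 z.1
    have a3 := log_condCell_nonpos hle ρ z.1
    have a4 := log_condCell_nonpos hle ρ₀ z.1
    have b1 := mul_nonneg hc0 (sq_nonneg z.2)
    have b2 := mul_nonneg hc0' (sq_nonneg z.2)
    have b3 : 0 ≤ c * (1 + z.1 ^ 2) := by positivity
    have b4 : 0 ≤ c' * (1 + z.1 ^ 2) := by positivity
    have e : (c + c') * (1 + z.1 ^ 2 + z.2 ^ 2) = c * (1 + z.1 ^ 2) + c' * (1 + z.1 ^ 2) +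
      c * z.2 ^ 2 + c' * z.2 ^ 2 := by ring
    rw [e, abs_le]
    constructor <;> linarith
  · rw [abs_zero]
    positivity

/-- Gibbs' inequality for the expected truncated log-likelihood ratio. -/
theorem integral_logRatio_le (hT : IsThresholds C T) (hC : 1 ≤ C) {ρ ρ₀ : ℝ} (hρ : |ρ| < 1)
    (hρ₀ : |ρ₀| < 1) {K : ℝ} (hK : 1 ≤ K) :
    ∫ z, logRatio C T ρ ρ₀ K z ∂bivariateGaussian ρ₀ ≤
      -∫ y in Set.Icc (-1) 1, (condCdf (T 2) ρ₀ y - condCdf (T 2) ρ y) ^ 2 / 4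
        ∂gaussianReal 0 1 := by
  obtain ⟨c, -, hc⟩ := exists_abs_logRatio_le hT hC hρ hρ₀
  have hmeas := measurable_logRatio C T ρ ρ₀ K
  have hint : Integrable (logRatio C T ρ ρ₀ K) (bivariateGaussian ρ₀) :=
    (memLp_two_of_quadratic_growth hρ₀ hmeas (hc K)).integrable one_le_two
  have hint' : Integrable (fun z : ℝ × ℝ =>
      logRatio C T ρ ρ₀ K (z.1, ρ₀ * z.1 + √(1 - ρ₀ ^ 2) * z.2))
      ((gaussianReal 0 1).prod (gaussianReal 0 1)) :=
    (integrable_map_measure hmeas.aestronglyMeasurable (measurable_correlate ρ₀).aemeasurable).1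
      hint
  rw [integral_bivariateGaussian ρ₀ hmeas, integral_prod _ hint', ← integral_neg,
    ← integral_indicator measurableSet_Icc]
  have hsq : Measurable fun y => (condCdf (T 2) ρ₀ y - condCdf (T 2) ρ y) ^ 2 / 4 :=
    (((measurable_condCdf _ _).sub (measurable_condCdf _ _)).pow_const 2).div_const 4
  have hbd : ∀ y, (condCdf (T 2) ρ₀ y - condCdf (T 2) ρ y) ^ 2 / 4 ≤ 1 := by
    intro y
    have := condCdf_nonneg (T 2) ρ₀ y
    have := condCdf_nonneg (T 2) ρ y
    have := condCdf_le_one (T 2) ρ₀ y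
    have := condCdf_le_one (T 2) ρ y
    nlinarith
  have hle : ∀ t ∈ Finset.Icc 1 C, T t < T (t + 1) := by
    intro t ht
    rw [Finset.mem_Icc] at ht
    exact hT.lt ht.1 (Nat.lt_succ_self t) (by omega)
  refine integral_mono hint'.integral_prod_left ?_ fun y => ?_
  · refine Integrable.indicator ?_ measurableSet_Icc
    refine (integrable_const (1 : ℝ)).mono' hsq.neg.aestronglyMeasurable (ae_of_all _ fun y => ?_)
    rw [norm_neg, Real.norm_of_nonneg (by positivity)]
    exact hbd y
  · have hin : ∫ w, logRatio C T ρ ρ₀ K (y, ρ₀ * y + √(1 - ρ₀ ^ 2) * w) ∂gaussianReal 0 1 =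
        if |y| ≤ K then ∑ t ∈ Finset.Icc 1 C, condCell (T t) (T (t + 1)) ρ₀ y *
          (Real.log (condCell (T t) (T (t + 1)) ρ y) -
            Real.log (condCell (T t) (T (t + 1)) ρ₀ y)) else 0 := by
      by_cases hy : |y| ≤ K
      · rw [if_pos hy]
        have hset : ∀ t, MeasurableSet {w : ℝ | T t < ((ρ₀ * y + √(1 - ρ₀ ^ 2) * w : ℝ) : EReal) ∧
            ((ρ₀ * y + √(1 - ρ₀ ^ 2) * w : ℝ) : EReal) ≤ T (t + 1)} := fun t =>
          (measurableSet_lt measurable_const (measurable_coe_real_ereal.comp (by fun_prop))).inter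
            (measurableSet_coe_le (by fun_prop) _)
        have e : ∀ w, logRatio C T ρ ρ₀ K (y, ρ₀ * y + √(1 - ρ₀ ^ 2) * w) =
            ∑ t ∈ Finset.Icc 1 C, {w : ℝ | T t < ((ρ₀ * y + √(1 - ρ₀ ^ 2) * w : ℝ) : EReal) ∧
            ((ρ₀ * y + √(1 - ρ₀ ^ 2) * w : ℝ) : EReal) ≤ T (t + 1)}.indicator
            (fun _ => Real.log (condCell (T t) (T (t + 1)) ρ y) -
              Real.log (condCell (T t) (T (t + 1)) ρ₀ y)) w := by
          intro w
          simp only [logRatio, Set.indicator_apply, Set.mem_ofPred_eq, hy, true_and]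
        simp_rw [e]
        rw [integral_finsetSum _ fun t _ => (integrable_const _).indicator (hset t)]
        refine Finset.sum_congr rfl fun t ht => ?_
        rw [integral_indicator_const _ (hset t), condCell_eq_measureReal (hle t ht).le ρ₀ y,
          smul_eq_mul]
      · rw [if_neg hy]
        simp_rw [logRatio_eq hT hC, if_neg hy]
        simp
    -- Gibbs' inequality for the conditional law of the level given the value `y`. Since `T 1 = ⊥`,
    -- the probability of the first level is the conditional distribution function at `T 2`.
    have hgibbs : ∑ t ∈ Finset.Icc 1 C, condCell (T t) (T (t + 1)) ρ₀ y *
        (Real.log (condCell (T t) (T (t + 1)) ρ y) -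
          Real.log (condCell (T t) (T (t + 1)) ρ₀ y)) ≤
        -((condCdf (T 2) ρ₀ y - condCdf (T 2) ρ y) ^ 2 / 4) := by
      have hsum : ∀ ρ', ∑ t ∈ Finset.Icc 1 C, condCell (T t) (T (t + 1)) ρ' y = 1 := by
        intro ρ'
        have := sum_Icc_one_sub (fun t => condCdf (T t) ρ' y) C
        rw [hT.1, hT.2.1, condCdf_bot, condCdf_top, sub_zero] at this
        exact this
      have h := sum_mul_log_sub_le (Finset.Icc 1 C)
        (p := fun t => condCell (T t) (T (t + 1)) ρ₀ y)
        (q := fun t => condCell (T t) (T (t + 1)) ρ y)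
        (fun t ht => condCell_nonneg (hle t ht).le _ _)
        (fun t ht => condCell_nonneg (hle t ht).le _ _)
        (fun t ht _ => condCell_pos (hle t ht) hρ _) (hsum ρ₀) (hsum ρ)
        (Finset.mem_Icc.2 ⟨le_rfl, hC⟩)
      have e1 : ∀ ρ', condCell (T 1) (T (1 + 1)) ρ' y = condCdf (T 2) ρ' y := by
        intro ρ'
        rw [condCell, hT.1, condCdf_bot, sub_zero]
      simp only [e1] at h
      exact h
    show ∫ w, logRatio C T ρ ρ₀ K (y, ρ₀ * y + √(1 - ρ₀ ^ 2) * w) ∂gaussianReal 0 1 ≤ _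
    rw [hin]
    -- The gap is kept only on `[-1, 1]`, which the cutoff does not touch because `K ≥ 1`. Elsewhere
    -- it suffices that the expression is nonpositive.
    by_cases hy1 : y ∈ Set.Icc (-1 : ℝ) 1
    · rw [Set.indicator_of_mem hy1, if_pos ((abs_le.2 hy1).trans hK)]
      exact hgibbs
    · rw [Set.indicator_of_notMem hy1]
      split_ifs
      · exact hgibbs.trans (neg_nonpos.2 (by positivity))
      · exact le_rfl

/-- The two conditional distribution functions agree only at their single crossing point, which is a
null set. -/
theorem integral_sq_condCdf_sub_pos {ρ₁ ρ₂ : ℝ} (h₁ : |ρ₁| < 1) (h₂ : |ρ₂| < 1) (h : ρ₁ < ρ₂)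
    (b : ℝ) : 0 < ∫ y in Set.Icc (-1) 1, (condCdf b ρ₁ y - condCdf b ρ₂ y) ^ 2 / 4
      ∂gaussianReal 0 1 := by
  obtain ⟨x₀, hlt, hgt⟩ := exists_condCdf_crossing h₁ h₂ h b
  have hmeas : Measurable fun y => (condCdf b ρ₁ y - condCdf b ρ₂ y) ^ 2 / 4 :=
    (((measurable_condCdf _ _).sub (measurable_condCdf _ _)).pow_const 2).div_const 4
  refine setIntegral_gaussianReal_pos (t := Set.Icc (-1) 1 \ {x₀}) ?_ measurableSet_Icc
    (fun y _ => by positivity) Set.sdiff_subset (fun y hy => ?_) ?_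
  · refine Integrable.integrableOn ((integrable_const (1 : ℝ)).mono' hmeas.aestronglyMeasurable
      (ae_of_all _ fun y => ?_))
    rw [Real.norm_of_nonneg (by positivity)]
    have := condCdf_nonneg b ρ₁ y
    have := condCdf_nonneg b ρ₂ y
    have := condCdf_le_one b ρ₁ y
    have := condCdf_le_one b ρ₂ y
    nlinarith
  · have hne : condCdf b ρ₁ y - condCdf b ρ₂ y ≠ 0 := by
      rcases lt_or_gt_of_ne (show y ≠ x₀ from hy.2) with hy | hy
      · exact (sub_neg.2 (hlt y hy)).ne
      · exact (sub_pos.2 (hgt y hy)).ne'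
    positivity
  · rw [measure_sdiff_null (measure_singleton x₀)]
    simp

end Polyserial

/-! ### Identification of the correlation by the polyserial likelihood -/

section PolyserialSeparates

variable {Ω : Type*} [MeasurableSpace Ω] {l : Filter (ℕ × Ω)} {U V : (N : ℕ) → Ω → Fin N → ℝ} {ρ₀ : ℝ}
  {C : ℕ} {T : ℕ → EReal}

theorem logLikCD_le_of_log_condCell_le (hT : IsThresholds C T) (hC : 1 ≤ C) {N : ℕ} (hN : 1 ≤ N)
    (U V : Fin N → ℝ) {ρ ρ₀ : ℝ} (hρ : |ρ| < 1) (hρ₀ : |ρ₀| < 1) {f : ℝ × ℝ → ℝ} {ε : ℝ}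
    (h : ∀ n, Real.log (condCell (empThreshold V (T (level C T (V n))))
        (empThreshold V (T (level C T (V n) + 1))) ρ (U n)) ≤
      Real.log (condCell (empThreshold V (T (level C T (V n))))
        (empThreshold V (T (level C T (V n) + 1))) ρ₀ (U n)) + (f (U n, V n) + ε)) :
    logLikCD U (fun n => discretize C T (V n)) ρ ≤
      logLikCD U (fun n => discretize C T (V n)) ρ₀ + (1 / (N : ℝ)) * ∑ n, f (U n, V n) + ε := by
  have hN0 : (0 : ℝ) < N := by exact_mod_cast hN
  rw [logLikCD_eq hT hC U V hρ, logLikCD_eq hT hC U V hρ₀]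
  have h1 := Finset.sum_le_sum fun n (_ : n ∈ Finset.univ) => h n
  rw [Finset.sum_add_distrib, Finset.sum_add_distrib, Finset.sum_const, Finset.card_univ,
    Fintype.card_fin, nsmul_eq_mul] at h1
  have h2 := mul_le_mul_of_nonneg_left h1 (show 0 ≤ 1 / (N : ℝ) by positivity)
  rw [mul_add, mul_add, ← mul_assoc (1 / (N : ℝ)) (N : ℝ) ε, one_div_mul_cancel hN0.ne',
    one_mul] at h2
  linarith

/-- Dominated convergence: at each point the integrand vanishes once `K` exceeds the first
coordinate in absolute value. -/
theorem exists_setIntegral_tail_lt {ρ c δ : ℝ} (hρ : |ρ| < 1) (hc : 0 ≤ c) (hδ : 0 < δ) :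
    ∃ K : ℕ, 1 ≤ K ∧ ∫ z, {z : ℝ × ℝ | (K : ℝ) < |z.1|}.indicator (fun z => c * (1 + z.1 ^ 2)) z
      ∂bivariateGaussian ρ < δ := by
  have hmeas : Measurable fun z : ℝ × ℝ => c * (1 + z.1 ^ 2) := by fun_prop
  have hint : Integrable (fun z : ℝ × ℝ => c * (1 + z.1 ^ 2)) (bivariateGaussian ρ) := by
    refine (memLp_two_of_quadratic_growth hρ hmeas (c := c) fun z => ?_).integrable one_le_two
    rw [abs_of_nonneg (by positivity)]
    have := mul_nonneg hc (sq_nonneg z.2)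
    linarith
  have hset : ∀ K : ℕ, MeasurableSet {z : ℝ × ℝ | (K : ℝ) < |z.1|} := fun K =>
    measurableSet_lt (g := fun z : ℝ × ℝ => |z.1|) measurable_const measurable_fst.abs
  have hlim : Tendsto (fun K : ℕ => ∫ z, {z : ℝ × ℝ | (K : ℝ) < |z.1|}.indicator
      (fun z => c * (1 + z.1 ^ 2)) z ∂bivariateGaussian ρ) atTop
      (𝓝 (∫ _, (0 : ℝ) ∂bivariateGaussian ρ)) := by
    refine tendsto_integral_of_dominated_convergence (fun z : ℝ × ℝ => c * (1 + z.1 ^ 2))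
      (fun K => (hmeas.indicator (hset K)).aestronglyMeasurable) hint
      (fun K => ae_of_all _ fun z => ?_) (ae_of_all _ fun z => ?_)
    · refine (norm_indicator_le_norm_self _ _).trans (le_of_eq ?_)
      exact Real.norm_of_nonneg (by positivity)
    · refine tendsto_const_nhds.congr' ?_
      filter_upwards [tendsto_natCast_atTop_atTop.eventually (eventually_ge_atTop |z.1|)] with K hK
      exact (Set.indicator_of_notMem (s := {z : ℝ × ℝ | (K : ℝ) < |z.1|})
        (fun h : (K : ℝ) < |z.1| => absurd h (not_lt.2 hK)) _).symm
  rw [integral_zero] at hlim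
  obtain ⟨K, hK, hK1⟩ := ((hlim.eventually (gt_mem_nhds hδ)).and (eventually_ge_atTop 1)).exists
  exact ⟨K, hK1, hK⟩

/-- For rows with `|U| ≤ K` the logarithms are uniformly close to those at the true thresholds and
at the limit `ρ`, so the comparison is governed by `logRatio`. For the other rows the logarithm at
`r x` is at most zero and the one at `ρ₀` is at least `-(c * (1 + U ^ 2))`; the average cost of
these rows is small for large `K`. -/
theorem PairLLN.eventually_logLikCD_le (hl : ∀ᶠ x in l, 1 ≤ x.1) (hρ₀ : |ρ₀| < 1)
    (h : PairLLN l U V ρ₀) (hT : IsThresholds C T) (hC : 1 ≤ C) {r : ℕ × Ω → ℝ} {ρ : ℝ}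
    (hr : Tendsto r l (𝓝 ρ)) (hρ : |ρ| < 1) {η : ℝ} (hη : 0 < η) :
    ∀ᶠ x in l, logLikCD (U x.1 x.2) (fun n => discretize C T (V x.1 x.2 n)) (r x) ≤
      logLikCD (U x.1 x.2) (fun n => discretize C T (V x.1 x.2 n)) ρ₀ -
      (∫ y in Set.Icc (-1) 1, (condCdf (T 2) ρ₀ y - condCdf (T 2) ρ y) ^ 2 / 4
        ∂gaussianReal 0 1) + η := by
  have hS := fun t => h.tendsto_empThreshold_snd hρ₀ (T t)
  obtain ⟨c, hc0, hc⟩ := exists_eventually_log_condCell_ge hT hρ₀ hS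
  obtain ⟨K, hK1, hK⟩ := exists_setIntegral_tail_lt hρ₀ hc0 (show 0 < η / 4 by linarith)
  obtain ⟨c', hc0', hc'⟩ := exists_abs_logRatio_le hT hC hρ hρ₀
  have hKr : (1 : ℝ) ≤ K := by exact_mod_cast hK1
  have hset : MeasurableSet {z : ℝ × ℝ | (K : ℝ) < |z.1|} :=
    measurableSet_lt (g := fun z : ℝ × ℝ => |z.1|) measurable_const measurable_fst.abs
  set g : ℝ × ℝ → ℝ :=
    {z : ℝ × ℝ | (K : ℝ) < |z.1|}.indicator (fun z => c * (1 + z.1 ^ 2)) with hg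
  have hgm : Measurable g := Measurable.indicator (by fun_prop) hset
  have hgb : ∀ z, |g z| ≤ c * (1 + z.1 ^ 2 + z.2 ^ 2) := by
    intro z
    have h1 : |g z| ≤ c * (1 + z.1 ^ 2) := by
      refine (norm_indicator_le_norm_self (s := {z : ℝ × ℝ | (K : ℝ) < |z.1|})
        (fun z : ℝ × ℝ => c * (1 + z.1 ^ 2)) z).trans (le_of_eq ?_)
      exact Real.norm_of_nonneg (by positivity)
    have := mul_nonneg hc0 (sq_nonneg z.2)
    linarith
  have hg0 : ∀ z, 0 ≤ g z := fun z => Set.indicator_nonneg (fun z _ => by positivity) z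
  have hlm := measurable_logRatio C T ρ ρ₀ K
  have hLLN := h (fun z => logRatio C T ρ ρ₀ K z + g z) (hlm.add hgm) ⟨c' + c, fun z => by
    rw [add_mul]
    exact (abs_add_le _ _).trans (add_le_add (hc' K z) (hgb z))⟩
  rw [integral_add ((memLp_two_of_quadratic_growth hρ₀ hlm (hc' K)).integrable one_le_two)
    ((memLp_two_of_quadratic_growth hρ₀ hgm hgb).integrable one_le_two)] at hLLN
  have hgibbs := integral_logRatio_le hT hC hρ hρ₀ hKr
  have hclose : ∀ {r : ℕ × Ω → ℝ} {ρ : ℝ}, Tendsto r l (𝓝 ρ) → |ρ| < 1 →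
      ∀ᶠ x in l, ∀ t ∈ Finset.Icc 1 C, ∀ y ∈ Set.Icc (-(K : ℝ)) K,
      |Real.log (condCell (empThreshold (V x.1 x.2) (T t)) (empThreshold (V x.1 x.2) (T (t + 1)))
        (r x) y) - Real.log (condCell (T t) (T (t + 1)) ρ y)| < η / 8 := by
    intro r ρ hr hρ
    refine (Finset.eventually_all _).2 fun t ht => ?_
    rw [Finset.mem_Icc] at ht
    exact eventually_log_condCell_close (hS t) (hS (t + 1)) hr
      (hT.lt ht.1 (Nat.lt_succ_self t) (by omega)) hρ isCompact_Icc (by linarith)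
  -- The error is made up of `η / 8` for each of the two approximations, `η / 4` for the tail and `η
  -- / 4` for the law of large numbers.
  filter_upwards [hl, hc, hclose hr hρ, hclose (r := fun _ => ρ₀) tendsto_const_nhds hρ₀,
    hr.abs.eventually (gt_mem_nhds hρ), hLLN.eventually (gt_mem_nhds (lt_add_of_pos_right _
      (show 0 < η / 4 by linarith)))] with x hN hx1 hx2 hx3 hx4 hx5
  have key := logLikCD_le_of_log_condCell_le hT hC hN (U x.1 x.2) (V x.1 x.2) hx4 hρ₀
    (f := fun z => logRatio C T ρ ρ₀ K z + g z) (ε := η / 4) fun n => ?_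
  · linarith
  · obtain ⟨h1, h2⟩ := hT.level_spec hC (V x.1 x.2 n)
    have hlt := empThreshold_lt (V x.1 x.2) h2.1 h2.2
    show _ ≤ _ + (logRatio C T ρ ρ₀ K (U x.1 x.2 n, V x.1 x.2 n) +
      g (U x.1 x.2 n, V x.1 x.2 n) + η / 4)
    rw [logRatio_eq hT hC]
    by_cases hU : |U x.1 x.2 n| ≤ K
    · rw [if_pos hU]
      have a1 := (abs_lt.1 (hx2 _ h1 _ (abs_le.1 hU))).2
      have a2 := (abs_lt.1 (hx3 _ h1 _ (abs_le.1 hU))).1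
      have a3 := hg0 (U x.1 x.2 n, V x.1 x.2 n)
      linarith
    · rw [if_neg hU]
      have a1 := hx1 _ h1 (U x.1 x.2 n)
      have a2 := log_condCell_nonpos hlt.le (r x) (U x.1 x.2 n)
      have a3 : g (U x.1 x.2 n, V x.1 x.2 n) = c * (1 + U x.1 x.2 n ^ 2) :=
        Set.indicator_of_mem (s := {z : ℝ × ℝ | (K : ℝ) < |z.1|}) (f := fun z => c * (1 + z.1 ^ 2))
          (a := (U x.1 x.2 n, V x.1 x.2 n)) (not_le.1 hU)
      rw [a3]
      linarith

/-- At the boundary, the conditional distribution function vanishes on some interval. -/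
theorem exists_condCdf_eq_zero {ρ : ℝ} (hρ : |ρ| = 1) (τ : ℝ) :
    ∃ a : ℝ, ∀ y ∈ Set.Icc a (a + 1), ρ * y ≠ τ ∧ condCdf τ ρ y = 0 := by
  have key : ∀ y : ℝ, τ < ρ * y → ρ * y ≠ τ ∧ condCdf τ ρ y = 0 := by
    intro y hy
    refine ⟨hy.ne', ?_⟩
    have hs : √(1 - ρ ^ 2) = 0 := by
      rw [← sq_abs, hρ]
      norm_num
    have he : {w : ℝ | ((ρ * y + √(1 - ρ ^ 2) * w : ℝ) : EReal) ≤ τ} = ∅ := by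
      ext w
      simp only [hs, zero_mul, add_zero, EReal.coe_le_coe_iff, Set.mem_ofPred_eq,
        Set.mem_empty_iff_false, iff_false, not_le]
      exact hy
    rw [condCdf, he]
    simp
  -- For `ρ = 1` the interval lies to the right of `|τ|`, for `ρ = -1` to the left of `-|τ|`; in
  -- both cases `τ < ρ * y` on it.
  rcases abs_cases τ with ⟨h1, h2⟩ | ⟨h1, h2⟩ <;>
  rcases eq_or_eq_neg_of_abs_eq hρ with rfl | rfl
  all_goals first
    | exact ⟨|τ| + 1, fun y hy => key y (by linarith [hy.1, hy.2])⟩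
    | exact ⟨-|τ| - 2, fun y hy => key y (by linarith [hy.1, hy.2])⟩

/-- As `r x` tends to `±1`, the second variable is nearly determined by the first, and the first
level becomes almost impossible for `U` in a suitable interval. Under `ρ₀` this combination has
positive frequency, so its contribution to the likelihood can be made as negative as desired. -/
theorem PairLLN.eventually_logLikCD_le_of_abs_eq_one (hl : ∀ᶠ x in l, 1 ≤ x.1) (hρ₀ : |ρ₀| < 1)
    (h : PairLLN l U V ρ₀) (hT : IsThresholds C T) (hC : 1 ≤ C) {τ : ℝ} (hτ : T 2 = τ)
    {r : ℕ × Ω → ℝ} {ρ : ℝ} (hr1 : ∀ᶠ x in l, |r x| < 1) (hr : Tendsto r l (𝓝 ρ)) (hρ : |ρ| = 1)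
    {η : ℝ} (hη : 0 < η) :
    ∀ᶠ x in l, logLikCD (U x.1 x.2) (fun n => discretize C T (V x.1 x.2 n)) (r x) ≤
      logLikCD (U x.1 x.2) (fun n => discretize C T (V x.1 x.2 n)) ρ₀ - 1 + η := by
  have hS := fun t => h.tendsto_empThreshold_snd hρ₀ (T t)
  obtain ⟨c, hc0, hc⟩ := exists_eventually_log_condCell_ge hT hρ₀ hS
  obtain ⟨a, ha⟩ := exists_condCdf_eq_zero hρ τ
  set E : Set (ℝ × ℝ) := {z | ((a : EReal) < z.1 ∧ (z.1 : EReal) ≤ ((a + 1 : ℝ) : EReal)) ∧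
    ((⊥ : EReal) < z.2 ∧ (z.2 : EReal) ≤ τ)} with hE
  have hEm : MeasurableSet E :=
    ((measurableSet_lt measurable_const (measurable_coe_real_ereal.comp measurable_fst)).inter
      (measurableSet_coe_le measurable_fst _)).inter
    ((measurableSet_lt measurable_const (measurable_coe_real_ereal.comp measurable_snd)).inter
      (measurableSet_coe_le measurable_snd _))
  have haa : (a : EReal) < ((a + 1 : ℝ) : EReal) := EReal.coe_lt_coe_iff.2 (by linarith)
  have hp : 0 < (bivariateGaussian ρ₀).real E := by
    rw [hE, ← cellProb_eq_bivariateGaussian haa.le bot_le]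
    exact cellProb_pos haa (EReal.bot_lt_coe τ) hρ₀
  set p := (bivariateGaussian ρ₀).real E with hp_def
  -- Chosen so that `p * log κ + 2 * c = -1`, where `2 * c` is the mean of the bound `c * (1 + U ^
  -- 2)` for the loss at `ρ₀`.
  set κ := Real.exp (-(2 * c + 1) / p) with hκ
  have hκ0 : 0 < κ := Real.exp_pos _
  have hsmall : ∀ᶠ x in l, ∀ y ∈ Set.Icc a (a + 1),
      condCdf (empThreshold (V x.1 x.2) (T 2)) (r x) y < κ := by
    have hev : ∀ᶠ q in 𝓝 ((τ : EReal), ρ), ∀ y ∈ Set.Icc a (a + 1), condCdf q.1 q.2 y < κ := by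
      refine isCompact_Icc.eventually_forall_of_forall_eventually fun y hy => ?_
      obtain ⟨hy1, hy2⟩ := ha y hy
      have h1 := continuousAt_condCdf (T := (τ : EReal)) (ρ := ρ) (x := y)
        (Or.inr (fun e => hy1 (EReal.coe_eq_coe_iff.1 e)))
      have h2 : ContinuousAt (fun z : (EReal × ℝ) × ℝ => condCdf z.1.1 z.1.2 z.2)
          (((τ : EReal), ρ), y) :=
        ContinuousAt.comp (f := fun z : (EReal × ℝ) × ℝ => (z.1.1, z.1.2, z.2))
          (x := (((τ : EReal), ρ), y)) h1 (Continuous.continuousAt (by fun_prop))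
      refine h2.tendsto.eventually (gt_mem_nhds ?_)
      show condCdf τ ρ y < κ
      rw [hy2]
      exact hκ0
    have h2 := hS 2
    rw [hτ] at h2
    rw [hτ]
    exact (h2.prodMk_nhds hr).eventually hev
  have hqm : Measurable fun z : ℝ × ℝ => c * (1 + z.1 ^ 2) := by fun_prop
  have hqb : ∀ z : ℝ × ℝ, |c * (1 + z.1 ^ 2)| ≤ c * (1 + z.1 ^ 2 + z.2 ^ 2) := by
    intro z
    rw [abs_of_nonneg (by positivity)]
    have := mul_nonneg hc0 (sq_nonneg z.2)
    linarith
  have hq := h _ hqm ⟨c, hqb⟩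
  have hqi : ∫ z, c * (1 + z.1 ^ 2) ∂bivariateGaussian ρ₀ = 2 * c := by
    have hsq : Integrable (fun z : ℝ × ℝ => z.1 ^ 2) (bivariateGaussian ρ₀) := by
      refine (memLp_two_of_quadratic_growth hρ₀ (by fun_prop) (c := 1) fun z => ?_).integrable
        one_le_two
      rw [abs_of_nonneg (by positivity)]
      nlinarith [sq_nonneg z.2]
    rw [integral_const_mul, integral_add (integrable_const _) hsq,
      integral_fst_sq_bivariateGaussian]
    simp
    ring
  rw [hqi] at hq
  have hlim := ((h.tendsto_freq hEm).mul_const (Real.log κ)).add hq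
  have hval : p * Real.log κ + 2 * c = -1 := by
    rw [hκ, Real.log_exp, mul_div_cancel₀ _ hp.ne']
    ring
  rw [← hp_def, hval] at hlim
  filter_upwards [hl, hc, hsmall, hr1,
    hlim.eventually (gt_mem_nhds (show -1 < -1 + η by linarith))] with x hN hx1 hx2 hx3 hx4
  have key := logLikCD_le_of_log_condCell_le hT hC hN (U x.1 x.2) (V x.1 x.2) hx3 hρ₀
    (f := fun z => E.indicator 1 z * Real.log κ + c * (1 + z.1 ^ 2)) (ε := 0) fun n => ?_
  · rw [Finset.sum_add_distrib, ← Finset.sum_mul, mul_add, ← mul_assoc] at key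
    linarith
  · obtain ⟨h1, h2⟩ := hT.level_spec hC (V x.1 x.2 n)
    have hlt := empThreshold_lt (V x.1 x.2) h2.1 h2.2
    have a1 := hx1 _ h1 (U x.1 x.2 n)
    have a2 := log_condCell_nonpos hlt.le (r x) (U x.1 x.2 n)
    show _ ≤ _ + (E.indicator 1 (U x.1 x.2 n, V x.1 x.2 n) * Real.log κ +
      c * (1 + U x.1 x.2 n ^ 2) + 0)
    by_cases hz : (U x.1 x.2 n, V x.1 x.2 n) ∈ E
    · have hU : U x.1 x.2 n ∈ Set.Icc a (a + 1) :=
        ⟨(EReal.coe_lt_coe_iff.1 hz.1.1).le, EReal.coe_le_coe_iff.1 hz.1.2⟩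
      have hlev : level C T (V x.1 x.2 n) = 1 :=
        hT.cell_unique h1 (Finset.mem_Icc.2 ⟨le_rfl, hC⟩) h2
          ⟨by rw [hT.1]; exact hz.2.1, by rw [one_add_one_eq_two, hτ]; exact hz.2.2⟩
      have a3 : Real.log (condCell (empThreshold (V x.1 x.2) (T (level C T (V x.1 x.2 n))))
          (empThreshold (V x.1 x.2) (T (level C T (V x.1 x.2 n) + 1))) (r x) (U x.1 x.2 n)) ≤
          Real.log κ := by
        refine Real.log_le_log (condCell_pos hlt hx3 _) ?_
        rw [hlev, hT.1, empThreshold_bot, condCell, condCdf_bot, sub_zero]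
        exact (hx2 _ hU).le
      rw [Set.indicator_of_mem hz, Pi.one_apply, one_mul]
      linarith
    · rw [Set.indicator_of_notMem hz, zero_mul]
      linarith

/-- In the interior the gap is the integrated squared distance of the conditional distribution
functions at `T 2`, which is finite because there are two levels; at the boundary the gap is one. -/
theorem PairLLN.separates_logLikCD (hl : ∀ᶠ x in l, 1 ≤ x.1) (hρ₀ : |ρ₀| < 1)
    (h : PairLLN l U V ρ₀) (hT : IsThresholds C T) (hC : 2 ≤ C) :
    Separates l (fun x => logLikCD (U x.1 x.2) (fun n => discretize C T (V x.1 x.2 n))) ρ₀ := by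
  intro u hu r ρ hr1 hr
  have hC1 : 1 ≤ C := by omega
  have hτ : ∃ τ : ℝ, T 2 = τ := by
    have h1 : T 2 ≠ ⊥ := by
      rw [← hT.1]
      exact (hT.lt le_rfl (by omega) (by omega)).ne'
    have h2 : T 2 ≠ ⊤ := by
      rw [← hT.2.1]
      exact (hT.lt (by omega) (by omega) le_rfl).ne
    exact ⟨(T 2).toReal, (EReal.coe_toReal h2 h1).symm⟩
  obtain ⟨τ, hτ⟩ := hτ
  have hρ : |ρ| ≤ 1 := le_of_tendsto hr.abs (hr1.mono fun x hx => hx.le)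
  rcases hρ.lt_or_eq with hρ | hρ
  · refine ⟨_, ?_, fun hne => ?_, fun η hη =>
      (h.mono hu).eventually_logLikCD_le (hl.filter_mono hu) hρ₀ hT hC1 hr hρ hη⟩
    · exact integral_nonneg fun y => by positivity
    · rw [hτ]
      rcases lt_or_gt_of_ne hne with hlt | hgt
      · have := integral_sq_condCdf_sub_pos hρ hρ₀ hlt τ
        simpa only [sub_sq_comm (condCdf _ ρ₀ _)] using this
      · exact integral_sq_condCdf_sub_pos hρ₀ hρ hgt τ
  · exact ⟨1, zero_le_one, fun _ => zero_lt_one, fun η hη =>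
      (h.mono hu).eventually_logLikCD_le_of_abs_eq_one (hl.filter_mono hu) hρ₀ hT hC1 hτ hr1 hr
        hρ hη⟩

end PolyserialSeparates

/-! ### Consistency of the maximum pairwise likelihood estimate -/

section PairwiseMLE

/-- The negative sum of criteria for the entries above the diagonal. -/
def pairwiseLoss {m : ℕ} {α : Type*} (ℓ : Fin m → Fin m → α → ℝ → ℝ) (x : α)
    (R : Matrix (Fin m) (Fin m) ℝ) : ℝ :=
  -∑ i, ∑ j ∈ Finset.Ioi i, ℓ i j x (R i j)

theorem IsPseudoCorrelation.symm {m : ℕ} {R : Matrix (Fin m) (Fin m) ℝ}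
    (h : IsPseudoCorrelation R) (i j : Fin m) : R i j = R j i := by
  simpa using h.1.isHermitian.apply j i

/-- Along the ultrafilter the bounded entries have limits, and each pair falls short of the truth by
its own gap. These deficits cannot compensate each other, so a matrix that does at least as well as
`S` has no gap at all. Only the comparison with `S` is used, not minimality. -/
theorem tendsto_of_separates {m : ℕ} {α : Type*} {ℓ : Fin m → Fin m → α → ℝ → ℝ}
    {S : Matrix (Fin m) (Fin m) ℝ} (hS : IsPseudoCorrelation S) {u : Ultrafilter α}
    (hsep : ∀ i j, i < j → Separates (u : Filter α) (ℓ i j) (S i j))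
    {R : α → Matrix (Fin m) (Fin m) ℝ}
    (hR : ∀ᶠ x in (u : Filter α), IsPseudoCorrelation (R x) ∧
      pairwiseLoss ℓ x (R x) ≤ pairwiseLoss ℓ x S) (i j : Fin m) :
    Tendsto (fun x => R x i j) u (𝓝 (S i j)) := by
  have hlt : ∀ i j, i < j → ∀ᶠ x in (u : Filter α), |R x i j| < 1 := fun i j hij =>
    hR.mono fun x hx => hx.1.2.2 i j hij.ne
  have hlim : ∀ i j, i < j → ∃ ρ d : ℝ, Tendsto (fun x => R x i j) u (𝓝 ρ) ∧ 0 ≤ d ∧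
      (ρ ≠ S i j → 0 < d) ∧
      ∀ η > 0, ∀ᶠ x in (u : Filter α), ℓ i j x (R x i j) ≤ ℓ i j x (S i j) - d + η := by
    intro i j hij
    obtain ⟨ρ, -, hρ⟩ := exists_tendsto_of_eventually_abs_le u
      ((hlt i j hij).mono fun x hx => hx.le)
    obtain ⟨d, hd⟩ := hsep i j hij u le_rfl _ ρ (hlt i j hij) hρ
    exact ⟨ρ, d, hρ, hd⟩
  choose! ρ d hρ hd0 hdpos hd using hlim
  have hupper : ∀ i j, i < j → Tendsto (fun x => R x i j) u (𝓝 (S i j)) := by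
    intro i₀ j₀ h₀
    by_cases hne : ρ i₀ j₀ = S i₀ j₀
    · rw [← hne]
      exact hρ i₀ j₀ h₀
    exfalso
    have hpos := hdpos i₀ j₀ h₀ hne
    set G : Finset (Σ _ : Fin m, Fin m) := Finset.univ.sigma fun i => Finset.Ioi i with hG
    have hmem : ∀ p ∈ G, p.1 < p.2 := by
      intro p hp
      simpa [hG] using hp
    -- The accumulated error `G.card * η` stays below the gap of the pair `(i₀, j₀)`.
    set η := d i₀ j₀ / (2 * (G.card + 1)) with hη
    have hη0 : 0 < η := by positivity
    have hev : ∀ᶠ x in (u : Filter α), ∀ p ∈ G,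
        ℓ p.1 p.2 x (R x p.1 p.2) ≤ ℓ p.1 p.2 x (S p.1 p.2) - d p.1 p.2 + η :=
      (Finset.eventually_all _).2 fun p hp => hd _ _ (hmem p hp) η hη0
    obtain ⟨x, hx1, hx2⟩ := (hR.and hev).exists
    have h1 := hx1.2
    rw [pairwiseLoss, pairwiseLoss, neg_le_neg_iff, Finset.sum_sigma', Finset.sum_sigma'] at h1
    have h2 := Finset.sum_le_sum hx2
    rw [Finset.sum_add_distrib, Finset.sum_sub_distrib, Finset.sum_const, nsmul_eq_mul] at h2
    have h3 : d i₀ j₀ ≤ ∑ p ∈ G, d p.1 p.2 :=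
      Finset.single_le_sum (f := fun p : (Σ _ : Fin m, Fin m) => d p.1 p.2)
        (fun p hp => hd0 _ _ (hmem p hp)) (a := ⟨i₀, j₀⟩) (by simpa [hG] using h₀)
    have h4 : (G.card : ℝ) * η < d i₀ j₀ := by
      rw [hη, mul_div_assoc', div_lt_iff₀ (by positivity)]
      nlinarith [(Nat.cast_nonneg G.card : (0 : ℝ) ≤ G.card)]
    linarith
  rcases lt_trichotomy i j with h | h | h
  · exact hupper i j h
  · subst h
    rw [hS.2.1]
    exact tendsto_const_nhds.congr' (hR.mono fun x hx => (hx.1.2.1 i).symm)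
  · rw [hS.symm i j]
    exact (hupper j i h).congr' (hR.mono fun x hx => hx.1.symm j i)

theorem isClosed_setOf_posSemidef (m : ℕ) :
    IsClosed {R : Matrix (Fin m) (Fin m) ℝ | R.PosSemidef} := by
  simp only [posSemidef_iff_dotProduct_mulVec, Set.ofPred_and, Set.ofPred_forall]
  refine IsClosed.inter ?_ (isClosed_iInter fun v => ?_)
  · exact isClosed_eq (continuous_id.matrix_conjTranspose) continuous_id
  · exact isClosed_le continuous_const
      (continuous_const.dotProduct (continuous_id.matrix_mulVec continuous_const))

theorem isCompact_pseudoCorrelation_abs_le (m : ℕ) (c : ℝ) :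
    IsCompact {R : Matrix (Fin m) (Fin m) ℝ |
      R.PosSemidef ∧ (∀ i, R i i = 1) ∧ ∀ i j, i ≠ j → |R i j| ≤ c} := by
  have hcl : IsClosed {R : Matrix (Fin m) (Fin m) ℝ |
      R.PosSemidef ∧ (∀ i, R i i = 1) ∧ ∀ i j, i ≠ j → |R i j| ≤ c} := by
    simp only [Set.ofPred_and, Set.ofPred_forall]
    refine (isClosed_setOf_posSemidef m).inter (IsClosed.inter ?_ ?_)
    · exact isClosed_iInter fun i => isClosed_eq (continuous_id.matrix_elem i i) continuous_const
    · exact isClosed_iInter fun i => isClosed_iInter fun j => isClosed_iInter fun _ =>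
        isClosed_le (continuous_id.matrix_elem i j).abs continuous_const
  have hK : IsCompact (Set.univ.pi fun _ : Fin m => Set.univ.pi fun _ : Fin m =>
      Set.Icc (-(|c| + 1)) (|c| + 1)) :=
    isCompact_univ_pi fun _ => isCompact_univ_pi fun _ => isCompact_Icc
  refine hK.of_isClosed_subset hcl fun R hR i _ j _ => ?_
  refine abs_le.1 ?_
  by_cases hij : i = j
  · subst hij
    rw [hR.2.1 i, abs_one]
    linarith [abs_nonneg c]
  · linarith [hR.2.2 i j hij, le_abs_self c]

/-- The admissible set is not closed, so the loss is minimized over the compact part with entries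
bounded by some `c < 1` that exceeds the entries of `S`. If this minimizer were beaten, the better
competitor would have an entry beyond `c` and would also beat `S`; but along an ultrafilter such
competitors converge to `S`. -/
theorem eventually_exists_minimizer {m : ℕ} {α : Type*} {l : Filter α}
    {ℓ : Fin m → Fin m → α → ℝ → ℝ} {S : Matrix (Fin m) (Fin m) ℝ} (hS : IsPseudoCorrelation S)
    (hsep : ∀ i j, i < j → Separates l (ℓ i j) (S i j))
    (hcont : ∀ i j, i < j → ∀ x, ContinuousOn (ℓ i j x) (Set.Ioo (-1) 1)) :
    ∀ᶠ x in l, ∃ R, IsPseudoCorrelation R ∧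
      ∀ R', IsPseudoCorrelation R' → pairwiseLoss ℓ x R ≤ pairwiseLoss ℓ x R' := by
  refine eventually_of_forall_ultrafilter fun u hu hnot => ?_
  obtain ⟨c, hc1, hc⟩ : ∃ c : ℝ, c < 1 ∧ ∀ i j, i ≠ j → |S i j| < c := by
    have h1 : ∀ᶠ c in 𝓝[<] (1 : ℝ), ∀ i j, i ≠ j → |S i j| < c := by
      refine eventually_all.2 fun i => eventually_all.2 fun j => ?_
      by_cases hij : i = j
      · exact Eventually.of_forall fun c h => absurd hij h
      · exact (eventually_nhdsWithin_of_eventually_nhds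
          (lt_mem_nhds (hS.2.2 i j hij))).mono fun c hc _ => hc
    obtain ⟨c, h2, h3⟩ := (h1.and self_mem_nhdsWithin).exists
    exact ⟨c, h3, h2⟩
  have hR' : ∀ᶠ x in (u : Filter α), ∃ R', (IsPseudoCorrelation R' ∧
      pairwiseLoss ℓ x R' ≤ pairwiseLoss ℓ x S) ∧ ∃ i j, i ≠ j ∧ c < |R' i j| := by
    filter_upwards [hnot] with x hx
    have hcx : ContinuousOn (pairwiseLoss ℓ x) {R : Matrix (Fin m) (Fin m) ℝ |
        R.PosSemidef ∧ (∀ i, R i i = 1) ∧ ∀ i j, i ≠ j → |R i j| ≤ c} := by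
      refine ContinuousOn.neg (continuousOn_finsetSum _ fun i _ =>
        continuousOn_finsetSum _ fun j hj => ?_)
      have hij : i < j := Finset.mem_Ioi.1 hj
      refine (hcont i j hij x).comp (continuous_id.matrix_elem i j).continuousOn fun R hR => ?_
      exact abs_lt.1 ((hR.2.2 i j hij.ne).trans_lt hc1)
    obtain ⟨R₀, hR₀, hmin⟩ := (isCompact_pseudoCorrelation_abs_le m c).exists_isMinOn
      ⟨S, hS.1, hS.2.1, fun i j hij => (hc i j hij).le⟩ hcx
    have hR₀' : IsPseudoCorrelation R₀ :=
      ⟨hR₀.1, hR₀.2.1, fun i j hij => (hR₀.2.2 i j hij).trans_lt hc1⟩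
    push Not at hx
    obtain ⟨R', h1, h2⟩ := hx R₀ hR₀'
    refine ⟨R', ⟨h1, h2.le.trans (hmin ⟨hS.1, hS.2.1, fun i j hij => (hc i j hij).le⟩)⟩, ?_⟩
    by_contra hcon
    push Not at hcon
    exact absurd (hmin ⟨h1.1, h1.2.1, hcon⟩) (not_le.2 h2)
  -- One competitor is selected for every `(N, ω)`, so that the convergence result applies to the
  -- family.
  obtain ⟨R', hR'⟩ := hR'.choice
  have hlim := tendsto_of_separates hS (fun i j hij v hv => hsep i j hij v (hv.trans hu))
    (hR'.mono fun x hx => hx.1)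
  have hsmall : ∀ᶠ x in (u : Filter α), ∀ i j, i ≠ j → |R' x i j| < c := by
    refine eventually_all.2 fun i => eventually_all.2 fun j => ?_
    by_cases hij : i = j
    · exact Eventually.of_forall fun c h => absurd hij h
    · exact ((hlim i j).abs.eventually (gt_mem_nhds (hc i j hij))).mono fun x hx _ => hx
  obtain ⟨x, ⟨-, i, j, hij, h1⟩, h2⟩ := (hR'.and hsmall).exists
  exact lt_asymm h1 (h2 i j hij)

variable {Ω : Type*} [MeasurableSpace Ω] {l : Filter (ℕ × Ω)}

/-- A column of data, discretized if `d`. -/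
def observeCol (d : Bool) (C : ℕ) (T : ℕ → EReal) {N : ℕ} (u : Fin N → ℝ) : Fin N → ℝ :=
  fun n => if d then discretize C T (u n) else u n

theorem separates_pairLogLik (hl : ∀ᶠ x in l, 1 ≤ x.1) {U V : (N : ℕ) → Ω → Fin N → ℝ} {ρ : ℝ}
    (hρ : |ρ| < 1) (hUV : PairLLN l U V ρ) (hVU : PairLLN l V U ρ) {du dv : Bool} {Cu Cv : ℕ}
    {Tu Tv : ℕ → EReal} (hu : du = true → 2 ≤ Cu ∧ IsThresholds Cu Tu)
    (hv : dv = true → 2 ≤ Cv ∧ IsThresholds Cv Tv) :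
    Separates l (fun x => pairLogLik du dv (observeCol du Cu Tu (U x.1 x.2))
      (observeCol dv Cv Tv (V x.1 x.2))) ρ := by
  cases du <;> cases dv
  · exact hUV.separates_logLikCC hl hρ
  · obtain ⟨hC, hT⟩ := hv rfl
    exact hUV.separates_logLikCD hl hρ hT hC
  · obtain ⟨hC, hT⟩ := hu rfl
    exact hVU.separates_logLikCD hl hρ hT hC
  · obtain ⟨hC, hT⟩ := hu rfl
    obtain ⟨hC', hT'⟩ := hv rfl
    exact hUV.separates_logLikDD hl hρ hT hT' hC hC'

theorem continuousOn_pairLogLik {N : ℕ} (U V : Fin N → ℝ) {du dv : Bool} {Cu Cv : ℕ}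
    {Tu Tv : ℕ → EReal} (hu : du = true → 2 ≤ Cu ∧ IsThresholds Cu Tu)
    (hv : dv = true → 2 ≤ Cv ∧ IsThresholds Cv Tv) :
    ContinuousOn (pairLogLik du dv (observeCol du Cu Tu U) (observeCol dv Cv Tv V))
      (Set.Ioo (-1) 1) := by
  cases du <;> cases dv
  · exact continuousOn_logLikCC U V
  · obtain ⟨hC, hT⟩ := hv rfl
    exact continuousOn_logLikCD hT (by omega) U V
  · obtain ⟨hC, hT⟩ := hu rfl
    exact continuousOn_logLikCD hT (by omega) V U
  · obtain ⟨hC, hT⟩ := hu rfl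
    obtain ⟨hC', hT'⟩ := hv rfl
    exact continuousOn_logLikDD hT hT' (by omega) (by omega) U V

variable {m : ℕ} {disc : Fin m → Bool} {C : Fin m → ℕ} {T : Fin m → ℕ → EReal}
  {D : (N : ℕ) → Ω → Matrix (Fin N) (Fin m) ℝ} {S : Matrix (Fin m) (Fin m) ℝ}

theorem separates_pairLogLik_observe
    (hC : ∀ j, disc j = true → 2 ≤ C j ∧ IsThresholds (C j) (T j))
    (hS : IsPseudoCorrelation S) (hl : ∀ᶠ x in l, 1 ≤ x.1)
    (hD : ∀ i j, i ≠ j → PairLLN l (fun N ω n => D N ω n i) (fun N ω n => D N ω n j) (S i j))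
    (i j : Fin m) (hij : i < j) :
    Separates l (fun x => pairLogLik (disc i) (disc j)
      (fun n => observe disc C T (D x.1 x.2) n i) (fun n => observe disc C T (D x.1 x.2) n j))
      (S i j) := by
  have hji : PairLLN l (fun N ω n => D N ω n j) (fun N ω n => D N ω n i) (S i j) := by
    rw [hS.symm]
    exact hD j i hij.ne'
  exact separates_pairLogLik hl (hS.2.2 i j hij.ne) (hD i j hij.ne) hji (hC i) (hC j)

theorem eventually_exists_isPairwiseMLE (hC : ∀ j, disc j = true → 2 ≤ C j ∧ IsThresholds (C j) (T j))
    (hS : IsPseudoCorrelation S) (hl : ∀ᶠ x in l, 1 ≤ x.1)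
    (hD : ∀ i j, i ≠ j → PairLLN l (fun N ω n => D N ω n i) (fun N ω n => D N ω n j) (S i j)) :
    ∀ᶠ x in l, ∃ R, IsPairwiseMLE disc (observe disc C T (D x.1 x.2)) R := by
  have hcont : ∀ i j, i < j → ∀ x : ℕ × Ω, ContinuousOn (pairLogLik (disc i) (disc j)
      (fun n => observe disc C T (D x.1 x.2) n i) (fun n => observe disc C T (D x.1 x.2) n j))
      (Set.Ioo (-1) 1) := fun i j hij x => continuousOn_pairLogLik _ _ (hC i) (hC j)
  exact eventually_exists_minimizer hS (separates_pairLogLik_observe hC hS hl hD) hcont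

theorem tendsto_of_isPairwiseMLE (hC : ∀ j, disc j = true → 2 ≤ C j ∧ IsThresholds (C j) (T j))
    (hS : IsPseudoCorrelation S) (hl : ∀ᶠ x in l, 1 ≤ x.1)
    (hD : ∀ i j, i ≠ j → PairLLN l (fun N ω n => D N ω n i) (fun N ω n => D N ω n j) (S i j))
    {R : ℕ → Ω → Matrix (Fin m) (Fin m) ℝ}
    (hR : ∀ᶠ x in l, IsPairwiseMLE disc (observe disc C T (D x.1 x.2)) (R x.1 x.2)) (i j : Fin m) :
    Tendsto (fun x : ℕ × Ω => R x.1 x.2 i j) l (𝓝 (S i j)) := by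
  rw [tendsto_iff_ultrafilter]
  intro u hu
  exact tendsto_of_separates hS (fun i j hij => separates_pairLogLik_observe hC hS
    (hl.filter_mono hu) (fun i j hij => (hD i j hij).mono hu) i j hij)
    (R := fun x => R x.1 x.2) ((hR.filter_mono hu).mono fun x hx => ⟨hx.1, hx.2 S hS⟩) i j

end PairwiseMLE

/-! ### The estimates from the sample and from the permuted sample -/

section Sample

variable {Ω : Type*} [MeasurableSpace Ω] {μ : Measure Ω} [IsProbabilityMeasure μ] {M P Q : ℕ}
  {Z : ℕ → Ω → Fin M → ℝ} {X : Fin P → Fin M} {Y : Fin Q → Fin M}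

theorem IsGaussianSample.posSemidef_popCov (h : IsGaussianSample μ Z) :
    (popCov μ (Z 0)).PosSemidef := by
  rw [posSemidef_iff_dotProduct_mulVec]
  refine ⟨?_, fun v => ?_⟩
  · ext i j
    exact covariance_comm _ _
  · have hL : ∀ i, MemLp (fun ω => v i * Z 0 ω i) 2 μ := fun i =>
      (h.memLp_eval 0 i 2 (by simp)).const_mul (v i)
    have h1 : star v ⬝ᵥ popCov μ (Z 0) *ᵥ v = variance (fun ω => ∑ i, v i * Z 0 ω i) μ := by
      rw [variance_fun_sum hL]
      simp only [dotProduct, mulVec, popCov, of_apply, Finset.mul_sum, covariance_const_mul_left,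
        covariance_const_mul_right]
      refine Finset.sum_congr rfl fun i _ => Finset.sum_congr rfl fun j _ => ?_
      simp only [star_trivial, Pi.star_apply]
      ring
    rw [h1]
    exact variance_nonneg _ _

theorem IsGaussianSample.isPseudoCorrelation_popCov (h : IsGaussianSample μ Z)
    (hcorr : ∀ i j, i ≠ j → |popCov μ (Z 0) i j| < 1) : IsPseudoCorrelation (popCov μ (Z 0)) :=
  ⟨h.posSemidef_popCov, h.var, hcorr⟩

/-- The correlation matrix of `X` and an independent copy of `Y`. -/
def blockCov (S : Matrix (Fin M) (Fin M) ℝ) (X : Fin P → Fin M) (Y : Fin Q → Fin M) :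
    Matrix (Fin (P + Q)) (Fin (P + Q)) ℝ :=
  (fromBlocks (S.submatrix X X) 0 0 (S.submatrix Y Y)).submatrix finSumFinEquiv.symm
    finSumFinEquiv.symm

@[simp]
theorem blockCov_castAdd_castAdd (S : Matrix (Fin M) (Fin M) ℝ) (i j : Fin P) :
    blockCov S X Y (Fin.castAdd Q i) (Fin.castAdd Q j) = S (X i) (X j) := by
  simp [blockCov]

@[simp]
theorem blockCov_castAdd_natAdd (S : Matrix (Fin M) (Fin M) ℝ) (i : Fin P) (j : Fin Q) :
    blockCov S X Y (Fin.castAdd Q i) (Fin.natAdd P j) = 0 := by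
  simp [blockCov]

@[simp]
theorem blockCov_natAdd_castAdd (S : Matrix (Fin M) (Fin M) ℝ) (i : Fin Q) (j : Fin P) :
    blockCov S X Y (Fin.natAdd P i) (Fin.castAdd Q j) = 0 := by
  simp [blockCov]

@[simp]
theorem blockCov_natAdd_natAdd (S : Matrix (Fin M) (Fin M) ℝ) (i j : Fin Q) :
    blockCov S X Y (Fin.natAdd P i) (Fin.natAdd P j) = S (Y i) (Y j) := by
  simp [blockCov]

/-- The off-diagonal blocks vanish, so the Schur complement of the `X` block is the `Y` block
itself. -/
theorem posSemidef_blockCov {S : Matrix (Fin M) (Fin M) ℝ} (hX : (S.submatrix X X).PosDef)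
    (hY : (S.submatrix Y Y).PosSemidef) : (blockCov S X Y).PosSemidef := by
  refine PosSemidef.submatrix ?_ _
  have := hX.isUnit.invertible
  have h := PosDef.fromBlocks₁₁ (A := S.submatrix X X) (0 : Matrix (Fin P) (Fin Q) ℝ)
    (S.submatrix Y Y) hX
  rw [conjTranspose_zero] at h
  rw [h]
  simpa using hY

/-- An admissible limit even if `X` and `Y` share variables: the two copies of a shared variable
have correlation zero here. Injectivity excludes a repetition within a block. -/
theorem isPseudoCorrelation_blockCov {S : Matrix (Fin M) (Fin M) ℝ} (hS : ∀ i, S i i = 1)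
    (hcorr : ∀ i j, i ≠ j → |S i j| < 1) (hXi : Function.Injective X)
    (hYi : Function.Injective Y) (hX : (S.submatrix X X).PosDef)
    (hY : (S.submatrix Y Y).PosSemidef) : IsPseudoCorrelation (blockCov S X Y) := by
  refine ⟨posSemidef_blockCov hX hY, fun i => ?_, fun i j => ?_⟩
  · refine Fin.addCases (fun i => ?_) (fun i => ?_) i <;> simp [hS]
  · refine Fin.addCases (fun i => ?_) (fun i => ?_) i <;>
    refine Fin.addCases (fun j => ?_) (fun j => ?_) j <;> intro hij
    · rw [blockCov_castAdd_castAdd]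
      exact hcorr _ _ fun e => hij (congrArg _ (hXi e))
    · simp
    · simp
    · rw [blockCov_natAdd_natAdd]
      exact hcorr _ _ fun e => hij (congrArg _ (hYi e))

theorem transpose_permMatrix_mul_apply {N p : ℕ} (τ : Equiv.Perm (Fin N))
    (D : Matrix (Fin N) (Fin p) ℝ) (n : Fin N) (j : Fin p) :
    ((τ.permMatrix ℝ)ᵀ * D) n j = D (τ⁻¹ n) j := by
  rw [mul_apply, Finset.sum_eq_single (τ⁻¹ n)]
  · simp [Equiv.Perm.permMatrix, PEquiv.toMatrix_apply]
  · intro m _ hm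
    have : ¬ τ m = n := fun e => hm (by rw [← e]; simp)
    simp [Equiv.Perm.permMatrix, PEquiv.toMatrix_apply, this]
  · simp

theorem permData_castAdd {N : ℕ} (τ : Equiv.Perm (Fin N)) (D : Matrix (Fin N) (Fin M) ℝ)
    (n : Fin N) (i : Fin P) : permData X Y τ D n (Fin.castAdd Q i) = D n (X i) := by
  simp [permData, sideBySide, cols]

theorem permData_natAdd {N : ℕ} (τ : Equiv.Perm (Fin N)) (D : Matrix (Fin N) (Fin M) ℝ)
    (n : Fin N) (j : Fin Q) : permData X Y τ D n (Fin.natAdd P j) = D (τ⁻¹ n) (Y j) := by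
  simp only [permData, sideBySide, of_apply, Fin.append_right, transpose_permMatrix_mul_apply]
  rfl

/-- Discretization acts on each entry according to its column and so commutes with permuting rows.
The permuted accessible data are thus the accessible version of permuted latent data, and the
consistency result applies to them. -/
theorem permData_observe {N : ℕ} (τ : Equiv.Perm (Fin N)) (disc : Fin M → Bool) (C : Fin M → ℕ)
    (T : Fin M → ℕ → EReal) (D : Matrix (Fin N) (Fin M) ℝ) :
    permData X Y τ (observe disc C T D) = observe (Fin.append (disc ∘ X) (disc ∘ Y))
      (Fin.append (C ∘ X) (C ∘ Y)) (Fin.append (T ∘ X) (T ∘ Y)) (permData X Y τ D) := by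
  ext n i
  refine Fin.addCases (fun i => ?_) (fun i => ?_) i
  · simp [observe, permData_castAdd]
  · simp [observe, permData_natAdd]

theorem PairLLN.comp_perm {l : Filter (ℕ × Ω)} {U V : (N : ℕ) → Ω → Fin N → ℝ} {ρ : ℝ}
    (h : PairLLN l U V ρ) (τ : (N : ℕ) → Ω → Equiv.Perm (Fin N)) :
    PairLLN l (fun N ω n => U N ω (τ N ω n)) (fun N ω n => V N ω (τ N ω n)) ρ := by
  intro f hf hc
  refine (h f hf hc).congr fun x => ?_
  rw [Equiv.sum_comp (τ x.1 x.2) fun n => f (U x.1 x.2 n, V x.1 x.2 n)]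

/-- Pairs within `X` are untouched, pairs within `Y` are permuted jointly, which does not change
averages, and mixed pairs are those of the law of large numbers for permuted columns. -/
theorem IsGaussianSample.pairLLN_permData (h : IsGaussianSample μ Z)
    (hcorr : ∀ i j, i ≠ j → |popCov μ (Z 0) i j| < 1) (hXi : Function.Injective X)
    (hYi : Function.Injective Y) {σ : (N : ℕ) → Ω → Equiv.Perm (Fin N)}
    (hσ : ∀ N, IsUniformIndepPerm μ (σ N) (fun ω (n : Fin N) => Z n ω)) (i j : Fin (P + Q))
    (hij : i ≠ j) :
    PairLLN (probFilter μ) (fun N ω n => permData X Y (σ N ω) (dataMatrix Z N ω) n i)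
      (fun N ω n => permData X Y (σ N ω) (dataMatrix Z N ω) n j)
      (blockCov (popCov μ (Z 0)) X Y i j) := by
  revert hij
  refine Fin.addCases (fun i => ?_) (fun i => ?_) i <;>
    refine Fin.addCases (fun j => ?_) (fun j => ?_) j <;> intro hij <;>
    simp only [permData_castAdd, permData_natAdd, blockCov_castAdd_castAdd,
      blockCov_castAdd_natAdd, blockCov_natAdd_castAdd, blockCov_natAdd_natAdd, dataMatrix,
      of_apply]
  · exact h.pairLLN (hcorr _ _ fun e => hij (congrArg _ (hXi e)))
  · exact h.pairLLN_perm (X i) (Y j) hσ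
  · exact (h.pairLLN_perm (X j) (Y i) hσ).swap_zero
  · exact (h.pairLLN (hcorr _ _ fun e => hij (congrArg _ (hYi e)))).comp_perm
      fun N ω => (σ N ω)⁻¹

theorem tendsto_div_sub_one_probFilter (μ : Measure Ω) :
    Tendsto (fun x : ℕ × Ω => (x.1 : ℝ) / ((x.1 : ℝ) - 1)) (probFilter μ) (𝓝 1) := by
  have h : Tendsto (fun x : ℝ => 1 + 1 / (x - 1)) atTop (𝓝 (1 + 0)) := by
    refine tendsto_const_nhds.add ?_
    simp only [one_div]
    exact tendsto_inv_atTop_zero.comp (tendsto_atTop_add_const_right _ (-1) tendsto_id)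
  rw [add_zero] at h
  refine ((h.comp tendsto_natCast_atTop_atTop).comp (tendsto_fst_probFilter μ)).congr' ?_
  filter_upwards [eventually_fst_ge_probFilter μ 2] with x hx
  have h2 : (2 : ℝ) ≤ x.1 := by exact_mod_cast hx
  have : (x.1 : ℝ) - 1 ≠ 0 := by linarith
  simp only [Function.comp]
  field_simp
  ring

theorem PairLLN.tendsto_inv_sub_one_mul_sum {U V : (N : ℕ) → Ω → Fin N → ℝ} {ρ : ℝ}
    (h : PairLLN (probFilter μ) U V ρ) {f : ℝ × ℝ → ℝ} (hf : Measurable f)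
    (hc : ∃ c, ∀ z, |f z| ≤ c * (1 + z.1 ^ 2 + z.2 ^ 2)) :
    Tendsto (fun x : ℕ × Ω => ((x.1 : ℝ) - 1)⁻¹ * ∑ n, f (U x.1 x.2 n, V x.1 x.2 n))
      (probFilter μ) (𝓝 (∫ z, f z ∂bivariateGaussian ρ)) := by
  have h1 := (tendsto_div_sub_one_probFilter μ).mul (h f hf hc)
  rw [one_mul] at h1
  refine h1.congr' ?_
  filter_upwards [eventually_fst_ge_probFilter μ 1] with x hx
  have h2 : (x.1 : ℝ) ≠ 0 := by
    have : 0 < x.1 := hx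
    positivity
  rw [← mul_assoc]
  congr 1
  field_simp

theorem abs_mul_le_quadratic (z : ℝ × ℝ) : |z.1 * z.2| ≤ 1 * (1 + z.1 ^ 2 + z.2 ^ 2) := by
  rw [abs_le]
  constructor <;> nlinarith [sq_nonneg (z.1 + z.2), sq_nonneg (z.1 - z.2)]

theorem IsGaussianSample.tendsto_permCrossProduct (h : IsGaussianSample μ Z)
    {σ : (N : ℕ) → Ω → Equiv.Perm (Fin N)}
    (hσ : ∀ N, IsUniformIndepPerm μ (σ N) (fun ω (n : Fin N) => Z n ω)) (i : Fin P) (j : Fin Q) :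
    Tendsto (fun x : ℕ × Ω => permCrossProduct X Y (σ x.1 x.2) (dataMatrix Z x.1 x.2) i j)
      (probFilter μ) (𝓝 0) := by
  have h1 := (h.pairLLN_perm (X i) (Y j) hσ).tendsto_inv_sub_one_mul_sum
    (f := fun z => z.1 * z.2) (by fun_prop) ⟨1, abs_mul_le_quadratic⟩
  rw [integral_mul_bivariateGaussian] at h1
  refine h1.congr fun x => ?_
  rw [permCrossProduct, Matrix.mul_assoc, Matrix.smul_apply, smul_eq_mul, mul_apply]
  simp only [transpose_permMatrix_mul_apply]
  rfl

theorem IsGaussianSample.tendsto_sampleCov (h : IsGaussianSample μ Z)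
    (hcorr : ∀ i j, i ≠ j → |popCov μ (Z 0) i j| < 1) (hXi : Function.Injective X)
    {σ : (N : ℕ) → Ω → Equiv.Perm (Fin N)}
    (hσ : ∀ N, IsUniformIndepPerm μ (σ N) (fun ω (n : Fin N) => Z n ω)) (i j : Fin P) :
    Tendsto (fun x : ℕ × Ω => sampleCov (cols X (dataMatrix Z x.1 x.2))
      (cols X (dataMatrix Z x.1 x.2)) i j) (probFilter μ) (𝓝 (popCov μ (Z 0) (X i) (X j))) := by
  have e : ∀ x : ℕ × Ω, ((x.1 : ℝ) - 1)⁻¹ * ∑ n : Fin x.1, Z n x.2 (X i) * Z n x.2 (X j) =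
      sampleCov (cols X (dataMatrix Z x.1 x.2)) (cols X (dataMatrix Z x.1 x.2)) i j := by
    intro x
    rw [sampleCov, Matrix.smul_apply, smul_eq_mul, mul_apply]
    rfl
  by_cases hij : i = j
  · subst hij
    -- A column paired with itself has correlation one, outside the reach of `pairLLN`. The function
    -- `z.1 ^ 2` ignores the second coordinate, so the pairing with a permuted column serves
    -- instead.
    have h1 := (h.pairLLN_perm (X i) (X i) hσ).tendsto_inv_sub_one_mul_sum
      (f := fun z => z.1 ^ 2) (by fun_prop) ⟨1, fun z => by
        rw [abs_of_nonneg (by positivity)]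
        nlinarith [sq_nonneg z.2]⟩
    rw [integral_fst_sq_bivariateGaussian] at h1
    rw [h.var]
    refine h1.congr fun x => ?_
    rw [← e x]
    simp only [sq]
  · have h1 := (h.pairLLN (hcorr _ _ fun e => hij (hXi e))).tendsto_inv_sub_one_mul_sum
      (f := fun z => z.1 * z.2) (by fun_prop) ⟨1, abs_mul_le_quadratic⟩
    rw [integral_mul_bivariateGaussian] at h1
    exact h1.congr e

end Sample

/-! ### Singular values -/

section SingularValues

variable {n : ℕ}

theorem orthogonal_mul_transpose {O : Matrix (Fin n) (Fin n) ℝ} (h : Oᵀ * O = 1) : O * Oᵀ = 1 :=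
  mul_eq_one_comm.1 h

theorem charpoly_toEuclideanLin (A : Matrix (Fin n) (Fin n) ℝ) :
    (toEuclideanLin A).charpoly = A.charpoly := by
  have h : toEuclideanLin A = toLin (PiLp.basisFun 2 ℝ (Fin n)) (PiLp.basisFun 2 ℝ (Fin n)) A := rfl
  rw [h, ← LinearMap.charpoly_toMatrix _ (PiLp.basisFun 2 ℝ (Fin n)),
    LinearMap.toMatrix_toLin]

theorem adjoint_comp_toEuclideanLin (W : Matrix (Fin n) (Fin n) ℝ) :
    LinearMap.adjoint (toEuclideanLin W) ∘ₗ toEuclideanLin W = toEuclideanLin (Wᵀ * W) := by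
  rw [← toEuclideanLin_conjTranspose_eq_adjoint, conjTranspose_eq_transpose_of_trivial]
  ext v i
  simp [toLpLin_apply, mulVec_mulVec]

/-- The singular values can be read off from any singular value decomposition. -/
theorem singVal_eq_of_svd {W O O' : Matrix (Fin n) (Fin n) ℝ} {r : Fin n → ℝ} (hO : Oᵀ * O = 1)
    (hO' : O'ᵀ * O' = 1) (hr : Antitone r) (hr0 : ∀ i, 0 ≤ r i)
    (hW : Oᵀ * W * O' = diagonal r) (i : Fin n) : singVal W i = r i := by
  have hW' : W = O * diagonal r * O'ᵀ := by
    rw [← hW]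
    have h1 := orthogonal_mul_transpose hO
    have h2 := orthogonal_mul_transpose hO'
    calc W = (O * Oᵀ) * W * (O' * O'ᵀ) := by rw [h1, h2, Matrix.one_mul, Matrix.mul_one]
      _ = _ := by simp only [Matrix.mul_assoc]
  have hWW : Wᵀ * W = O' * diagonal (fun i => r i ^ 2) * O'ᵀ := by
    have h3 : diagonal (fun i => r i ^ 2) = diagonal r * diagonal r := by
      rw [diagonal_mul_diagonal]
      simp only [sq]
    rw [hW', h3]
    simp only [transpose_mul, transpose_transpose, diagonal_transpose]
    calc O' * (diagonal r * Oᵀ) * (O * diagonal r * O'ᵀ)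
        = O' * diagonal r * (Oᵀ * O) * diagonal r * O'ᵀ := by simp only [Matrix.mul_assoc]
      _ = _ := by rw [hO, Matrix.mul_one]; simp only [Matrix.mul_assoc]
  have hchar : (Wᵀ * W).charpoly = (diagonal fun i => r i ^ 2).charpoly := by
    rw [hWW, charpoly_mul_comm, ← Matrix.mul_assoc, hO', Matrix.one_mul]
  have hn : Module.finrank ℝ (EuclideanSpace ℝ (Fin n)) = n := by simp
  set T := toEuclideanLin W with hT
  have hc : (LinearMap.adjoint T ∘ₗ T).charpoly =
      ((Finset.univ.val.map fun i => r i ^ 2).map fun a => Polynomial.X - Polynomial.C a).prod := by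
    rw [hT, adjoint_comp_toEuclideanLin, charpoly_toEuclideanLin, hchar, charpoly_diagonal,
      Multiset.map_map]
    rfl
  -- The squares `r i ^ 2` are the roots of the characteristic polynomial of `Wᵀ * W`. Being sorted
  -- already, they agree with the ordered eigenvalues index by index.
  have hsort := T.isSymmetric_adjoint_comp_self.sort_roots_charpoly_eq_eigenvalues hn
  rw [hc, Polynomial.roots_multiset_prod_X_sub_C, Multiset.map_map, Fin.univ_val_map,
    Multiset.coe_sort] at hsort
  have hsorted : (List.ofFn fun i => r i ^ 2).Pairwise (· ≥ ·) :=
    List.pairwise_ofFn.2 fun i j hij => pow_le_pow_left₀ (hr0 j) (hr hij.le) 2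
  have hof : List.ofFn (fun i => r i ^ 2) =
      List.ofFn (T.isSymmetric_adjoint_comp_self.eigenvalues hn) := by
    rw [← hsort]
    symm
    exact List.mergeSort_eq_self _ hsorted
  have heq := congrFun (List.ofFn_injective hof) i
  rw [singVal, T.singularValues_fin hn i, ← heq, Real.sqrt_sq (hr0 i)]

/-- The matrix with the vectors of an orthonormal basis as columns. -/
def basisMatrix (b : OrthonormalBasis (Fin n) ℝ (EuclideanSpace ℝ (Fin n))) :
    Matrix (Fin n) (Fin n) ℝ :=
  Matrix.of fun a i => b i a

theorem transpose_basisMatrix_mul (b : OrthonormalBasis (Fin n) ℝ (EuclideanSpace ℝ (Fin n))) :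
    (basisMatrix b)ᵀ * basisMatrix b = 1 := by
  ext i j
  have h := orthonormal_iff_ite.1 b.orthonormal i j
  rw [PiLp.inner_apply] at h
  rw [mul_apply, one_apply, ← h]
  exact Finset.sum_congr rfl fun a _ => by simp [basisMatrix, mul_comm]

/-- The right vectors are an eigenbasis of the adjoint composed with the map. Their images are
orthogonal, with the singular values as norms; the normalized nonzero images extend to an
orthonormal basis, which gives the left vectors. -/
theorem exists_svd (W : Matrix (Fin n) (Fin n) ℝ) :
    ∃ O O' : Matrix (Fin n) (Fin n) ℝ, Oᵀ * O = 1 ∧ O'ᵀ * O' = 1 ∧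
      Oᵀ * W * O' = diagonal fun i : Fin n => singVal W i := by
  have hn : Module.finrank ℝ (EuclideanSpace ℝ (Fin n)) = n := by simp
  set T := toEuclideanLin W with hT
  have hsym := T.isSymmetric_adjoint_comp_self
  set v := hsym.eigenvectorBasis hn with hv
  have hTT : ∀ j, LinearMap.adjoint T (T (v j)) = (singVal W j ^ 2) • v j := by
    intro j
    have h1 := hsym.apply_eigenvectorBasis hn j
    rw [← T.sq_singularValues_fin hn j] at h1
    exact h1
  have hinner : ∀ i j, inner ℝ (T (v i)) (T (v j)) = if i = j then singVal W j ^ 2 else 0 := by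
    intro i j
    rw [← LinearMap.adjoint_inner_right, hTT, inner_smul_right, orthonormal_iff_ite.1 v.orthonormal]
    simp
  have hon : Orthonormal ℝ (Set.domRestrict {i : Fin n | singVal W i ≠ 0}
      fun i => (singVal W i)⁻¹ • T (v i)) := by
    rw [orthonormal_iff_ite]
    rintro ⟨i, hi⟩ ⟨j, hj⟩
    have hi' : singVal W i ≠ 0 := hi
    simp only [Set.domRestrict_apply, inner_smul_left, inner_smul_right, hinner, Subtype.mk.injEq]
    split_ifs with h
    · subst h
      simp only [conj_trivial]
      field_simp
    · simp
  obtain ⟨b, hb⟩ := hon.exists_orthonormalBasis_extension_of_card_eq (by simp)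
  have hTv : ∀ j, T (v j) = singVal W j • b j := by
    intro j
    by_cases hj : singVal W j = 0
    · have h1 := hinner j j
      rw [if_pos rfl, hj, zero_pow two_ne_zero, inner_self_eq_zero] at h1
      rw [h1, hj, zero_smul]
    · rw [hb j hj, smul_smul, mul_inv_cancel₀ hj, one_smul]
  refine ⟨basisMatrix b, basisMatrix v, transpose_basisMatrix_mul b, transpose_basisMatrix_mul v, ?_⟩
  have h2 : W * basisMatrix v = basisMatrix b * diagonal fun i : Fin n => singVal W i := by
    ext a j
    rw [mul_diagonal, mul_apply]
    have h3 := congrArg (fun x : EuclideanSpace ℝ (Fin n) => x a) (hTv j)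
    simp only [hT, toLpLin_apply, PiLp.smul_apply, smul_eq_mul] at h3
    simp only [basisMatrix, of_apply]
    rw [mul_comm, ← h3]
    rfl
  rw [Matrix.mul_assoc, h2, ← Matrix.mul_assoc, transpose_basisMatrix_mul, Matrix.one_mul]

theorem abs_le_one_of_transpose_mul {m : ℕ} {O : Matrix (Fin m) (Fin n) ℝ} (h : Oᵀ * O = 1)
    (a : Fin m) (i : Fin n) : |O a i| ≤ 1 := by
  have h1 : ∑ b, O b i * O b i = 1 := by
    have := congrFun (congrFun h i) i
    rwa [mul_apply, one_apply_eq] at this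
  have h2 := Finset.single_le_sum (f := fun b => O b i * O b i)
    (fun b _ => mul_self_nonneg (O b i)) (Finset.mem_univ a)
  rw [← sq_le_one_iff_abs_le_one]
  have h3 : O a i * O a i ≤ 1 := h2.trans_eq h1
  rwa [sq]

/-- A singular value is a diagonal entry of `Oᵀ * W * O'`, and the entries of orthogonal matrices
are at most one in absolute value. This crude bound suffices for limits equal to zero. -/
theorem singVal_le_sum_abs (W : Matrix (Fin n) (Fin n) ℝ) (i : Fin n) :
    singVal W i ≤ ∑ b, ∑ a, |W a b| := by
  obtain ⟨O, O', hO, hO', h⟩ := exists_svd W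
  have h1 := congrFun (congrFun h i) i
  rw [diagonal_apply_eq, mul_apply] at h1
  rw [← h1]
  refine Finset.sum_le_sum fun b _ => ?_
  rw [mul_apply, Finset.sum_mul]
  refine Finset.sum_le_sum fun a _ => (le_abs_self _).trans ?_
  rw [abs_mul, abs_mul, transpose_apply]
  have h2 := abs_le_one_of_transpose_mul hO a i
  have h3 := abs_le_one_of_transpose_mul hO' b i
  have h4 := mul_le_mul_of_nonneg_right h2 (abs_nonneg (W a b))
  have h5 := mul_le_mul_of_nonneg_left h3 (mul_nonneg (abs_nonneg (O a i)) (abs_nonneg (W a b)))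
  linarith

theorem singVal_nonneg {p q : ℕ} (W : Matrix (Fin p) (Fin q) ℝ) (i : ℕ) : 0 ≤ singVal W i :=
  LinearMap.singularValues_nonneg _ i

/-- Von Neumann's trace inequality. -/
theorem trace_le_sum_of_svd {W O O' P P' : Matrix (Fin n) (Fin n) ℝ} {s : Fin n → ℝ}
    (hO : Oᵀ * O = 1) (hO' : O'ᵀ * O' = 1) (hs : ∀ i, 0 ≤ s i) (hW : Oᵀ * W * O' = diagonal s)
    (hP : Pᵀ * P = 1) (hP' : P'ᵀ * P' = 1) : (Pᵀ * W * P').trace ≤ ∑ i, s i := by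
  have hO2 := orthogonal_mul_transpose hO
  have hO2' := orthogonal_mul_transpose hO'
  have hP2 := orthogonal_mul_transpose hP
  have hP2' := orthogonal_mul_transpose hP'
  -- The trace equals the sum of `s i * E i i` with `E` orthogonal, so its diagonal entries are at
  -- most one.
  set E := O'ᵀ * P' * (Pᵀ * O) with hE
  have hEE : Eᵀ * E = 1 := by
    calc Eᵀ * E = Oᵀ * P * (P'ᵀ * (O' * O'ᵀ) * P') * (Pᵀ * O) := by
          rw [hE]
          simp only [transpose_mul, transpose_transpose, Matrix.mul_assoc]
      _ = Oᵀ * (P * Pᵀ) * O := by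
          rw [hO2', Matrix.mul_one, hP', Matrix.mul_one]
          simp only [Matrix.mul_assoc]
      _ = 1 := by rw [hP2, Matrix.mul_one, hO]
  have h1 : (Pᵀ * W * P').trace = (diagonal s * E).trace := by
    calc (Pᵀ * W * P').trace = (Pᵀ * ((O * Oᵀ) * W * (O' * O'ᵀ)) * P').trace := by
          rw [hO2, hO2', Matrix.one_mul, Matrix.mul_one]
      _ = ((Pᵀ * O) * (diagonal s * (O'ᵀ * P'))).trace := by
          rw [← hW]
          simp only [Matrix.mul_assoc]
      _ = _ := by
          rw [trace_mul_comm, hE]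
          simp only [Matrix.mul_assoc]
  rw [h1, trace]
  refine Finset.sum_le_sum fun i _ => ?_
  rw [diag_apply, diagonal_mul]
  have := (abs_le.1 (abs_le_one_of_transpose_mul hEE i i)).2
  nlinarith [hs i]

/-- The diagonal at an optimum of the trace over pairs of orthogonal matrices consists of the
singular values. -/
theorem isMax_trace_iff_singVal (W : Matrix (Fin n) (Fin n) ℝ) (s : Fin n → ℝ) :
    (Antitone s ∧ ∃ O O' : Matrix (Fin n) (Fin n) ℝ, (Oᵀ * O = 1 ∧ O'ᵀ * O' = 1) ∧
      (∀ P P' : Matrix (Fin n) (Fin n) ℝ, Pᵀ * P = 1 → P'ᵀ * P' = 1 →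
        (Pᵀ * W * P').trace ≤ (Oᵀ * W * O').trace) ∧ Oᵀ * W * O' = diagonal s) ↔
    ∀ i : Fin n, s i = singVal W i := by
  constructor
  · rintro ⟨hs, O, O', ⟨hO, hO'⟩, hmax, hW⟩ i
    refine (singVal_eq_of_svd hO hO' hs (fun j => ?_) hW i).symm
    by_contra hj
    rw [not_le] at hj
    -- Reversing the sign of column `j` of `O` preserves orthogonality and would raise the trace if
    -- `s j` were negative.
    set ε : Fin n → ℝ := Function.update 1 j (-1) with hε
    have hεε : diagonal ε * diagonal ε = 1 := by
      rw [diagonal_mul_diagonal, ← diagonal_one]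
      congr 1
      ext i
      by_cases hi : i = j
      · subst hi
        simp [hε]
      · simp [hε, hi]
    have h1 := hmax (O * diagonal ε) O' (by
      rw [transpose_mul, diagonal_transpose]
      calc diagonal ε * Oᵀ * (O * diagonal ε) = diagonal ε * (Oᵀ * O) * diagonal ε := by
            simp only [Matrix.mul_assoc]
        _ = 1 := by rw [hO, Matrix.mul_one, hεε]) hO'
    have h2 : (O * diagonal ε)ᵀ * W * O' = diagonal fun i => ε i * s i := by
      rw [transpose_mul, diagonal_transpose, ← diagonal_mul_diagonal, ← hW]
      simp only [Matrix.mul_assoc]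
    rw [h2, hW, trace_diagonal, trace_diagonal] at h1
    refine absurd h1 (not_le.2 (Finset.sum_lt_sum (fun i _ => ?_) ⟨j, Finset.mem_univ j, ?_⟩))
    · by_cases hi : i = j
      · subst hi
        simp only [hε, Function.update_self]
        linarith
      · simp [hε, hi]
    · simp only [hε, Function.update_self]
      linarith
  · intro hs
    obtain ⟨O, O', hO, hO', h⟩ := exists_svd W
    have hs' : s = fun i : Fin n => singVal W i := funext hs
    subst hs'
    refine ⟨fun i j hij => ?_, O, O', ⟨hO, hO'⟩, fun P P' hP hP' => ?_, h⟩
    · exact LinearMap.singularValues_antitone _ hij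
    · rw [h, trace_diagonal]
      exact trace_le_sum_of_svd hO hO' (fun i => singVal_nonneg W i) h hP hP'

end SingularValues

/-! ### Inverse square roots and the CCA scores -/

section InvSqrt

variable {n : ℕ}

theorem transpose_invSqrt (S : Matrix (Fin n) (Fin n) ℝ) : (invSqrt S)ᵀ = invSqrt S := by
  have h : IsSelfAdjoint (invSqrt S) := cfc_predicate _ _
  rw [← conjTranspose_eq_transpose_of_trivial]
  exact h

theorem spectrum_pos_of_posDef {S : Matrix (Fin n) (Fin n) ℝ} (hS : S.PosDef) {x : ℝ}
    (hx : x ∈ spectrum ℝ S) : 0 < x := by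
  rw [hS.1.spectrum_real_eq_range_eigenvalues] at hx
  obtain ⟨i, rfl⟩ := hx
  exact hS.eigenvalues_pos i

/-- The product is the functional calculus of `(√x)⁻¹ * x * (√x)⁻¹`, which is one on the positive
spectrum. Continuity is automatic, since the spectrum is finite. -/
theorem invSqrt_mul_mul_invSqrt {S : Matrix (Fin n) (Fin n) ℝ} (hS : S.PosDef) :
    invSqrt S * S * invSqrt S = 1 := by
  have hsa : IsSelfAdjoint S := hS.1
  have hc : ∀ f : ℝ → ℝ, ContinuousOn f (spectrum ℝ S) := fun f =>
    (finite_real_spectrum (A := S)).continuousOn f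
  have h1 : invSqrt S * S = cfc (fun x : ℝ => (√x)⁻¹ * x) S := by
    rw [cfc_mul (fun x : ℝ => (√x)⁻¹) (fun x => x) S (hc _) (hc _), cfc_id' ℝ S]
    rfl
  rw [h1, invSqrt, ← cfc_mul _ _ S (hc _) (hc _), ← cfc_one ℝ S]
  refine cfc_congr fun x hx => ?_
  have hx0 := spectrum_pos_of_posDef hS hx
  have h2 : √x ≠ 0 := (Real.sqrt_pos.2 hx0).ne'
  simp only [Pi.one_apply]
  field_simp
  exact (Real.sq_sqrt hx0.le).symm

/-- Multiplication by the inverse square roots is a bijection from pairs of orthogonal matrices onto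
the feasible pairs and turns the objective into the trace for the whitened matrix. -/
theorem isCCAScores_iff_singVal {Sx Sxy Sy : Matrix (Fin n) (Fin n) ℝ} (hx : Sx.PosDef)
    (hy : Sy.PosDef) (s : Fin n → ℝ) :
    IsCCAScores Sx Sxy Sy s ↔ ∀ i : Fin n, s i = singVal (whitened Sx Sxy Sy) i := by
  rw [← isMax_trace_iff_singVal]
  have hfeas : ∀ {S : Matrix (Fin n) (Fin n) ℝ}, S.PosDef → ∀ O : Matrix (Fin n) (Fin n) ℝ,
      (invSqrt S * O)ᵀ * S * (invSqrt S * O) = Oᵀ * O := by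
    intro S hS O
    calc (invSqrt S * O)ᵀ * S * (invSqrt S * O) = Oᵀ * (invSqrt S * S * invSqrt S) * O := by
          rw [transpose_mul, transpose_invSqrt]
          simp only [Matrix.mul_assoc]
      _ = Oᵀ * O := by rw [invSqrt_mul_mul_invSqrt hS, Matrix.mul_one]
  have hobj : ∀ O O' : Matrix (Fin n) (Fin n) ℝ, (invSqrt Sx * O)ᵀ * Sxy * (invSqrt Sy * O') =
      Oᵀ * whitened Sx Sxy Sy * O' := by
    intro O O'
    rw [transpose_mul, transpose_invSqrt, whitened]
    simp only [Matrix.mul_assoc]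
  have hsurj : ∀ {S : Matrix (Fin n) (Fin n) ℝ}, S.PosDef → ∀ A : Matrix (Fin n) (Fin n) ℝ,
      ∃ O, A = invSqrt S * O := by
    intro S hS A
    refine ⟨S * invSqrt S * A, ?_⟩
    rw [← Matrix.mul_assoc, ← Matrix.mul_assoc, invSqrt_mul_mul_invSqrt hS, Matrix.one_mul]
  refine and_congr_right fun _ => ⟨?_, ?_⟩
  · rintro ⟨A, B, ⟨⟨hA, hB⟩, hmax⟩, hd⟩
    obtain ⟨O, rfl⟩ := hsurj hx A
    obtain ⟨O', rfl⟩ := hsurj hy B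
    rw [hfeas hx] at hA
    rw [hfeas hy] at hB
    refine ⟨O, O', ⟨hA, hB⟩, fun P P' hP hP' => ?_, by rw [← hobj, hd]⟩
    rw [← hobj, ← hobj]
    exact hmax _ _ ⟨by rw [hfeas hx, hP], by rw [hfeas hy, hP']⟩
  · rintro ⟨O, O', ⟨hO, hO'⟩, hmax, hd⟩
    refine ⟨invSqrt Sx * O, invSqrt Sy * O', ⟨⟨by rw [hfeas hx, hO], by rw [hfeas hy, hO']⟩,
      fun A B hAB => ?_⟩, by rw [hobj, hd]⟩
    obtain ⟨P, rfl⟩ := hsurj hx A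
    obtain ⟨P', rfl⟩ := hsurj hy B
    obtain ⟨hP, hP'⟩ := hAB
    rw [hfeas hx] at hP
    rw [hfeas hy] at hP'
    rw [hobj, hobj]
    exact hmax P P' hP hP'

end InvSqrt

/-! ### The covariances of the canonical variables -/

section CanonicalVariables

variable {N M P Q K : ℕ}

theorem transpose_permMatrix_mul_self (τ : Equiv.Perm (Fin N)) :
    (τ.permMatrix ℝ)ᵀ * τ.permMatrix ℝ = 1 := by
  ext i j
  rw [transpose_permMatrix_mul_apply]
  simp [Equiv.Perm.permMatrix, PEquiv.toMatrix_apply, one_apply]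

theorem sampleCov_tailCols (k : ℕ) (C₁ C₂ : Matrix (Fin N) (Fin K) ℝ) :
    sampleCov (tailCols k C₁) (tailCols k C₂) = tailBlock k (sampleCov C₁ C₂) := by
  ext i j
  simp [sampleCov, tailCols, tailBlock, mul_apply]

theorem sampleCov_mul_mul (D₁ : Matrix (Fin N) (Fin P) ℝ) (D₂ : Matrix (Fin N) (Fin Q) ℝ)
    (A : Matrix (Fin P) (Fin K) ℝ) (B : Matrix (Fin Q) (Fin K) ℝ) :
    sampleCov (D₁ * A) (D₂ * B) = Aᵀ * sampleCov D₁ D₂ * B := by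
  simp only [sampleCov, transpose_mul, Matrix.mul_smul, Matrix.smul_mul, Matrix.mul_assoc]

/-- The permutation disappears, because `Pᵀ * P = 1`; it survives only in the cross-covariance. -/
theorem sampleCov_canonX (k : ℕ) (X : Fin P → Fin M) (A : Matrix (Fin P) (Fin K) ℝ)
    (τ : Equiv.Perm (Fin N)) (D : Matrix (Fin N) (Fin M) ℝ) :
    sampleCov (canonX k X A τ D) (canonX k X A τ D) =
      tailBlock k (Aᵀ * sampleCov (cols X D) (cols X D) * A) := by
  rw [canonX, sampleCov_tailCols, sampleCov_mul_mul]
  congr 3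
  rw [sampleCov, sampleCov, transpose_mul, Matrix.mul_assoc,
    ← Matrix.mul_assoc (τ.permMatrix ℝ)ᵀ, transpose_permMatrix_mul_self, Matrix.one_mul]

theorem sampleCov_canonY (k : ℕ) (Y : Fin Q → Fin M) (B : Matrix (Fin Q) (Fin K) ℝ)
    (D : Matrix (Fin N) (Fin M) ℝ) :
    sampleCov (canonY k Y B D) (canonY k Y B D) =
      tailBlock k (Bᵀ * sampleCov (cols Y D) (cols Y D) * B) := by
  rw [canonY, sampleCov_tailCols, sampleCov_mul_mul]

theorem sampleCov_canonX_canonY (k : ℕ) (X : Fin P → Fin M) (Y : Fin Q → Fin M)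
    (A : Matrix (Fin P) (Fin K) ℝ) (B : Matrix (Fin Q) (Fin K) ℝ) (τ : Equiv.Perm (Fin N))
    (D : Matrix (Fin N) (Fin M) ℝ) :
    sampleCov (canonX k X A τ D) (canonY k Y B D) =
      tailBlock k (Aᵀ * permCrossProduct X Y τ D * B) := by
  rw [canonX, canonY, sampleCov_tailCols, sampleCov_mul_mul, sampleCov, permCrossProduct,
    transpose_mul]

theorem whitened_canonical (k : ℕ) (X : Fin P → Fin M) (Y : Fin Q → Fin M)
    (A : Matrix (Fin P) (Fin K) ℝ) (B : Matrix (Fin Q) (Fin K) ℝ) (τ : Equiv.Perm (Fin N))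
    (D : Matrix (Fin N) (Fin M) ℝ) :
    whitened (sampleCov (canonX k X A τ D) (canonX k X A τ D))
      (sampleCov (canonX k X A τ D) (canonY k Y B D))
      (sampleCov (canonY k Y B D) (canonY k Y B D)) =
    scoreMatrix k A B (sampleCov (cols X D) (cols X D)) (permCrossProduct X Y τ D)
      (sampleCov (cols Y D) (cols Y D)) := by
  rw [whitened, scoreMatrix, sampleCov_canonX, sampleCov_canonX_canonY, sampleCov_canonY]

end CanonicalVariables

/-! ### Convergence of the score matrices -/

section ScoreMatrices

variable {α : Type*} {l : Filter α} {n p q K : ℕ}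

/-- The entries of the matrices are bounded, eventually along `l`. -/
def EventuallyBounded (l : Filter α) (G : α → Matrix (Fin p) (Fin q) ℝ) : Prop :=
  ∃ c, ∀ᶠ x in l, ∀ a i, |G x a i| ≤ c

theorem EventuallyBounded.transpose {G : α → Matrix (Fin p) (Fin q) ℝ}
    (h : EventuallyBounded l G) : EventuallyBounded l fun x => (G x)ᵀ := by
  obtain ⟨c, hc⟩ := h
  exact ⟨c, hc.mono fun x hx a i => hx i a⟩

theorem tendsto_mul_mul_zero {m : ℕ} {G : α → Matrix (Fin m) (Fin p) ℝ}
    {S : α → Matrix (Fin p) (Fin q) ℝ} {H : α → Matrix (Fin q) (Fin n) ℝ}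
    (hG : EventuallyBounded l G) (hS : ∀ i j, Tendsto (fun x => S x i j) l (𝓝 0))
    (hH : EventuallyBounded l H) (i : Fin m) (j : Fin n) :
    Tendsto (fun x => (G x * S x * H x) i j) l (𝓝 0) := by
  obtain ⟨c, hc⟩ := hG
  obtain ⟨c', hc'⟩ := hH
  have h : Tendsto (fun x => ∑ b, (∑ a, G x i a * S x a b) * H x b j) l
      (𝓝 (∑ _b : Fin q, (0 : ℝ))) := by
    refine tendsto_finsetSum _ fun b _ => ?_
    have h1 : Tendsto (fun x => ∑ a, G x i a * S x a b) l (𝓝 (∑ _a : Fin p, (0 : ℝ))) := by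
      refine tendsto_finsetSum _ fun a _ => ?_
      exact isBoundedUnder_le_mul_tendsto_zero
        ⟨c, eventually_map.2 (hc.mono fun x hx => hx i a)⟩ (hS a b)
    rw [Finset.sum_const_zero] at h1
    exact h1.zero_mul_isBoundedUnder_le ⟨c', eventually_map.2 (hc'.mono fun x hx => hx b j)⟩
  rw [Finset.sum_const_zero] at h
  exact h.congr fun x => by simp only [mul_apply]

theorem tendsto_matrix {S : α → Matrix (Fin p) (Fin q) ℝ} {S₀ : Matrix (Fin p) (Fin q) ℝ}
    (h : ∀ i j, Tendsto (fun x => S x i j) l (𝓝 (S₀ i j))) : Tendsto S l (𝓝 S₀) :=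
  tendsto_pi_nhds.2 fun i => tendsto_pi_nhds.2 fun j => h i j

/-- The quadratic forms of matrices near a positive definite one are uniformly coercive. -/
theorem exists_eventually_coercive {S₀ : Matrix (Fin n) (Fin n) ℝ} (hS₀ : S₀.PosDef) :
    ∃ c : ℝ, 0 < c ∧ ∀ᶠ S in 𝓝 S₀, ∀ v : Fin n → ℝ, c * (v ⬝ᵥ v) ≤ v ⬝ᵥ S *ᵥ v := by
  set K : Set (Fin n → ℝ) := {v | v ⬝ᵥ v = 1} with hK
  have hKc : IsCompact K := by
    refine (isCompact_univ_pi fun _ : Fin n => isCompact_Icc (a := (-1 : ℝ)) (b := 1)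
      ).of_isClosed_subset ?_ ?_
    · exact isClosed_eq (continuous_id.dotProduct continuous_id) continuous_const
    · intro v hv i _
      have h1 : v i * v i ≤ 1 := by
        rw [← show v ⬝ᵥ v = 1 from hv]
        exact Finset.single_le_sum (f := fun i => v i * v i) (fun i _ => mul_self_nonneg _)
          (Finset.mem_univ i)
      exact abs_le.1 (abs_le_one_iff_mul_self_le_one.2 h1)
  have hcont : Continuous fun z : Matrix (Fin n) (Fin n) ℝ × (Fin n → ℝ) => z.2 ⬝ᵥ z.1 *ᵥ z.2 :=
    continuous_snd.dotProduct (continuous_fst.matrix_mulVec continuous_snd)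
  have hpos : ∀ v ∈ K, 0 < v ⬝ᵥ S₀ *ᵥ v := by
    intro v hv
    refine hS₀.dotProduct_mulVec_pos (x := v) fun h0 => ?_
    have h1 : v ⬝ᵥ v = 1 := hv
    rw [h0, zero_dotProduct] at h1
    exact zero_ne_one h1
  obtain ⟨c, hc0, hc⟩ : ∃ c : ℝ, 0 < c ∧ ∀ v ∈ K, c < v ⬝ᵥ S₀ *ᵥ v := by
    -- The unit sphere is empty in dimension zero, where any constant serves.
    rcases K.eq_empty_or_nonempty with he | hne
    · exact ⟨1, one_pos, by simp [he]⟩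
    · obtain ⟨w, hw, hmin⟩ := hKc.exists_isMinOn hne
        (f := fun v => v ⬝ᵥ S₀ *ᵥ v) (hcont.comp (by fun_prop : Continuous fun v => (S₀, v))).continuousOn
      refine ⟨(w ⬝ᵥ S₀ *ᵥ w) / 2, half_pos (hpos w hw), fun v hv => ?_⟩
      exact (half_lt_self (hpos w hw)).trans_le (hmin hv)
  have hev : ∀ᶠ S in 𝓝 S₀, ∀ v ∈ K, c < v ⬝ᵥ S *ᵥ v :=
    hKc.eventually_forall_of_forall_eventually fun v hv =>
      (hcont.tendsto (S₀, v)).eventually (lt_mem_nhds (hc v hv))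
  refine ⟨c, hc0, hev.mono fun S hS v => ?_⟩
  by_cases hv : v = 0
  · simp [hv]
  have hvv : 0 < v ⬝ᵥ v := by
    refine lt_of_le_of_ne (Finset.sum_nonneg fun i _ => mul_self_nonneg _) fun h => hv ?_
    exact dotProduct_self_eq_zero.1 h.symm
  set t := √(v ⬝ᵥ v) with ht
  have ht0 : 0 < t := Real.sqrt_pos.2 hvv
  have htt : t * t = v ⬝ᵥ v := Real.mul_self_sqrt hvv.le
  have h1 := hS (t⁻¹ • v) (by
    show (t⁻¹ • v) ⬝ᵥ (t⁻¹ • v) = 1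
    rw [smul_dotProduct, dotProduct_smul, ← htt]
    simp only [smul_eq_mul]
    field_simp)
  rw [smul_dotProduct, mulVec_smul, dotProduct_smul, smul_eq_mul, smul_eq_mul, ← mul_assoc,
    ← mul_inv, htt, inv_mul_eq_div, lt_div_iff₀ hvv] at h1
  exact h1.le

theorem eventually_posDef {S : α → Matrix (Fin n) (Fin n) ℝ} {S₀ : Matrix (Fin n) (Fin n) ℝ}
    (hS₀ : S₀.PosDef) (hS : Tendsto S l (𝓝 S₀)) (hh : ∀ᶠ x in l, (S x).IsHermitian) :
    ∀ᶠ x in l, (S x).PosDef := by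
  obtain ⟨c, hc0, hc⟩ := exists_eventually_coercive hS₀
  filter_upwards [hS.eventually hc, hh] with x h1 h2
  refine .of_dotProduct_mulVec_pos h2 fun v hv => ?_
  refine lt_of_lt_of_le (mul_pos hc0 ?_) (h1 v)
  refine lt_of_le_of_ne (Finset.sum_nonneg fun i _ => mul_self_nonneg _) fun h => hv ?_
  exact dotProduct_self_eq_zero.1 h.symm

/-- A column `g` satisfies `c * (g ⬝ᵥ g) ≤ g ⬝ᵥ S *ᵥ g = 1` by uniform coercivity. No convergence of
`G` is needed. -/
theorem eventuallyBounded_of_transpose_mul_mul {S : α → Matrix (Fin n) (Fin n) ℝ}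
    {S₀ : Matrix (Fin n) (Fin n) ℝ} (hS₀ : S₀.PosDef) (hS : Tendsto S l (𝓝 S₀))
    {G : α → Matrix (Fin n) (Fin K) ℝ} (hG : ∀ᶠ x in l, (G x)ᵀ * S x * G x = 1) :
    EventuallyBounded l G := by
  obtain ⟨c, hc0, hc⟩ := exists_eventually_coercive hS₀
  -- A number `t` with `t ^ 2 ≤ c⁻¹` has `|t| ≤ (t ^ 2 + 1) / 2`.
  refine ⟨c⁻¹ + 1, ?_⟩
  filter_upwards [hS.eventually hc, hG] with x h1 h2 a i
  have h3 := congrFun (congrFun h2 i) i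
  have h4 : ((G x)ᵀ * S x * G x) i i = (fun a => G x a i) ⬝ᵥ S x *ᵥ fun a => G x a i := by
    rw [Matrix.mul_assoc, mul_apply]
    rfl
  rw [h4, one_apply_eq] at h3
  have h5 := h1 fun a => G x a i
  rw [h3] at h5
  have h6 : G x a i * G x a i ≤ (fun a => G x a i) ⬝ᵥ fun a => G x a i :=
    Finset.single_le_sum (f := fun a => G x a i * G x a i) (fun a _ => mul_self_nonneg _)
      (Finset.mem_univ a)
  have h7 : G x a i * G x a i ≤ c⁻¹ := by
    rw [← one_div, le_div_iff₀' hc0]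
    exact (mul_le_mul_of_nonneg_left h6 hc0.le).trans h5
  rw [abs_le]
  constructor <;> nlinarith [sq_nonneg (G x a i - 1), sq_nonneg (G x a i + 1)]

/-- The inverse square root `G` itself satisfies `Gᵀ * S * G = 1`. This avoids any continuity of the
functional calculus in the matrix. -/
theorem eventuallyBounded_invSqrt {S : α → Matrix (Fin n) (Fin n) ℝ}
    {S₀ : Matrix (Fin n) (Fin n) ℝ} (hS₀ : S₀.PosDef) (hS : Tendsto S l (𝓝 S₀))
    (hh : ∀ᶠ x in l, (S x).IsHermitian) : EventuallyBounded l fun x => invSqrt (S x) := by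
  refine eventuallyBounded_of_transpose_mul_mul hS₀ hS ?_
  filter_upwards [eventually_posDef hS₀ hS hh] with x hx
  rw [transpose_invSqrt, invSqrt_mul_mul_invSqrt hx]

theorem IsCCAProjection.transpose_mul_mul_eq_one {Sx : Matrix (Fin p) (Fin p) ℝ}
    {Sxy : Matrix (Fin p) (Fin q) ℝ} {Sy : Matrix (Fin q) (Fin q) ℝ} {A : Matrix (Fin p) (Fin K) ℝ}
    {B : Matrix (Fin q) (Fin K) ℝ} (h : IsCCAProjection Sx Sxy Sy A B) (hx : Sx.PosDef)
    (hy : Sy.PosDef) : Aᵀ * Sx * A = 1 ∧ Bᵀ * Sy * B = 1 := by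
  obtain ⟨U, s, V, ⟨hU, hV, -⟩, rfl, rfl⟩ := h
  have key : ∀ {m : ℕ} {S : Matrix (Fin m) (Fin m) ℝ} {G : Matrix (Fin m) (Fin K) ℝ}, S.PosDef →
      Gᵀ * G = 1 → ((invSqrt S)ᵀ * G)ᵀ * S * ((invSqrt S)ᵀ * G) = 1 := by
    intro m S G hS hG
    rw [transpose_invSqrt, transpose_mul, transpose_invSqrt]
    calc Gᵀ * invSqrt S * S * (invSqrt S * G) = Gᵀ * (invSqrt S * S * invSqrt S) * G := by
          simp only [Matrix.mul_assoc]
      _ = 1 := by rw [invSqrt_mul_mul_invSqrt hS, Matrix.mul_one, hG]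
  exact ⟨key hx hU, key hy (by rw [transpose_transpose, hV])⟩

theorem isHermitian_transpose_mul_mul {S : Matrix (Fin n) (Fin n) ℝ} (hS : S.IsHermitian)
    (A : Matrix (Fin n) (Fin K) ℝ) (k : ℕ) : (tailBlock k (Aᵀ * S * A)).IsHermitian := by
  have hS' : Sᵀ = S := by
    rw [← conjTranspose_eq_transpose_of_trivial]
    exact hS
  have h : (Aᵀ * S * A).IsHermitian := by
    rw [IsHermitian, conjTranspose_eq_transpose_of_trivial, transpose_mul, transpose_mul,
      transpose_transpose, hS', Matrix.mul_assoc]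
  exact h.submatrix _

theorem isHermitian_sampleCov {N : ℕ} (D : Matrix (Fin N) (Fin p) ℝ) :
    (sampleCov D D).IsHermitian := by
  rw [IsHermitian, conjTranspose_eq_transpose_of_trivial, sampleCov, transpose_smul, transpose_mul,
    transpose_transpose]

/-- The covariance of variables that are uncorrelated for one consistent estimate tends to the
identity for every consistent estimate. -/
theorem tendsto_tailBlock_one {S₀ : Matrix (Fin n) (Fin n) ℝ} (hS₀ : S₀.PosDef)
    {R S : α → Matrix (Fin n) (Fin n) ℝ} (hR : Tendsto R l (𝓝 S₀)) (hS : Tendsto S l (𝓝 S₀))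
    {A : α → Matrix (Fin n) (Fin K) ℝ} (hA : ∀ᶠ x in l, (A x)ᵀ * R x * A x = 1) (k : ℕ) :
    Tendsto (fun x => tailBlock k ((A x)ᵀ * S x * A x)) l (𝓝 1) := by
  have hb := eventuallyBounded_of_transpose_mul_mul hS₀ hR hA
  -- `Aᵀ * S * A` differs from the identity by `Aᵀ * (S - R) * A`, whose middle factor vanishes
  -- while `A` stays bounded.
  have hd : ∀ i j, Tendsto (fun x => (S x - R x) i j) l (𝓝 0) := by
    intro i j
    have h1 := tendsto_pi_nhds.1 (tendsto_pi_nhds.1 (hS.sub hR) i) j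
    rw [sub_self] at h1
    exact h1
  have h2 := tendsto_mul_mul_zero hb.transpose hd hb
  refine tendsto_matrix fun i j => ?_
  have h3 := (h2 (tailIdx k i) (tailIdx k j)).add_const
    ((1 : Matrix (Fin K) (Fin K) ℝ) (tailIdx k i) (tailIdx k j))
  have h4 : (1 : Matrix (Fin K) (Fin K) ℝ) (tailIdx k i) (tailIdx k j) =
      (1 : Matrix (Fin (K - k)) (Fin (K - k)) ℝ) i j := by
    simp only [one_apply, tailIdx, Nat.add_left_cancel_iff, Fin.ext_iff]
  rw [zero_add, h4] at h3
  refine h3.congr' ?_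
  filter_upwards [hA] with x hx
  rw [← h4, ← hx, ← Matrix.add_apply, ← Matrix.add_mul, ← Matrix.mul_add, sub_add_cancel]
  rfl

/-- All outer factors are bounded and the cross-covariance vanishes. The covariances `SX`, `SY` need
not be those that define `A` and `B`, so the lemma covers both the estimated and the empirical
expression. -/
theorem tendsto_scoreMatrix_zero {Sx : Matrix (Fin p) (Fin p) ℝ} {Sy : Matrix (Fin q) (Fin q) ℝ}
    (hSx : Sx.PosDef) (hSy : Sy.PosDef) {Rx SX : α → Matrix (Fin p) (Fin p) ℝ}
    {Ry SY : α → Matrix (Fin q) (Fin q) ℝ} {SXY : α → Matrix (Fin p) (Fin q) ℝ}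
    (hRx : Tendsto Rx l (𝓝 Sx)) (hRy : Tendsto Ry l (𝓝 Sy)) (hSX : Tendsto SX l (𝓝 Sx))
    (hSY : Tendsto SY l (𝓝 Sy)) (hSXh : ∀ᶠ x in l, (SX x).IsHermitian)
    (hSYh : ∀ᶠ x in l, (SY x).IsHermitian) {A : α → Matrix (Fin p) (Fin K) ℝ}
    {B : α → Matrix (Fin q) (Fin K) ℝ} (hA : ∀ᶠ x in l, (A x)ᵀ * Rx x * A x = 1)
    (hB : ∀ᶠ x in l, (B x)ᵀ * Ry x * B x = 1)
    (hSXY : ∀ i j, Tendsto (fun x => SXY x i j) l (𝓝 0)) (k : ℕ) (i j : Fin (K - k)) :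
    Tendsto (fun x => scoreMatrix k (A x) (B x) (SX x) (SXY x) (SY x) i j) l (𝓝 0) := by
  have hbA := eventuallyBounded_of_transpose_mul_mul hSx hRx hA
  have hbB := eventuallyBounded_of_transpose_mul_mul hSy hRy hB
  have hm := tendsto_mul_mul_zero hbA.transpose hSXY hbB
  exact tendsto_mul_mul_zero
    (eventuallyBounded_invSqrt .one (tendsto_tailBlock_one hSx hRx hSX hA k)
      (hSXh.mono fun x hx => isHermitian_transpose_mul_mul hx _ k))
    (fun a b => hm (tailIdx k a) (tailIdx k b))
    (eventuallyBounded_invSqrt .one (tendsto_tailBlock_one hSy hRy hSY hB k)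
      (hSYh.mono fun x hx => isHermitian_transpose_mul_mul hx _ k)) i j

theorem tendsto_singVal_zero {W : α → Matrix (Fin n) (Fin n) ℝ}
    (hW : ∀ i j, Tendsto (fun x => W x i j) l (𝓝 0)) (i : Fin n) :
    Tendsto (fun x => singVal (W x) i) l (𝓝 0) := by
  have h : Tendsto (fun x => ∑ b, ∑ a, |W x a b|) l (𝓝 (∑ _b : Fin n, ∑ _a : Fin n, |(0 : ℝ)|)) :=
    tendsto_finsetSum _ fun b _ => tendsto_finsetSum _ fun a _ => (hW a b).abs
  simp only [abs_zero, Finset.sum_const_zero] at h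
  exact squeeze_zero (fun x => singVal_nonneg _ _) (fun x => singVal_le_sum_abs _ i) h

end ScoreMatrices

end

/-! ### The main theorem: estimate and target have the common limit zero. -/

theorem theorem5
    {Ω : Type*} [MeasurableSpace Ω] (μ : Measure Ω) [IsProbabilityMeasure μ]
    -- the variables, the index sets of `X` and `Y` (which may overlap), and the block `k:`
    (M P Q K k : ℕ) (X : Fin P → Fin M) (Y : Fin Q → Fin M)
    (hX : Function.Injective X) (hY : Function.Injective Y)
    (hK : K = min P Q) (hk : k < K)
    -- i.i.d. jointly Gaussian observations with zero means and unit variances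
    (Z : ℕ → Ω → Fin M → ℝ) (hZm : ∀ n, Measurable (Z n)) (hZi : iIndepFun Z μ)
    (hZd : ∀ n, IdentDistrib (Z n) (Z 0) μ μ) (hZg : HasGaussianLaw (Z 0) μ)
    (hmean : ∀ j, ∫ ω, Z 0 ω j ∂μ = 0) (hvar : ∀ j, popCov μ (Z 0) j j = 1)
    -- nondegeneracy: the whitening of `X` and of `Y` is possible, no two variables coincide
    (hcovX : ((popCov μ (Z 0)).submatrix X X).PosDef)
    (hcovY : ((popCov μ (Z 0)).submatrix Y Y).PosDef)
    (hcorr : ∀ i j, i ≠ j → |popCov μ (Z 0) i j| < 1)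
    -- the discretized variables, their numbers of levels and their thresholds
    (disc : Fin M → Bool) (C : Fin M → ℕ) (T : Fin M → ℕ → EReal)
    (hC : ∀ j, disc j = true → 2 ≤ C j ∧ IsThresholds (C j) (T j))
    -- a uniformly random permutation for every sample size, independent of the data
    (σ : (N : ℕ) → Ω → Equiv.Perm (Fin N))
    (hσ : ∀ N, IsUniformIndepPerm μ (σ N) (fun ω (n : Fin N) => Z n ω))
    -- the estimated correlation matrix, from the accessible data, whenever the minimum is attained
    (R : ℕ → Ω → Matrix (Fin M) (Fin M) ℝ)
    (hR : ∀ N ω, (∃ S, IsPairwiseMLE disc (observe disc C T (dataMatrix Z N ω)) S) →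
      IsPairwiseMLE disc (observe disc C T (dataMatrix Z N ω)) (R N ω))
    -- the same estimate from the accessible data of `X` and the permuted accessible data of `Y`
    (Rσ : ℕ → Ω → Matrix (Fin (P + Q)) (Fin (P + Q)) ℝ)
    (hRσ : ∀ N ω,
      (∃ S, IsPairwiseMLE (Fin.append (disc ∘ X) (disc ∘ Y))
        (permData X Y (σ N ω) (observe disc C T (dataMatrix Z N ω))) S) →
      IsPairwiseMLE (Fin.append (disc ∘ X) (disc ∘ Y))
        (permData X Y (σ N ω) (observe disc C T (dataMatrix Z N ω))) (Rσ N ω))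
    -- the projection matrices of the CCA problem with the estimated covariances
    (A : ℕ → Ω → Matrix (Fin P) (Fin K) ℝ) (B : ℕ → Ω → Matrix (Fin Q) (Fin K) ℝ)
    (hAB : ∀ N ω, IsCCAProjection ((R N ω).submatrix X X) ((R N ω).submatrix X Y)
      ((R N ω).submatrix Y Y) (A N ω) (B N ω))
    -- the data of the last `K - k` canonical variables under a permutation
    (CX : (N : ℕ) → Ω → Equiv.Perm (Fin N) → Matrix (Fin N) (Fin (K - k)) ℝ)
    (hCX : ∀ N ω τ, CX N ω τ = canonX k X (A N ω) τ (dataMatrix Z N ω))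
    (CY : (N : ℕ) → Ω → Matrix (Fin N) (Fin (K - k)) ℝ)
    (hCY : ∀ N ω, CY N ω = canonY k Y (B N ω) (dataMatrix Z N ω))
    -- their empirical CCA scores under the random permutation
    (r : (N : ℕ) → Ω → Fin (K - k) → ℝ)
    (hr : ∀ N ω,
      (∃ s : Fin (K - k) → ℝ, IsCCAScores (sampleCov (CX N ω (σ N ω)) (CX N ω (σ N ω)))
        (sampleCov (CX N ω (σ N ω)) (CY N ω)) (sampleCov (CY N ω) (CY N ω)) s) →
      IsCCAScores (sampleCov (CX N ω (σ N ω)) (CX N ω (σ N ω)))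
        (sampleCov (CX N ω (σ N ω)) (CY N ω)) (sampleCov (CY N ω) (CY N ω)) (r N ω)) :
    -- under every permutation, the CCA scores are the singular values of the whitened
    -- cross-covariance
    (∀ (N : ℕ) (ω : Ω) (τ : Equiv.Perm (Fin N)),
      (sampleCov (CX N ω τ) (CX N ω τ)).PosDef → (sampleCov (CY N ω) (CY N ω)).PosDef →
      ∀ s : Fin (K - k) → ℝ,
        IsCCAScores (sampleCov (CX N ω τ) (CX N ω τ)) (sampleCov (CX N ω τ) (CY N ω))
          (sampleCov (CY N ω) (CY N ω)) s ↔
        ∀ i : Fin (K - k), s i = singVal (whitened (sampleCov (CX N ω τ) (CX N ω τ))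
          (sampleCov (CX N ω τ) (CY N ω)) (sampleCov (CY N ω) (CY N ω))) i) ∧
    -- which is given by the explicit expression
    (∀ (N : ℕ) (ω : Ω) (τ : Equiv.Perm (Fin N)),
      whitened (sampleCov (CX N ω τ) (CX N ω τ)) (sampleCov (CX N ω τ) (CY N ω))
          (sampleCov (CY N ω) (CY N ω)) =
        scoreMatrix k (A N ω) (B N ω)
          (sampleCov (cols X (dataMatrix Z N ω)) (cols X (dataMatrix Z N ω)))
          (permCrossProduct X Y τ (dataMatrix Z N ω))
          (sampleCov (cols Y (dataMatrix Z N ω)) (cols Y (dataMatrix Z N ω)))) ∧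
    -- with probability tending to one, the covariances of the canonical variables are nonsingular
    -- and the estimates exist
    WithProbTendingToOne μ (fun N ω =>
      (sampleCov (CX N ω (σ N ω)) (CX N ω (σ N ω))).PosDef ∧
      (sampleCov (CY N ω) (CY N ω)).PosDef ∧
      IsPairwiseMLE disc (observe disc C T (dataMatrix Z N ω)) (R N ω) ∧
      IsPairwiseMLE (Fin.append (disc ∘ X) (disc ∘ Y))
        (permData X Y (σ N ω) (observe disc C T (dataMatrix Z N ω))) (Rσ N ω)) ∧
    -- the permuted cross-product is estimated consistently from the accessible data
    (∀ (i : Fin P) (j : Fin Q), ConsistentlyEstimates μ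
      (fun N ω => Rσ N ω (Fin.castAdd Q i) (Fin.natAdd P j))
      (fun N ω => permCrossProduct X Y (σ N ω) (dataMatrix Z N ω) i j)) ∧
    -- the expression at the estimates is a consistent estimate of the whitened cross-covariance
    (∀ i j : Fin (K - k), ConsistentlyEstimates μ
      (fun N ω => scoreMatrix k (A N ω) (B N ω) ((R N ω).submatrix X X)
        ((Rσ N ω).submatrix (Fin.castAdd Q) (Fin.natAdd P)) ((R N ω).submatrix Y Y) i j)
      (fun N ω => whitened (sampleCov (CX N ω (σ N ω)) (CX N ω (σ N ω)))
        (sampleCov (CX N ω (σ N ω)) (CY N ω)) (sampleCov (CY N ω) (CY N ω)) i j)) ∧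
    -- and its singular values are consistent estimates of the CCA scores
    (∀ i : Fin (K - k), ConsistentlyEstimates μ
      (fun N ω => singVal (scoreMatrix k (A N ω) (B N ω) ((R N ω).submatrix X X)
        ((Rσ N ω).submatrix (Fin.castAdd Q) (Fin.natAdd P)) ((R N ω).submatrix Y Y)) i)
      (fun N ω => r N ω i)) := by
  have hZ : IsGaussianSample μ Z := ⟨hZm, hZi, hZd, hZg, hmean, hvar⟩
  have hN := eventually_fst_ge_probFilter μ 1
  have hD : ∀ i j, i ≠ j → PairLLN (probFilter μ) (fun N ω n => dataMatrix Z N ω n i)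
      (fun N ω n => dataMatrix Z N ω n j) (popCov μ (Z 0) i j) :=
    fun i j hij => hZ.pairLLN (hcorr i j hij)
  have hpc := hZ.isPseudoCorrelation_popCov hcorr
  have hmle : ∀ᶠ x in probFilter μ,
      IsPairwiseMLE disc (observe disc C T (dataMatrix Z x.1 x.2)) (R x.1 x.2) :=
    (eventually_exists_isPairwiseMLE hC hpc hN hD).mono fun x hx => hR x.1 x.2 hx
  have hRlim := tendsto_of_isPairwiseMLE hC hpc hN hD hmle
  have hCσ : ∀ j, Fin.append (disc ∘ X) (disc ∘ Y) j = true →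
      2 ≤ Fin.append (C ∘ X) (C ∘ Y) j ∧
        IsThresholds (Fin.append (C ∘ X) (C ∘ Y) j) (Fin.append (T ∘ X) (T ∘ Y) j) := by
    intro j
    refine Fin.addCases (fun i => ?_) (fun i => ?_) j
    · simpa using hC (X i)
    · simpa using hC (Y i)
  have hpcσ := isPseudoCorrelation_blockCov hvar hcorr hX hY hcovX hcovY.posSemidef
  have hDσ := hZ.pairLLN_permData hcorr hX hY hσ
  have hmleσ : ∀ᶠ x in probFilter μ, IsPairwiseMLE (Fin.append (disc ∘ X) (disc ∘ Y))
      (permData X Y (σ x.1 x.2) (observe disc C T (dataMatrix Z x.1 x.2))) (Rσ x.1 x.2) := by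
    refine (eventually_exists_isPairwiseMLE hCσ hpcσ hN hDσ).mono fun x hx => hRσ x.1 x.2 ?_
    rw [permData_observe]
    exact hx
  have hRσlim := tendsto_of_isPairwiseMLE (R := Rσ) hCσ hpcσ hN hDσ (hmleσ.mono fun x hx => by
    rw [← permData_observe]
    exact hx)
  have hRσXY : ∀ i j, Tendsto (fun x : ℕ × Ω => Rσ x.1 x.2 (Fin.castAdd Q i) (Fin.natAdd P j))
      (probFilter μ) (𝓝 0) := by
    intro i j
    have h := hRσlim (Fin.castAdd Q i) (Fin.natAdd P j)
    rwa [blockCov_castAdd_natAdd] at h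
  have hperm : ∀ i j, Tendsto (fun x : ℕ × Ω =>
      permCrossProduct X Y (σ x.1 x.2) (dataMatrix Z x.1 x.2) i j) (probFilter μ) (𝓝 0) :=
    fun i j => hZ.tendsto_permCrossProduct hσ i j
  have hRX : Tendsto (fun x : ℕ × Ω => (R x.1 x.2).submatrix X X) (probFilter μ)
      (𝓝 ((popCov μ (Z 0)).submatrix X X)) := tendsto_matrix fun i j => hRlim (X i) (X j)
  have hRY : Tendsto (fun x : ℕ × Ω => (R x.1 x.2).submatrix Y Y) (probFilter μ)
      (𝓝 ((popCov μ (Z 0)).submatrix Y Y)) := tendsto_matrix fun i j => hRlim (Y i) (Y j)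
  have hRXh : ∀ᶠ x in probFilter μ, ((R x.1 x.2).submatrix X X).IsHermitian :=
    hmle.mono fun x hx => hx.1.1.isHermitian.submatrix X
  have hRYh : ∀ᶠ x in probFilter μ, ((R x.1 x.2).submatrix Y Y).IsHermitian :=
    hmle.mono fun x hx => hx.1.1.isHermitian.submatrix Y
  have hSX : Tendsto (fun x : ℕ × Ω => sampleCov (cols X (dataMatrix Z x.1 x.2))
      (cols X (dataMatrix Z x.1 x.2))) (probFilter μ) (𝓝 ((popCov μ (Z 0)).submatrix X X)) :=
    tendsto_matrix fun i j => hZ.tendsto_sampleCov hcorr hX hσ i j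
  have hSY : Tendsto (fun x : ℕ × Ω => sampleCov (cols Y (dataMatrix Z x.1 x.2))
      (cols Y (dataMatrix Z x.1 x.2))) (probFilter μ) (𝓝 ((popCov μ (Z 0)).submatrix Y Y)) :=
    tendsto_matrix fun i j => hZ.tendsto_sampleCov hcorr hY hσ i j
  -- The relation `Aᵀ * R * A = 1` holds once the estimated blocks are positive definite, which
  -- consistency ensures with probability tending to one.
  have hproj : ∀ᶠ x in probFilter μ,
      (A x.1 x.2)ᵀ * (R x.1 x.2).submatrix X X * A x.1 x.2 = 1 ∧
      (B x.1 x.2)ᵀ * (R x.1 x.2).submatrix Y Y * B x.1 x.2 = 1 := by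
    filter_upwards [eventually_posDef hcovX hRX hRXh, eventually_posDef hcovY hRY hRYh] with x h1 h2
    exact (hAB x.1 x.2).transpose_mul_mul_eq_one h1 h2
  have hA := hproj.mono fun x hx => hx.1
  have hB := hproj.mono fun x hx => hx.2
  have hposX : ∀ᶠ x in probFilter μ,
      (sampleCov (CX x.1 x.2 (σ x.1 x.2)) (CX x.1 x.2 (σ x.1 x.2))).PosDef := by
    simp only [hCX, sampleCov_canonX]
    exact eventually_posDef .one (tendsto_tailBlock_one hcovX hRX hSX hA k)
      (Eventually.of_forall fun x => isHermitian_transpose_mul_mul (isHermitian_sampleCov _) _ k)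
  have hposY : ∀ᶠ x in probFilter μ, (sampleCov (CY x.1 x.2) (CY x.1 x.2)).PosDef := by
    simp only [hCY, sampleCov_canonY]
    exact eventually_posDef .one (tendsto_tailBlock_one hcovY hRY hSY hB k)
      (Eventually.of_forall fun x => isHermitian_transpose_mul_mul (isHermitian_sampleCov _) _ k)
  have hest : ∀ i j, Tendsto (fun x : ℕ × Ω => scoreMatrix k (A x.1 x.2) (B x.1 x.2)
      ((R x.1 x.2).submatrix X X) ((Rσ x.1 x.2).submatrix (Fin.castAdd Q) (Fin.natAdd P))
      ((R x.1 x.2).submatrix Y Y) i j) (probFilter μ) (𝓝 0) :=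
    tendsto_scoreMatrix_zero hcovX hcovY hRX hRY hRX hRY hRXh hRYh hA hB hRσXY k
  have hemp : ∀ i j, Tendsto (fun x : ℕ × Ω => whitened
      (sampleCov (CX x.1 x.2 (σ x.1 x.2)) (CX x.1 x.2 (σ x.1 x.2)))
      (sampleCov (CX x.1 x.2 (σ x.1 x.2)) (CY x.1 x.2))
      (sampleCov (CY x.1 x.2) (CY x.1 x.2)) i j) (probFilter μ) (𝓝 0) := by
    simp only [hCX, hCY, whitened_canonical]
    exact tendsto_scoreMatrix_zero hcovX hcovY hRX hRY hSX hSY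
      (Eventually.of_forall fun x => isHermitian_sampleCov _)
      (Eventually.of_forall fun x => isHermitian_sampleCov _) hA hB hperm k
  -- The scores are determined only when the covariances of the canonical variables are nonsingular;
  -- there they exist, and they are the singular values of the vanishing matrix `W`.
  have hrlim : ∀ i, Tendsto (fun x : ℕ × Ω => r x.1 x.2 i) (probFilter μ) (𝓝 0) := by
    intro i
    refine (tendsto_singVal_zero hemp i).congr' ?_
    filter_upwards [hposX, hposY] with x h1 h2
    have h3 := isCCAScores_iff_singVal (Sxy := sampleCov (CX x.1 x.2 (σ x.1 x.2)) (CY x.1 x.2))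
      h1 h2
    exact ((h3 _).1 (hr x.1 x.2 ⟨_, (h3 _).2 fun _ => rfl⟩) i).symm
  refine ⟨fun N ω τ h1 h2 s => isCCAScores_iff_singVal h1 h2 s, fun N ω τ => ?_, ?_,
    fun i j => ?_, fun i j => ?_, fun i => ?_⟩
  · rw [hCX, hCY, whitened_canonical]
  · rw [withProbTendingToOne_iff]
    filter_upwards [hposX, hposY, hmle, hmleσ] with x h1 h2 h3 h4
    exact ⟨h1, h2, h3, h4⟩
  · rw [consistentlyEstimates_iff]
    simpa using (hRσXY i j).sub (hperm i j)
  · rw [consistentlyEstimates_iff]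
    simpa using (hest i j).sub (hemp i j)
  · rw [consistentlyEstimates_iff]
    simpa using (tendsto_singVal_zero hest i).sub (hrlim i)
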